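/- **Theorem (Construction of the canonical model).** Consider the following categories. * $\mathbf{ConcPrb}$: probability spaces $(X,\Sigma,\mu)$; morphisms are measurable measure-preserving maps. * $\mathbf{AbsPrb}$: pairs $(\mathcal B,\mu)$ of a $\sigma$-complete Boolean algebra and a countably additive probability measure $\mu:\mathcal B\to[0,1]$; a morphism $(\mathcal B,\mu)\to(\mathcal C,\nu)$ is a Boolean homomorphism $\mathcal C\to\mathcal B$ preserving countable joins and meets and carrying $\mu$ back to $\nu$. $\mathbf{PrbAlg}$ (probability algebras): the objects of $\mathbf{AbsPrb}$ with $\mu(E)>0$ for all $E\neq 0$, with the same morphisms. * $\mathbf{vN}^\tau$: commutative von Neumann algebras $\mathcal A$ (equivalently, commutative unital $C^*$-algebras with a Banach space predual) with a faithful normal trace, that is, a normal $*$-linear functional $\tau:\mathcal A\to\mathbb C$ with $\tau(1)=1$ and $\tau(aa^*)\ge 0$, with equality iff $a=0$; morphisms are trace-preserving normal unital $*$-homomorphisms. * $\mathbf{C^*Alg}^\tau$: commutative unital $C^*$-algebras with a state; morphisms are state-preserving unital $*$-homomorphisms. * $\mathbf{CHPrb}$: compact Hausdorff spaces with a Radon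 probability measure on the Baire $\sigma$-algebra (Radon: inner regular with respect to compact $G_\delta$ sets); morphisms are continuous measure-preserving maps. These are categories, and the following are well-defined functors between them. * $\mathtt{Abs}:\mathbf{ConcPrb}\to\mathbf{AbsPrb}$, $(X,\Sigma,\mu)\mapsto(\Sigma,\mu)$, and $\mathtt{Mes}:\mathbf{AbsPrb}\to\mathbf{PrbAlg}$, the quotient by the ideal of null elements. * $L^\infty:\mathbf{ConcPrb}\to(\mathbf{vN}^\tau)^{op}$: classes of bounded measurable functions $X\to\mathbb C$ modulo a.e. equality, with pointwise operations, the essential supremum norm and the trace $\int_X f\,d\mu$; a morphism $T$ goes to $[f]\mapsto[f\circ T]$. * $L^\infty:\mathbf{PrbAlg}\to(\mathbf{vN}^\tau)^{op}$: bounded abstractly measurable functions $f:X\to\mathbb C$, i.e. Boolean homomorphisms preserving countable joins and meets from the Borel $\sigma$-algebra of $\mathbb C$ to the algebra of $X$ that send some disc $\{|z|\le M\}$ to $1$, with the operations induced from those of $\mathbb C$ (a binary operation is applied to the joint map into $\mathbb C\times\mathbb C$), the norm equal to the infimum of such $M$, and the trace with $\tau(1_E)=\mu(E)$; morphisms go to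 Koopman operators $f\mapsto f\circ T$. On $\mathbf{AbsPrb}$, put $L^\infty:=L^\infty\circ\mathtt{Mes}$. * $\mathtt{Idem}:(\mathbf{vN}^\tau)^{op}\to\mathbf{PrbAlg}$: the algebra of projections $p=p^*=p^2$ with $p\wedge q=pq$, $\overline p=1-p$, $p\vee q=1-(1-p)(1-q)$ and measure $\tau$; morphisms are restricted to projections. * $C:\mathbf{CHPrb}\to(\mathbf{C^*Alg}^\tau)^{op}$: continuous functions with the state $f\mapsto\int f\,d\mu$, and $T\mapsto(f\mapsto f\circ T)$. * $\mathtt{Riesz}:(\mathbf{C^*Alg}^\tau)^{op}\to\mathbf{CHPrb}$: the Gelfand spectrum with the unique Radon probability measure representing the state; $\Phi\mapsto(\lambda\mapsto\lambda\circ\Phi)$. * The forgetful functor $\mathtt{Forget}:(\mathbf{vN}^\tau)^{op}\to(\mathbf{C^*Alg}^\tau)^{op}$, and the canonical model functor $\mathtt{Stone}:=\mathtt{Riesz}\circ\mathtt{Forget}\circ L^\infty:\mathbf{PrbAlg}\to\mathbf{CHPrb}$. The functors $L^\infty$ on $\mathbf{PrbAlg}$, $\mathtt{Idem}$, $\mathtt{Forget}$,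 $C$, $\mathtt{Riesz}$ and $\mathtt{Stone}$ are full and faithful. The diagram formed by these functors commutes up to natural isomorphism: $L^\infty\cong L^\infty\circ\mathtt{Abs}$ on $\mathbf{ConcPrb}$ and $L^\infty\cong L^\infty\circ\mathtt{Mes}$ on $\mathbf{AbsPrb}$; $\mathtt{Idem}\circ L^\infty\cong\mathrm{id}$ and $L^\infty\circ\mathtt{Idem}\cong\mathrm{id}$; $\mathtt{Riesz}\circ C\cong\mathrm{id}$ and $C\circ\mathtt{Riesz}\cong\mathrm{id}$; $\mathtt{Stone}\cong\mathtt{Riesz}\circ\mathtt{Forget}\circ L^\infty$, $C\circ\mathtt{Stone}\cong\mathtt{Forget}\circ L^\infty$, $\mathtt{Stone}\circ\mathtt{Idem}\cong\mathtt{Riesz}\circ\mathtt{Forget}$ and $C\circ\mathtt{Stone}\circ\mathtt{Idem}\cong\mathtt{Forget}$. In particular, $L^\infty$ and $\mathtt{Idem}$ form a duality of categories between probability algebras and tracial commutative von Neumann algebras. -/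

import Mathlib

open CategoryTheory MeasureTheory

universe u

noncomputable section

namespace CanonicalModel

/-! ### Abstract `σ`-complete Boolean algebras and probability measures on them -/

/-- A Boolean algebra is `σ`-complete if all countable joins and meets exist. -/
class IsSigmaComplete (B : Type u) [BooleanAlgebra B] : Prop where
  exists_isLUB : ∀ E : ℕ → B, ∃ a, IsLUB (Set.range E) a
  exists_isGLB : ∀ E : ℕ → B, ∃ a, IsGLB (Set.range E) a

theorem isLUB_compl {B : Type*} [BooleanAlgebra B] {E : ℕ → B} {a : B}
    (h : IsGLB (Set.range E) a) : IsLUB (Set.range fun n => (E n)ᶜ) aᶜ := by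
  constructor
  · rintro _ ⟨n, rfl⟩
    exact compl_le_compl (h.1 ⟨n, rfl⟩)
  · intro b hb
    rw [compl_le_iff_compl_le]
    refine h.2 ?_
    rintro _ ⟨n, rfl⟩
    rw [compl_le_iff_compl_le]
    exact hb ⟨n, rfl⟩

theorem isGLB_compl {B : Type*} [BooleanAlgebra B] {E : ℕ → B} {a : B}
    (h : IsLUB (Set.range E) a) : IsGLB (Set.range fun n => (E n)ᶜ) aᶜ := by
  constructor
  · rintro _ ⟨n, rfl⟩
    exact compl_le_compl (h.1 ⟨n, rfl⟩)
  · intro b hb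
    rw [le_compl_comm]
    refine h.2 ?_
    rintro _ ⟨n, rfl⟩
    rw [le_compl_comm]
    exact hb ⟨n, rfl⟩

theorem IsSigmaComplete.of_isLUB {B : Type u} [BooleanAlgebra B]
    (h : ∀ E : ℕ → B, ∃ a, IsLUB (Set.range E) a) : IsSigmaComplete B where
  exists_isLUB := h
  exists_isGLB E := by
    obtain ⟨a, ha⟩ := h fun n => (E n)ᶜ
    exact ⟨aᶜ, by simpa using isGLB_compl ha⟩

/-- A `σ`-homomorphism: a homomorphism of Boolean algebras that preserves countable joins and
meets. -/
structure SigmaHom (B C : Type*) [BooleanAlgebra B] [BooleanAlgebra C] extends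
    BoundedLatticeHom B C where
  map_isLUB' : ∀ (E : ℕ → B) (a : B), IsLUB (Set.range E) a →
    IsLUB (Set.range fun n => toFun (E n)) (toFun a)
  map_isGLB' : ∀ (E : ℕ → B) (a : B), IsGLB (Set.range E) a →
    IsGLB (Set.range fun n => toFun (E n)) (toFun a)

namespace SigmaHom

variable {B C D : Type*} [BooleanAlgebra B] [BooleanAlgebra C] [BooleanAlgebra D]

instance : FunLike (SigmaHom B C) B C where
  coe f := f.toFun
  coe_injective f g h := by
    cases f; cases g; congr; exact DFunLike.coe_injective h

instance : BoundedLatticeHomClass (SigmaHom B C) B C where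
  map_sup f := f.map_sup'
  map_inf f := f.map_inf'
  map_top f := f.map_top'
  map_bot f := f.map_bot'

@[ext]
theorem ext {f g : SigmaHom B C} (h : ∀ a, f a = g a) : f = g :=
  DFunLike.ext f g h

theorem map_isLUB (f : SigmaHom B C) {E : ℕ → B} {a : B} (h : IsLUB (Set.range E) a) :
    IsLUB (Set.range fun n => f (E n)) (f a) :=
  f.map_isLUB' E a h

theorem map_isGLB (f : SigmaHom B C) {E : ℕ → B} {a : B} (h : IsGLB (Set.range E) a) :
    IsGLB (Set.range fun n => f (E n)) (f a) :=
  f.map_isGLB' E a h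

/-- Preservation of countable meets follows from preservation of countable joins. -/
def ofIsLUB (f : BoundedLatticeHom B C)
    (h : ∀ (E : ℕ → B) (a : B), IsLUB (Set.range E) a →
      IsLUB (Set.range fun n => f (E n)) (f a)) : SigmaHom B C where
  __ := f
  map_isLUB' := h
  map_isGLB' E a ha := by
    have := isGLB_compl (h _ _ (isLUB_compl ha))
    simp only [map_compl', compl_compl] at this
    exact this

@[simp]
theorem ofIsLUB_apply (f : BoundedLatticeHom B C) (h) (a : B) : ofIsLUB f h a = f a := rfl

/-- The identity `σ`-homomorphism. -/
def id (B : Type*) [BooleanAlgebra B] : SigmaHom B B where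
  __ := BoundedLatticeHom.id B
  map_isLUB' _ _ h := h
  map_isGLB' _ _ h := h

/-- Composition of `σ`-homomorphisms. -/
def comp (g : SigmaHom C D) (f : SigmaHom B C) : SigmaHom B D where
  __ := g.toBoundedLatticeHom.comp f.toBoundedLatticeHom
  map_isLUB' _ _ h := g.map_isLUB (f.map_isLUB h)
  map_isGLB' _ _ h := g.map_isGLB (f.map_isGLB h)

@[simp] theorem id_apply (a : B) : SigmaHom.id B a = a := rfl

@[simp] theorem comp_apply (g : SigmaHom C D) (f : SigmaHom B C) (a : B) :
    g.comp f a = g (f a) := rfl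

end SigmaHom

/-- A (countably additive) probability measure on an abstract Boolean algebra. -/
structure IsProbMeasure {B : Type*} [BooleanAlgebra B] (μ : B → ℝ) : Prop where
  mem_Icc : ∀ E, μ E ∈ Set.Icc (0 : ℝ) 1
  map_bot : μ ⊥ = 0
  map_top : μ ⊤ = 1
  hasSum : ∀ E : ℕ → B, (∀ m n, m ≠ n → E m ⊓ E n = ⊥) →
    ∀ a, IsLUB (Set.range E) a → HasSum (fun n => μ (E n)) (μ a)

/-! ### Measurable sets as an abstract `σ`-algebra -/

/-- The `σ`-algebra of a measurable space, as an abstract Boolean algebra. -/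
abbrev MeasAlg (α : Type*) [MeasurableSpace α] : Type _ :=
  Subtype (MeasurableSet : Set α → Prop)

theorem MeasAlg.isLUB_iUnion {α : Type*} [MeasurableSpace α] (E : ℕ → MeasAlg α) :
    IsLUB (Set.range E) ⟨⋃ n, (E n).1, MeasurableSet.iUnion fun n => (E n).2⟩ := by
  constructor
  · rintro _ ⟨n, rfl⟩
    exact Set.subset_iUnion (fun n => (E n).1) n
  · intro b hb
    exact Set.iUnion_subset fun n => hb ⟨n, rfl⟩

theorem MeasAlg.isLUB_iff {α : Type*} [MeasurableSpace α] {E : ℕ → MeasAlg α} {a : MeasAlg α} :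
    IsLUB (Set.range E) a ↔ a.1 = ⋃ n, (E n).1 := by
  constructor
  · intro h
    exact congrArg Subtype.val (h.unique (MeasAlg.isLUB_iUnion E))
  · intro h
    have : a = ⟨⋃ n, (E n).1, MeasurableSet.iUnion fun n => (E n).2⟩ := Subtype.ext h
    rw [this]
    exact MeasAlg.isLUB_iUnion E

instance {α : Type u} [MeasurableSpace α] : IsSigmaComplete (MeasAlg α) :=
  .of_isLUB fun E => ⟨_, MeasAlg.isLUB_iUnion E⟩

/-- The pullback `σ`-homomorphism `E ↦ T⁻¹(E)` of a measurable map `T`. -/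
def pullback {α β : Type*} [MeasurableSpace α] [MeasurableSpace β] (T : α → β)
    (hT : Measurable T) : SigmaHom (MeasAlg β) (MeasAlg α) :=
  .ofIsLUB
    { toFun := fun E => ⟨T ⁻¹' E.1, hT E.2⟩
      map_sup' := fun _ _ => rfl
      map_inf' := fun _ _ => rfl
      map_top' := rfl
      map_bot' := rfl }
    (by
      intro E a h
      rw [MeasAlg.isLUB_iff] at h ⊢
      change T ⁻¹' a.1 = ⋃ n, T ⁻¹' (E n).1
      rw [h, Set.preimage_iUnion])

@[simp]
theorem pullback_coe {α β : Type*} [MeasurableSpace α] [MeasurableSpace β] (T : α → β)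
    (hT : Measurable T) (E : MeasAlg β) : (pullback T hT E).1 = T ⁻¹' E.1 := rfl

/-! ### Concrete and abstract probability spaces, probability algebras -/

/-- Concrete probability spaces. -/
structure ConcProb : Type (u + 1) where
  carrier : Type u
  [meas : MeasurableSpace carrier]
  μ : Measure carrier
  [isProb : IsProbabilityMeasure μ]

namespace ConcProb

attribute [instance] ConcProb.meas ConcProb.isProb

/-- Morphisms of concrete probability spaces: measurable measure-preserving maps. -/
structure Hom (X Y : ConcProb.{u}) where
  toFun : X.carrier → Y.carrier
  measurePreserving : MeasurePreserving toFun X.μ Y.μ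

instance : Category ConcProb.{u} where
  Hom := Hom
  id X := ⟨fun x => x, .id _⟩
  comp f g := ⟨fun x => g.toFun (f.toFun x), g.measurePreserving.comp f.measurePreserving⟩

end ConcProb

/-- Abstract probability spaces: a `σ`-complete Boolean algebra with a probability measure. -/
structure AbsProb : Type (u + 1) where
  carrier : Type u
  [bool : BooleanAlgebra carrier]
  [sigma : IsSigmaComplete carrier]
  μ : carrier → ℝ
  isProb : IsProbMeasure μ

namespace AbsProb

attribute [instance] AbsProb.bool AbsProb.sigma

/-- A morphism `X ⟶ Y` of abstract probability spaces is a measure-preserving `σ`-homomorphism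
in the opposite direction. -/
@[ext]
structure Hom (X Y : AbsProb.{u}) where
  pull : SigmaHom Y.carrier X.carrier
  measure_pull : ∀ E, X.μ (pull E) = Y.μ E

instance : Category AbsProb.{u} where
  Hom := Hom
  id X := ⟨SigmaHom.id _, fun _ => rfl⟩
  comp f g := ⟨f.pull.comp g.pull, fun E => (f.measure_pull _).trans (g.measure_pull E)⟩

end AbsProb

/-- Probability algebras: abstract probability spaces in which only `0` is null. -/
structure ProbAlg : Type (u + 1) extends AbsProb.{u} where
  pos : ∀ E : carrier, E ≠ ⊥ → 0 < μ E

namespace ProbAlg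

/-- Morphisms of probability algebras are the morphisms of the underlying abstract
probability spaces. -/
instance : Category ProbAlg.{u} where
  Hom X Y := X.toAbsProb ⟶ Y.toAbsProb
  id X := 𝟙 X.toAbsProb
  comp f g := f ≫ g

end ProbAlg

/-- The abstraction functor: forget the points of a concrete probability space, keeping only its
`σ`-algebra and its measure. -/
def abstraction : ConcProb.{u} ⥤ AbsProb.{u} where
  obj X :=
    { carrier := MeasAlg X.carrier
      μ := fun E => X.μ.real E.1
      isProb :=
        { mem_Icc := fun E => ⟨measureReal_nonneg, measureReal_le_one⟩
          map_bot := by simp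
          map_top := by simp
          hasSum := by
            intro E hE a ha
            rw [MeasAlg.isLUB_iff] at ha
            rw [ha, measureReal_def, measure_iUnion _ fun n => (E n).2]
            · have h : ∑' n, X.μ (E n).1 ≠ ⊤ := by
                rw [← measure_iUnion _ fun n => (E n).2]
                · exact measure_ne_top _ _
                · intro m n hmn
                  exact Set.disjoint_iff_inter_eq_empty.2 (congrArg Subtype.val (hE m n hmn))
              rw [ENNReal.tsum_toReal_eq fun n => measure_ne_top _ _]
              exact ENNReal.hasSum_toReal h
            · intro m n hmn
              exact Set.disjoint_iff_inter_eq_empty.2 (congrArg Subtype.val (hE m n hmn)) } }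
  map T := ⟨pullback T.toFun T.measurePreserving.measurable, fun E => by
    simp only [pullback_coe, measureReal_def]
    rw [T.measurePreserving.measure_preimage E.2.nullMeasurableSet]⟩

/-! ### The probability algebra of an abstract probability space -/

namespace IsProbMeasure

variable {B : Type*} [BooleanAlgebra B] {μ : B → ℝ}

theorem nonneg (h : IsProbMeasure μ) (a : B) : 0 ≤ μ a := (h.mem_Icc a).1

theorem sup_of_disjoint (h : IsProbMeasure μ) {a b : B} (hab : a ⊓ b = ⊥) :
    μ (a ⊔ b) = μ a + μ b := by
  let E : ℕ → B := fun n => if n = 0 then a else if n = 1 then b else ⊥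
  have hE : ∀ m n, m ≠ n → E m ⊓ E n = ⊥ := by
    intro m n hmn
    have hba : b ⊓ a = ⊥ := by rw [inf_comm]; exact hab
    simp only [E]
    split_ifs <;> simp_all
  have hL : IsLUB (Set.range E) (a ⊔ b) := by
    constructor
    · rintro _ ⟨n, rfl⟩
      simp only [E]
      split_ifs <;> simp
    · intro c hc
      exact sup_le (hc ⟨0, by simp [E]⟩) (hc ⟨1, by simp [E]⟩)
  have h1 := h.hasSum E hE _ hL
  have h2 : HasSum (fun n => μ (E n)) (∑ n ∈ Finset.range 2, μ (E n)) := by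
    refine hasSum_sum_of_ne_finset_zero fun n hn => ?_
    have : E n = ⊥ := by
      simp only [Finset.mem_range, not_lt] at hn
      simp only [E]
      rw [if_neg (by omega), if_neg (by omega)]
    rw [this, h.map_bot]
  rw [h1.unique h2]
  simp [Finset.sum_range_succ, E]

theorem add_sdiff (h : IsProbMeasure μ) (a b : B) : μ (a ⊓ b) + μ (a \ b) = μ a := by
  rw [← h.sup_of_disjoint (inf_inf_sdiff a b), sup_inf_sdiff]

theorem mono (h : IsProbMeasure μ) {a b : B} (hab : a ≤ b) : μ a ≤ μ b := by
  have := h.add_sdiff b a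
  rw [inf_eq_right.2 hab] at this
  have := h.nonneg (b \ a)
  linarith

theorem null_of_le (h : IsProbMeasure μ) {a b : B} (hab : a ≤ b) (hb : μ b = 0) : μ a = 0 :=
  le_antisymm (hb ▸ h.mono hab) (h.nonneg a)

theorem null_sup (h : IsProbMeasure μ) {a b : B} (ha : μ a = 0) (hb : μ b = 0) :
    μ (a ⊔ b) = 0 := by
  have : a ⊔ b = a ⊔ b \ a := by simp
  rw [this, h.sup_of_disjoint (by simp), ha, zero_add]
  exact h.null_of_le sdiff_le hb

theorem isLUB_disjointed {E : ℕ → B} {a : B} (ha : IsLUB (Set.range E) a) :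
    IsLUB (Set.range (disjointed E)) a := by
  constructor
  · rintro _ ⟨n, rfl⟩
    exact (disjointed_le E n).trans (ha.1 ⟨n, rfl⟩)
  · intro b hb
    refine ha.2 ?_
    rintro _ ⟨n, rfl⟩
    have : E n ≤ partialSups (disjointed E) n := by
      rw [partialSups_disjointed]; exact le_partialSups E n
    exact this.trans (partialSups_le _ _ _ fun i _ => hb ⟨i, rfl⟩)

theorem hasSum_disjointed (h : IsProbMeasure μ) {E : ℕ → B} {a : B}
    (ha : IsLUB (Set.range E) a) : HasSum (fun n => μ (disjointed E n)) (μ a) :=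
  h.hasSum _ (fun _ _ hmn => (disjoint_disjointed E hmn).eq_bot) _ (isLUB_disjointed ha)

theorem null_isLUB (h : IsProbMeasure μ) {E : ℕ → B} {a : B} (ha : IsLUB (Set.range E) a)
    (hE : ∀ n, μ (E n) = 0) : μ a = 0 := by
  have h1 := h.hasSum_disjointed ha
  have h2 : (fun n => μ (disjointed E n)) = fun _ => 0 :=
    funext fun n => h.null_of_le (disjointed_le E n) (hE n)
  rw [h2] at h1
  exact h1.unique hasSum_zero

end IsProbMeasure

theorem isLUB_sdiff {B : Type*} [BooleanAlgebra B] {E : ℕ → B} {a : B}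
    (h : IsLUB (Set.range E) a) (b : B) : IsLUB (Set.range fun n => E n \ b) (a \ b) := by
  constructor
  · rintro _ ⟨n, rfl⟩
    exact sdiff_le_sdiff_right (h.1 ⟨n, rfl⟩)
  · intro c hc
    rw [sdiff_le_iff]
    refine h.2 ?_
    rintro _ ⟨n, rfl⟩
    rw [← sdiff_le_iff]
    exact hc ⟨n, rfl⟩

open scoped symmDiff

/-- Two elements of an abstract probability space are identified if their symmetric difference
is null. -/
def nullSetoid (X : AbsProb.{u}) : Setoid X.carrier where
  r a b := X.μ (a ∆ b) = 0
  iseqv :=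
    { refl := fun a => by rw [symmDiff_self]; exact X.isProb.map_bot
      symm := fun {a b} h => by rw [symmDiff_comm]; exact h
      trans := fun {a b c} h h' =>
        X.isProb.null_of_le (symmDiff_triangle a b c) (X.isProb.null_sup h h') }

/-- The quotient of an abstract probability space by its null ideal. -/
def NullQuotient (X : AbsProb.{u}) : Type u := Quotient (nullSetoid X)

namespace NullQuotient

variable {X Y : AbsProb.{u}}

/-- The class of an element modulo null elements. -/
def mk (a : X.carrier) : NullQuotient X := Quotient.mk (nullSetoid X) a

theorem mk_eq {a b : X.carrier} : (mk a : NullQuotient X) = mk b ↔ X.μ (a ∆ b) = 0 :=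
  Quotient.eq (r := nullSetoid X)

theorem mk_surjective : Function.Surjective (mk : X.carrier → NullQuotient X) :=
  Quotient.mk_surjective

instance : Max (NullQuotient X) :=
  ⟨Quotient.map₂ (· ⊔ ·) fun a a' h b b' h' => by
    refine X.isProb.null_of_le ?_ (X.isProb.null_sup h h')
    rw [symmDiff_le_iff]
    constructor <;> refine sup_le ?_ ?_
    · exact (le_symmDiff_sup_left a' a).trans (by
        rw [symmDiff_comm]
        exact sup_le (le_sup_of_le_right le_sup_left) (le_sup_of_le_left le_sup_left))
    · exact (le_symmDiff_sup_left b' b).trans (by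
        rw [symmDiff_comm]
        exact sup_le (le_sup_of_le_right le_sup_right) (le_sup_of_le_left le_sup_right))
    · exact (le_symmDiff_sup_left a a').trans
        (sup_le (le_sup_of_le_right le_sup_left) (le_sup_of_le_left le_sup_left))
    · exact (le_symmDiff_sup_left b b').trans
        (sup_le (le_sup_of_le_right le_sup_right) (le_sup_of_le_left le_sup_right))⟩

instance : Compl (NullQuotient X) :=
  ⟨Quotient.map (fun a => aᶜ) fun a a' h => by
    change X.μ (aᶜ ∆ a'ᶜ) = 0
    rw [compl_symmDiff_compl]
    exact h⟩

instance : Min (NullQuotient X) :=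
  ⟨Quotient.map₂ (· ⊓ ·) fun a a' h b b' h' => by
    refine X.isProb.null_of_le ?_ (X.isProb.null_sup h h')
    have key : ∀ x x' y y' : X.carrier, x ⊓ y ≤ x' ⊓ y' ⊔ (x ∆ x' ⊔ y ∆ y') := by
      intro x x' y y'
      rw [sup_inf_right]
      refine le_inf (inf_le_left.trans ?_) (inf_le_right.trans ?_)
      · exact (le_symmDiff_sup_left x' x).trans (by
          rw [symmDiff_comm]
          exact sup_le (le_sup_of_le_right le_sup_left) le_sup_left)
      · exact (le_symmDiff_sup_left y' y).trans (by
          rw [symmDiff_comm]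
          exact sup_le (le_sup_of_le_right le_sup_right) le_sup_left)
    rw [symmDiff_le_iff]
    refine ⟨key _ _ _ _, ?_⟩
    have := key a' a b' b
    rwa [symmDiff_comm a', symmDiff_comm b'] at this⟩

instance : Lattice (NullQuotient X) :=
  Lattice.mk'
    (fun a b => Quotient.inductionOn₂ a b fun _ _ => congrArg mk (sup_comm _ _))
    (fun a b c => Quotient.inductionOn₃ a b c fun _ _ _ => congrArg mk (sup_assoc _ _ _))
    (fun a b => Quotient.inductionOn₂ a b fun _ _ => congrArg mk (inf_comm _ _))
    (fun a b c => Quotient.inductionOn₃ a b c fun _ _ _ => congrArg mk (inf_assoc _ _ _))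
    (fun a b => Quotient.inductionOn₂ a b fun _ _ => congrArg mk sup_inf_self)
    (fun a b => Quotient.inductionOn₂ a b fun _ _ => congrArg mk inf_sup_self)

theorem mk_sup (a b : X.carrier) : (mk (a ⊔ b) : NullQuotient X) = mk a ⊔ mk b := rfl

theorem mk_inf (a b : X.carrier) : (mk (a ⊓ b) : NullQuotient X) = mk a ⊓ mk b := rfl

theorem mk_mono {a b : X.carrier} (h : a ≤ b) : (mk a : NullQuotient X) ≤ mk b := by
  exact sup_eq_right.1 (congrArg mk (sup_eq_right.2 h))

instance : DistribLattice (NullQuotient X) where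
  le_sup_inf a b c := Quotient.inductionOn₃ a b c fun _ _ _ => mk_mono le_sup_inf

instance : BooleanAlgebra (NullQuotient X) where
  top := mk ⊤
  bot := mk ⊥
  inf_compl_le_bot a := Quotient.inductionOn a fun _ => mk_mono (BooleanAlgebra.inf_compl_le_bot _)
  top_le_sup_compl a := Quotient.inductionOn a fun _ => mk_mono (BooleanAlgebra.top_le_sup_compl _)
  le_top a := Quotient.inductionOn a fun _ => mk_mono le_top
  bot_le a := Quotient.inductionOn a fun _ => mk_mono bot_le
  sdiff_eq _ _ := rfl
  himp_eq _ _ := rfl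

theorem mk_bot : (mk ⊥ : NullQuotient X) = ⊥ := rfl

theorem mk_top : (mk ⊤ : NullQuotient X) = ⊤ := rfl

theorem mk_sdiff (a b : X.carrier) : (mk (a \ b) : NullQuotient X) = mk a \ mk b := by
  rw [sdiff_eq, sdiff_eq, mk_inf]; rfl

theorem mk_eq_bot {a : X.carrier} : (mk a : NullQuotient X) = ⊥ ↔ X.μ a = 0 := by
  rw [← mk_bot, mk_eq, symmDiff_bot]

theorem mk_le {a b : X.carrier} : (mk a : NullQuotient X) ≤ mk b ↔ X.μ (a \ b) = 0 := by
  rw [← sdiff_eq_bot_iff, ← mk_sdiff, mk_eq_bot]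

theorem isLUB_mk {E : ℕ → X.carrier} {a : X.carrier} (h : IsLUB (Set.range E) a) :
    IsLUB (Set.range fun n => (mk (E n) : NullQuotient X)) (mk a) := by
  constructor
  · rintro _ ⟨n, rfl⟩
    exact mk_mono (h.1 ⟨n, rfl⟩)
  · intro b hb
    obtain ⟨b, rfl⟩ := mk_surjective b
    rw [mk_le]
    exact X.isProb.null_isLUB (isLUB_sdiff h b) fun n => mk_le.1 (hb ⟨n, rfl⟩)

theorem exists_rep (E : ℕ → NullQuotient X) : ∃ F : ℕ → X.carrier, E = fun n => mk (F n) :=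
  ⟨fun n => (mk_surjective (E n)).choose, funext fun n => (mk_surjective (E n)).choose_spec.symm⟩

instance : IsSigmaComplete (NullQuotient X) :=
  .of_isLUB fun E => by
    obtain ⟨F, rfl⟩ := exists_rep E
    obtain ⟨a, ha⟩ := IsSigmaComplete.exists_isLUB F
    exact ⟨mk a, isLUB_mk ha⟩

theorem measure_eq {a b : X.carrier} (h : X.μ (a ∆ b) = 0) : X.μ a = X.μ b := by
  have h1 := X.isProb.add_sdiff a b
  have h2 := X.isProb.add_sdiff b a
  have h3 : X.μ (a \ b) = 0 := X.isProb.null_of_le le_sup_left h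
  have h4 : X.μ (b \ a) = 0 := X.isProb.null_of_le le_sup_right h
  rw [inf_comm] at h2
  linarith

/-- The measure of a class modulo null elements. -/
def measure (X : AbsProb.{u}) : NullQuotient X → ℝ :=
  Quotient.lift X.μ fun _ _ h => measure_eq h

@[simp]
theorem measure_mk (a : X.carrier) : measure X (mk a) = X.μ a := rfl

theorem isProbMeasure : IsProbMeasure (measure X) where
  mem_Icc E := Quotient.inductionOn E X.isProb.mem_Icc
  map_bot := X.isProb.map_bot
  map_top := X.isProb.map_top
  hasSum E hE a ha := by
    obtain ⟨F, rfl⟩ := exists_rep E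
    obtain ⟨b, hb⟩ := IsSigmaComplete.exists_isLUB F
    rw [ha.unique (isLUB_mk hb)]
    have h := X.isProb.hasSum_disjointed hb
    suffices H : ∀ n, measure X (mk (F n)) = X.μ (disjointed F n) by
      simp only [H]
      exact h
    intro n
    rw [measure_mk]
    have hF : ∀ m n, m ≠ n → X.μ (F m ⊓ F n) = 0 := fun m n hmn => by
      rw [← mk_eq_bot, mk_inf]; exact hE m n hmn
    have hn : X.μ (F n \ disjointed F n) = 0 := by
      cases n with
      | zero => rw [disjointed_zero, sdiff_self]; exact X.isProb.map_bot
      | succ n =>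
        rw [disjointed_add_one, sdiff_sdiff_right_self]
        have : ∀ k, k ≤ n → X.μ (F (n + 1) ⊓ partialSups F k) = 0 := by
          intro k
          induction k with
          | zero => intro _; rw [partialSups_zero]; exact hF _ _ (by omega)
          | succ k ih =>
            intro hk
            rw [partialSups_add_one, inf_sup_left]
            exact X.isProb.null_sup (ih (by omega)) (hF _ _ (by omega))
        exact this n le_rfl
    have := X.isProb.add_sdiff (F n) (disjointed F n)
    rw [inf_eq_right.2 (disjointed_le F n), hn, add_zero] at this
    exact this.symm

end NullQuotient

/-- The functor taking an abstract probability space to the probability algebra obtained by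
dividing out the null ideal. -/
def mes : AbsProb.{u} ⥤ ProbAlg.{u} where
  obj X :=
    { carrier := NullQuotient X
      μ := NullQuotient.measure X
      isProb := NullQuotient.isProbMeasure
      pos := fun E hE => by
        obtain ⟨a, rfl⟩ := NullQuotient.mk_surjective E
        refine lt_of_le_of_ne (X.isProb.nonneg a) fun h => hE ?_
        exact NullQuotient.mk_eq_bot.2 h.symm }
  map {X Y} T :=
    { pull := .ofIsLUB
        { toFun := Quotient.map T.pull fun a b h => by
            change X.μ (T.pull a ∆ T.pull b) = 0
            rw [← map_symmDiff', T.measure_pull]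
            exact h
          map_sup' := fun a b => Quotient.inductionOn₂ a b fun _ _ =>
            congrArg NullQuotient.mk (map_sup T.pull _ _)
          map_inf' := fun a b => Quotient.inductionOn₂ a b fun _ _ =>
            congrArg NullQuotient.mk (map_inf T.pull _ _)
          map_top' := congrArg NullQuotient.mk (map_top T.pull)
          map_bot' := congrArg NullQuotient.mk (map_bot T.pull) }
        (by
          intro E a ha
          obtain ⟨F, rfl⟩ := NullQuotient.exists_rep E
          obtain ⟨b, hb⟩ := IsSigmaComplete.exists_isLUB F
          rw [ha.unique (NullQuotient.isLUB_mk hb)]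
          exact NullQuotient.isLUB_mk (T.pull.map_isLUB hb))
      measure_pull := fun E => Quotient.inductionOn E T.measure_pull }
  map_id X := by
    refine AbsProb.Hom.ext (SigmaHom.ext fun E => ?_)
    exact Quotient.inductionOn E fun _ => rfl
  map_comp S T := by
    refine AbsProb.Hom.ext (SigmaHom.ext fun E => ?_)
    exact Quotient.inductionOn E fun _ => rfl

/-! ### Tracial commutative `C⋆`-algebras -/

open scoped ComplexOrder in
/-- Unital commutative `C⋆`-algebras with a state, i.e. a bounded linear functional that is
non-negative and has operator norm `1`. -/
structure CStarTau : Type (u + 1) where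
  carrier : Type u
  [cstar : CommCStarAlgebra carrier]
  state : carrier →L[ℂ] ℂ
  state_nonneg : ∀ a, 0 ≤ state (star a * a)
  norm_state : ‖state‖ = 1

namespace CStarTau

attribute [instance] CStarTau.cstar

/-- State-preserving unital `⋆`-homomorphisms. -/
@[ext]
structure Hom (A B : CStarTau.{u}) where
  toStarAlgHom : A.carrier →⋆ₐ[ℂ] B.carrier
  state_map : ∀ a, B.state (toStarAlgHom a) = A.state a

instance : Category CStarTau.{u} where
  Hom := Hom
  id A := ⟨StarAlgHom.id ℂ A.carrier, fun _ => rfl⟩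
  comp f g := ⟨g.toStarAlgHom.comp f.toStarAlgHom,
    fun a => (g.state_map _).trans (f.state_map a)⟩

end CStarTau

/-! ### Tracial commutative von Neumann algebras -/

section Normal

attribute [local instance] CStarAlgebra.spectralOrder

/-- A map between `C⋆`-algebras is normal if it preserves suprema of (bounded) directed sets in
the order where `a ≤ b` means that `b - a` is non-negative. -/
def IsNormalMap {A B : Type*} [CommCStarAlgebra A] [CommCStarAlgebra B] (Φ : A → B) : Prop :=
  ScottContinuous Φ

/-- A functional that is real on self-adjoint elements is normal if it preserves suprema of
(bounded) directed sets. -/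
def IsNormalFunctional {A : Type*} [CommCStarAlgebra A] (τ : A → ℂ) : Prop :=
  ScottContinuous fun a => (τ a).re

end Normal

open scoped ComplexOrder in
/-- The structure of a tracial commutative von Neumann algebra: a commutative `C⋆`-algebra with a
Banach space predual and a faithful normal trace of total mass `1`. -/
class TracialVonNeumann (A : Type u) extends CommCStarAlgebra A where
  wstar : WStarAlgebra A
  trace : A →ₗ[ℂ] ℂ
  trace_star : ∀ a, trace (star a) = starRingEnd ℂ (trace a)
  trace_one : trace 1 = 1
  trace_nonneg : ∀ a, 0 ≤ trace (a * star a)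
  trace_faithful : ∀ a, trace (a * star a) = 0 ↔ a = 0
  trace_normal : IsNormalFunctional trace

/-- Tracial commutative von Neumann algebras. -/
structure VonNeumannTau : Type (u + 1) where
  carrier : Type u
  [str : TracialVonNeumann carrier]

namespace VonNeumannTau

attribute [instance] VonNeumannTau.str

/-- The trace of a tracial commutative von Neumann algebra. -/
abbrev trace (A : VonNeumannTau.{u}) : A.carrier →ₗ[ℂ] ℂ := TracialVonNeumann.trace

/-- Trace-preserving homomorphisms of von Neumann algebras, i.e. normal unital
`⋆`-homomorphisms. -/
@[ext]
structure Hom (A B : VonNeumannTau.{u}) where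
  toStarAlgHom : A.carrier →⋆ₐ[ℂ] B.carrier
  normal : IsNormalMap toStarAlgHom
  trace_map : ∀ a, B.trace (toStarAlgHom a) = A.trace a

theorem isNormalMap_id (A : VonNeumannTau.{u}) :
    IsNormalMap (StarAlgHom.id ℂ A.carrier) := by
  intro d _ _ a h
  simpa using h

section

attribute [local instance] CStarAlgebra.spectralOrder

theorem isNormalMap_comp {A B C : VonNeumannTau.{u}} {g : B.carrier →⋆ₐ[ℂ] C.carrier}
    {f : A.carrier →⋆ₐ[ℂ] B.carrier} (hg : IsNormalMap g) (hf : IsNormalMap f) :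
    IsNormalMap (g.comp f) := by
  have h : ScottContinuous (g ∘ f) := ScottContinuous.comp (f := f) (g := g) hf hg
  exact h

end

instance : Category VonNeumannTau.{u} where
  Hom := Hom
  id A := ⟨StarAlgHom.id ℂ A.carrier, isNormalMap_id A, fun _ => rfl⟩
  comp f g := ⟨g.toStarAlgHom.comp f.toStarAlgHom, isNormalMap_comp g.normal f.normal,
    fun a => (g.trace_map _).trans (f.trace_map a)⟩

theorem hom_ext {A B : VonNeumannTau.{u}} {f g : A ⟶ B}
    (h : ∀ a, f.toStarAlgHom a = g.toStarAlgHom a) : f = g :=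
  Hom.ext (StarAlgHom.ext h)

section Forget

attribute [local instance] CStarAlgebra.spectralOrder CStarAlgebra.spectralOrderedRing

theorem norm_trace_le (A : VonNeumannTau.{u}) (a : A.carrier) : ‖A.trace a‖ ≤ 1 * ‖a‖ := by
  have hnn : ∀ b : A.carrier, 0 ≤ (A.trace (star b * b)).re := fun b => by
    rw [mul_comm]
    exact (Complex.le_def.1 (TracialVonNeumann.trace_nonneg b)).1
  have h1 : (A.trace (star a * a)).re ≤ ‖a‖ ^ 2 := by
    have hle : star a * a ≤ algebraMap ℝ A.carrier (‖a‖ ^ 2) := by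
      have := IsSelfAdjoint.le_algebraMap_norm_self (IsSelfAdjoint.star_mul_self a)
      rwa [CStarRing.norm_star_mul_self, ← sq] at this
    obtain ⟨c, hc⟩ := CStarAlgebra.nonneg_iff_eq_star_mul_self.1 (sub_nonneg.2 hle)
    have h2 := hnn c
    rw [← hc, map_sub, Complex.sub_re, Algebra.algebraMap_eq_smul_one,
      ← Complex.coe_smul, map_smul, TracialVonNeumann.trace_one] at h2
    simp only [smul_eq_mul, mul_one, Complex.ofReal_re] at h2
    linarith
  have h3 := hnn (a - A.trace a • 1)
  have h4 : star (a - A.trace a • (1 : A.carrier)) * (a - A.trace a • 1) =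
      star a * a - A.trace a • star a - (starRingEnd ℂ (A.trace a)) • a +
        (starRingEnd ℂ (A.trace a) * A.trace a) • (1 : A.carrier) := by
    simp only [star_sub, star_smul, star_one, sub_mul, mul_sub, smul_mul_assoc, mul_smul_comm,
      one_mul, mul_one, starRingEnd_apply]
    module
  have h5 : ‖A.trace a‖ ^ 2 ≤ ‖a‖ ^ 2 := by
    rw [h4, map_add, map_sub, map_sub, map_smul, map_smul, map_smul,
      TracialVonNeumann.trace_star, TracialVonNeumann.trace_one] at h3
    simp only [smul_eq_mul, mul_one, Complex.add_re, Complex.sub_re, mul_comm (starRingEnd ℂ _),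
      Complex.mul_conj, Complex.ofReal_re, Complex.normSq_eq_norm_sq] at h3
    linarith
  rw [one_mul]
  exact le_of_sq_le_sq h5 (norm_nonneg a)

end Forget

/-- The trace as a bounded functional. -/
def traceCLM (A : VonNeumannTau.{u}) : A.carrier →L[ℂ] ℂ :=
  A.trace.mkContinuous 1 (norm_trace_le A)

theorem norm_traceCLM (A : VonNeumannTau.{u}) : ‖A.traceCLM‖ = 1 := by
  refine le_antisymm (LinearMap.mkContinuous_norm_le _ zero_le_one _) ?_
  have h1 : A.traceCLM 1 = 1 := TracialVonNeumann.trace_one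
  have : Nontrivial A.carrier := by
    refine ⟨1, 0, fun h => ?_⟩
    rw [h, map_zero] at h1
    exact zero_ne_one h1
  have h := A.traceCLM.le_opNorm 1
  simpa [h1] using h

/-- The functor that forgets the von Neumann structure. -/
def forget : VonNeumannTau.{u} ⥤ CStarTau.{u} where
  obj A :=
    { carrier := A.carrier
      state := A.traceCLM
      state_nonneg := fun a => by
        rw [mul_comm]; exact TracialVonNeumann.trace_nonneg a
      norm_state := A.norm_traceCLM }
  map f := ⟨f.toStarAlgHom, f.trace_map⟩

end VonNeumannTau

/-! ### Compact Hausdorff probability spaces -/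

/-- The Baire `σ`-algebra, generated by the continuous complex-valued functions. -/
@[reducible]
def baire (X : Type*) [TopologicalSpace X] : MeasurableSpace X :=
  ⨆ f : C(X, ℂ), MeasurableSpace.comap f inferInstance

/-- The given `σ`-algebra is the Baire `σ`-algebra. -/
class IsBaireSigmaAlgebra (X : Type*) [TopologicalSpace X] [m : MeasurableSpace X] : Prop where
  eq_baire : m = baire X

/-- Radon measures on the Baire `σ`-algebra: inner regular with respect to compact `Gδ` sets. -/
def IsRadon {X : Type*} [TopologicalSpace X] [MeasurableSpace X] (μ : Measure X) : Prop :=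
  μ.InnerRegularWRT (fun K => MeasurableSet K ∧ IsCompact K ∧ IsGδ K) MeasurableSet

/-- Compact Hausdorff spaces with a Radon probability measure on the Baire `σ`-algebra. -/
structure CHProb : Type (u + 1) where
  carrier : Type u
  [top : TopologicalSpace carrier]
  [compact : CompactSpace carrier]
  [t2 : T2Space carrier]
  [meas : MeasurableSpace carrier]
  [baire : IsBaireSigmaAlgebra carrier]
  μ : Measure carrier
  [isProb : IsProbabilityMeasure μ]
  radon : IsRadon μ

namespace CHProb

attribute [instance] CHProb.top CHProb.compact CHProb.t2 CHProb.meas CHProb.baire CHProb.isProb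

/-- Continuous measure-preserving maps. -/
@[ext]
structure Hom (X Y : CHProb.{u}) where
  toMap : C(X.carrier, Y.carrier)
  measurePreserving : MeasurePreserving toMap X.μ Y.μ

instance : Category CHProb.{u} where
  Hom := Hom
  id X := ⟨ContinuousMap.id X.carrier, .id _⟩
  comp f g := ⟨g.toMap.comp f.toMap, g.measurePreserving.comp f.measurePreserving⟩

theorem measurable_continuousMap (X : CHProb.{u}) (f : C(X.carrier, ℂ)) : Measurable f := by
  have h : MeasurableSpace.comap f inferInstance ≤ X.meas := by
    rw [X.baire.eq_baire]
    exact le_iSup (fun f : C(X.carrier, ℂ) => MeasurableSpace.comap f inferInstance) f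
  exact fun s hs => h _ ⟨s, hs, rfl⟩

theorem integrable (X : CHProb.{u}) (f : C(X.carrier, ℂ)) : Integrable f X.μ :=
  Integrable.of_bound (X.measurable_continuousMap f).aestronglyMeasurable ‖f‖
    (ae_of_all _ f.norm_coe_le_norm)

/-- Integration against the measure of a compact Hausdorff probability space. -/
def integral (X : CHProb.{u}) : C(X.carrier, ℂ) →L[ℂ] ℂ :=
  LinearMap.mkContinuous
    { toFun := fun f => ∫ x, f x ∂X.μ
      map_add' := fun f g => integral_add (X.integrable f) (X.integrable g)
      map_smul' := fun c f => integral_smul c f } 1 (by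
    intro f
    have h := norm_integral_le_of_norm_le_const (μ := X.μ) (ae_of_all _ f.norm_coe_le_norm)
    simpa using h)

@[simp]
theorem integral_apply (X : CHProb.{u}) (f : C(X.carrier, ℂ)) :
    X.integral f = ∫ x, f x ∂X.μ := rfl

theorem norm_integral (X : CHProb.{u}) : ‖X.integral‖ = 1 := by
  refine le_antisymm (LinearMap.mkContinuous_norm_le _ zero_le_one _) ?_
  have h := X.integral.le_opNorm 1
  have : Nonempty X.carrier := nonempty_of_isProbabilityMeasure X.μ
  simpa using h

theorem integral_star_mul_self (X : CHProb.{u}) (f : C(X.carrier, ℂ)) :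
    X.integral (star f * f) = ((∫ x, ‖f x‖ ^ 2 ∂X.μ : ℝ) : ℂ) := by
  have h : ∀ x, (star f * f) x = ((‖f x‖ ^ 2 : ℝ) : ℂ) := fun x => by
    change starRingEnd ℂ (f x) * f x = _
    rw [Complex.conj_mul', Complex.ofReal_pow]
  rw [integral_apply]
  simp only [h]
  exact integral_complex_ofReal

theorem integral_comp {X Y : CHProb.{u}} (T : X ⟶ Y) (f : C(Y.carrier, ℂ)) :
    X.integral (f.comp T.toMap) = Y.integral f := by
  have h := integral_map T.measurePreserving.aemeasurable
    (f := f) (Y.measurable_continuousMap f).aestronglyMeasurable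
  rw [T.measurePreserving.map_eq] at h
  exact h.symm

open scoped ComplexOrder in
/-- The functor of continuous functions, with integration as the state. -/
def cfunc : CHProb.{u} ⥤ CStarTau.{u}ᵒᵖ where
  obj X := .op
    { carrier := C(X.carrier, ℂ)
      state := X.integral
      state_nonneg := fun f => by
        rw [integral_star_mul_self]
        exact Complex.zero_le_real.2 (integral_nonneg fun x => by positivity)
      norm_state := X.norm_integral }
  map {X Y} T := Quiver.Hom.op
    (⟨ContinuousMap.compStarAlgHom' ℂ ℂ T.toMap, integral_comp T⟩ : CStarTau.Hom _ _)

end CHProb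

/-! ### The algebra of bounded measurable functions on a concrete probability space -/

/-- Bounded measurable complex-valued functions. -/
def BddMeas (X : ConcProb.{u}) : Type u :=
  {f : X.carrier → ℂ // Measurable f ∧ ∃ M : ℝ, ∀ x, ‖f x‖ ≤ M}

/-- Almost everywhere equality. -/
def aeSetoid (X : ConcProb.{u}) : Setoid (BddMeas X) where
  r f g := f.1 =ᵐ[X.μ] g.1
  iseqv := ⟨fun _ => .rfl, fun h => h.symm, fun h h' => h.trans h'⟩

/-- Equivalence classes of bounded measurable functions modulo almost everywhere equality. -/
def ConcLinfty (X : ConcProb.{u}) : Type u := Quotient (aeSetoid X)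

namespace ConcLinfty

/-- The class of a bounded measurable function. -/
def mk {X : ConcProb.{u}} (f : BddMeas X) : ConcLinfty X := Quotient.mk (aeSetoid X) f

/-- The Koopman operator `[f] ↦ [f ∘ T]`. -/
def koopman {X Y : ConcProb.{u}} (T : X ⟶ Y) : ConcLinfty Y → ConcLinfty X :=
  Quotient.map
    (fun f => ⟨fun x => f.1 (T.toFun x), f.2.1.comp T.measurePreserving.measurable,
      f.2.2.imp fun _ h x => h (T.toFun x)⟩)
    fun _ _ h => T.measurePreserving.quasiMeasurePreserving.ae_eq_comp h

end ConcLinfty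

/-- The tracial von Neumann algebra structure on `L^∞` of a concrete probability space: pointwise
operations, the essential supremum norm, and integration as the trace. The listed properties
determine the structure. -/
structure ConcLinftyStr (X : ConcProb.{u}) extends TracialVonNeumann (ConcLinfty X) where
  mk_add : ∀ f g h : BddMeas X, (∀ x, h.1 x = f.1 x + g.1 x) →
    ConcLinfty.mk h = ConcLinfty.mk f + ConcLinfty.mk g
  mk_mul : ∀ f g h : BddMeas X, (∀ x, h.1 x = f.1 x * g.1 x) →
    ConcLinfty.mk h = ConcLinfty.mk f * ConcLinfty.mk g
  mk_smul : ∀ (c : ℂ) (f h : BddMeas X), (∀ x, h.1 x = c * f.1 x) →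
    ConcLinfty.mk h = c • ConcLinfty.mk f
  mk_star : ∀ f h : BddMeas X, (∀ x, h.1 x = starRingEnd ℂ (f.1 x)) →
    ConcLinfty.mk h = star (ConcLinfty.mk f)
  norm_mk : ∀ f : BddMeas X,
    ‖ConcLinfty.mk f‖ = sInf {M : ℝ | 0 ≤ M ∧ ∀ᵐ x ∂X.μ, ‖f.1 x‖ ≤ M}
  trace_mk : ∀ f : BddMeas X, trace (ConcLinfty.mk f) = ∫ x, f.1 x ∂X.μ

/-- The well-definedness of `L^∞` as a functor on concrete probability spaces: every `L^∞(X)` is a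
tracial commutative von Neumann algebra, and every Koopman operator is a trace-preserving
homomorphism of von Neumann algebras. -/
structure ConcLinftyWellDefined : Type (u + 1) where
  str : ∀ X : ConcProb.{u}, ConcLinftyStr X
  koopman_isHom : ∀ {X Y : ConcProb.{u}} (T : X ⟶ Y),
    ∃ Φ : VonNeumannTau.mk (ConcLinfty Y) (str := (str Y).toTracialVonNeumann) ⟶
        VonNeumannTau.mk (ConcLinfty X) (str := (str X).toTracialVonNeumann),
      ∀ f, Φ.toStarAlgHom f = ConcLinfty.koopman T f

/-- The functor `L^∞` on concrete probability spaces. -/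
def ConcLinftyWellDefined.functor (w : ConcLinftyWellDefined.{u}) :
    ConcProb.{u} ⥤ VonNeumannTau.{u}ᵒᵖ where
  obj X := .op (VonNeumannTau.mk (ConcLinfty X) (str := (w.str X).toTracialVonNeumann))
  map T := (w.koopman_isHom T).choose.op
  map_id X := by
    refine Quiver.Hom.unop_inj (VonNeumannTau.hom_ext fun f => ?_)
    refine ((w.koopman_isHom (𝟙 X)).choose_spec f).trans ?_
    exact Quotient.inductionOn f fun _ => rfl
  map_comp S T := by
    refine Quiver.Hom.unop_inj (VonNeumannTau.hom_ext fun f => ?_)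
    refine ((w.koopman_isHom (S ≫ T)).choose_spec f).trans ?_
    refine Eq.trans ?_ ((w.koopman_isHom S).choose_spec _).symm
    refine Eq.trans ?_ (congrArg _ ((w.koopman_isHom T).choose_spec f).symm)
    exact Quotient.inductionOn f fun _ => rfl

/-! ### The algebra of bounded abstractly measurable functions on a probability algebra -/

/-- The closed disc of radius `M` about the origin, as a Borel set. -/
def disc (M : ℝ) : MeasAlg ℂ := ⟨{z | ‖z‖ ≤ M}, measurableSet_le measurable_norm measurable_const⟩

/-- Bounded abstractly measurable functions `f : X → ℂ`, where an abstractly measurable function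
is a `σ`-homomorphism from the Borel `σ`-algebra of `ℂ` to the algebra of `X`, thought of as
`E ↦ f⁻¹(E)`. -/
def Linfty (X : ProbAlg.{u}) : Type u :=
  {f : SigmaHom (MeasAlg ℂ) X.carrier // ∃ M : ℝ, 0 ≤ M ∧ f (disc M) = ⊤}

namespace Linfty

variable {X Y : ProbAlg.{u}}

/-- `h` is the result of applying the measurable binary operation `op` to `f` and `g`: the joint
map `(f, g)` into the product `ℂ × ℂ`, followed by `op`, is `h`. -/
def IsBinaryOp (op : ℂ × ℂ → ℂ) (hop : Measurable op) (f g h : Linfty X) : Prop :=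
  ∃ J : SigmaHom (MeasAlg (ℂ × ℂ)) X.carrier,
    J.comp (pullback Prod.fst measurable_fst) = f.1 ∧
    J.comp (pullback Prod.snd measurable_snd) = g.1 ∧
    J.comp (pullback op hop) = h.1

/-- `h` is the result of applying the measurable unary operation `op` to `f`. -/
def IsUnaryOp (op : ℂ → ℂ) (hop : Measurable op) (f h : Linfty X) : Prop :=
  f.1.comp (pullback op hop) = h.1

open scoped Classical in
/-- The indicator function of an element `E`: the preimage of `S` is `1` if `S` contains `0` and
`1`, it is `E` if `S` contains `1` but not `0`, it is the complement of `E` if `S` contains `0`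
but not `1`, and it is `0` otherwise. -/
def indicatorHom {B : Type u} [BooleanAlgebra B] (E : B) : SigmaHom (MeasAlg ℂ) B :=
  .ofIsLUB
    { toFun := fun S => (if (1 : ℂ) ∈ S.1 then E else ⊥) ⊔ (if (0 : ℂ) ∈ S.1 then Eᶜ else ⊥)
      map_sup' := fun S T => by
        have h : ∀ z : ℂ, z ∈ (S ⊔ T).1 ↔ z ∈ S.1 ∨ z ∈ T.1 := fun _ => Iff.rfl
        simp only [h]
        by_cases h1 : (1 : ℂ) ∈ S.1 <;> by_cases h2 : (1 : ℂ) ∈ T.1 <;>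
          by_cases h3 : (0 : ℂ) ∈ S.1 <;> by_cases h4 : (0 : ℂ) ∈ T.1 <;>
          simp [h1, h2, h3, h4]
      map_inf' := fun S T => by
        have h : ∀ z : ℂ, z ∈ (S ⊓ T).1 ↔ z ∈ S.1 ∧ z ∈ T.1 := fun _ => Iff.rfl
        simp only [h]
        by_cases h1 : (1 : ℂ) ∈ S.1 <;> by_cases h2 : (1 : ℂ) ∈ T.1 <;>
          by_cases h3 : (0 : ℂ) ∈ S.1 <;> by_cases h4 : (0 : ℂ) ∈ T.1 <;>
          simp [h1, h2, h3, h4]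
      map_top' := by
        simp
      map_bot' := by
        simp }
    (by
      intro S A h
      rw [MeasAlg.isLUB_iff] at h
      have hmem : ∀ z : ℂ, z ∈ A.1 ↔ ∃ n, z ∈ (S n).1 := fun z => by rw [h, Set.mem_iUnion]
      constructor
      · rintro _ ⟨n, rfl⟩
        refine sup_le_sup ?_ ?_
        · by_cases h1 : (1 : ℂ) ∈ (S n).1
          · rw [if_pos h1, if_pos ((hmem _).2 ⟨n, h1⟩)]
          · rw [if_neg h1]; exact bot_le
        · by_cases h1 : (0 : ℂ) ∈ (S n).1
          · rw [if_pos h1, if_pos ((hmem _).2 ⟨n, h1⟩)]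
          · rw [if_neg h1]; exact bot_le
      · intro c hc
        refine sup_le ?_ ?_
        · by_cases h1 : (1 : ℂ) ∈ A.1
          · obtain ⟨n, hn⟩ := (hmem _).1 h1
            rw [if_pos h1]
            refine le_trans ?_ (hc ⟨n, rfl⟩)
            exact le_sup_of_le_left (if_pos hn).ge
          · rw [if_neg h1]; exact bot_le
        · by_cases h1 : (0 : ℂ) ∈ A.1
          · obtain ⟨n, hn⟩ := (hmem _).1 h1
            rw [if_pos h1]
            refine le_trans ?_ (hc ⟨n, rfl⟩)
            exact le_sup_of_le_right (if_pos hn).ge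
          · rw [if_neg h1]; exact bot_le)

/-- The indicator function of an element of a probability algebra. -/
def indicator (E : X.carrier) : Linfty X :=
  ⟨indicatorHom E, 1, zero_le_one, by
    change (if (1 : ℂ) ∈ {z : ℂ | ‖z‖ ≤ 1} then E else ⊥) ⊔
      (if (0 : ℂ) ∈ {z : ℂ | ‖z‖ ≤ 1} then Eᶜ else ⊥) = ⊤
    simp⟩

/-- The Koopman operator `f ↦ f ∘ T`. -/
def koopman (T : X ⟶ Y) (f : Linfty Y) : Linfty X :=
  ⟨(AbsProb.Hom.pull T).comp f.1, f.2.imp fun M h => ⟨h.1, by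
    rw [SigmaHom.comp_apply, h.2, map_top]⟩⟩

end Linfty

/-- The tracial von Neumann algebra structure on `L^∞` of a probability algebra: the operations are
those induced by the operations of `ℂ`, the norm of `f` is the least `M` with `|f| ≤ M`, and the
trace of the indicator function of `E` is the measure of `E`. The listed properties determine the
structure, as simple functions are dense and traces are bounded. -/
structure LinftyStr (X : ProbAlg.{u}) extends TracialVonNeumann (Linfty X) where
  isBinaryOp_add : ∀ f g : Linfty X,
    Linfty.IsBinaryOp (fun z => z.1 + z.2) (by fun_prop) f g (f + g)
  isBinaryOp_mul : ∀ f g : Linfty X,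
    Linfty.IsBinaryOp (fun z => z.1 * z.2) (by fun_prop) f g (f * g)
  isUnaryOp_smul : ∀ (c : ℂ) (f : Linfty X),
    Linfty.IsUnaryOp (fun z => c * z) (by fun_prop) f (c • f)
  isUnaryOp_star : ∀ f : Linfty X,
    Linfty.IsUnaryOp (starRingEnd ℂ) Complex.continuous_conj.measurable f (star f)
  norm_eq : ∀ f : Linfty X, ‖f‖ = sInf {M : ℝ | 0 ≤ M ∧ f.1 (disc M) = ⊤}
  trace_indicator : ∀ E : X.carrier, trace (Linfty.indicator E) = X.μ E

/-- The well-definedness of `L^∞` as a functor on probability algebras: every `L^∞(X)` is a tracial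
commutative von Neumann algebra, and every Koopman operator is a trace-preserving homomorphism of
von Neumann algebras. -/
structure LinftyWellDefined : Type (u + 1) where
  str : ∀ X : ProbAlg.{u}, LinftyStr X
  koopman_isHom : ∀ {X Y : ProbAlg.{u}} (T : X ⟶ Y),
    ∃ Φ : VonNeumannTau.mk (Linfty Y) (str := (str Y).toTracialVonNeumann) ⟶
        VonNeumannTau.mk (Linfty X) (str := (str X).toTracialVonNeumann),
      ∀ f, Φ.toStarAlgHom f = Linfty.koopman T f

/-- The functor `L^∞` on probability algebras. -/
def LinftyWellDefined.functor (w : LinftyWellDefined.{u}) :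
    ProbAlg.{u} ⥤ VonNeumannTau.{u}ᵒᵖ where
  obj X := .op (VonNeumannTau.mk (Linfty X) (str := (w.str X).toTracialVonNeumann))
  map T := (w.koopman_isHom T).choose.op
  map_id X := by
    refine Quiver.Hom.unop_inj (VonNeumannTau.hom_ext fun f => ?_)
    exact (w.koopman_isHom (𝟙 X)).choose_spec f
  map_comp S T := by
    refine Quiver.Hom.unop_inj (VonNeumannTau.hom_ext fun f => ?_)
    refine ((w.koopman_isHom (S ≫ T)).choose_spec f).trans ?_
    refine Eq.trans ?_ ((w.koopman_isHom S).choose_spec _).symm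
    exact congrArg (Linfty.koopman S) ((w.koopman_isHom T).choose_spec f).symm

/-! ### The probability algebra of projections of a tracial von Neumann algebra -/

/-- The (self-adjoint) projections of a commutative `⋆`-ring. -/
abbrev Proj (A : Type*) [CommRing A] [StarRing A] : Type _ := {p : A // IsStarProjection p}

namespace Proj

variable {A B : Type*} [CommRing A] [StarRing A] [CommRing B] [StarRing B]

instance : Min (Proj A) := ⟨fun p q => ⟨p.1 * q.1, p.2.mul q.2 (Commute.all _ _)⟩⟩

instance : Compl (Proj A) := ⟨fun p => ⟨1 - p.1, p.2.one_sub⟩⟩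

instance : Max (Proj A) := ⟨fun p q => ⟨1 - (1 - p.1) * (1 - q.1),
  (p.2.one_sub.mul q.2.one_sub (Commute.all _ _)).one_sub⟩⟩

theorem coe_inf (p q : Proj A) : (p ⊓ q).1 = p.1 * q.1 := rfl

theorem coe_sup (p q : Proj A) : (p ⊔ q).1 = 1 - (1 - p.1) * (1 - q.1) := rfl

instance : Lattice (Proj A) :=
  Lattice.mk'
    (fun p q => Subtype.ext (by simp only [coe_sup]; ring))
    (fun p q r => Subtype.ext (by simp only [coe_sup]; ring))
    (fun p q => Subtype.ext (by simp only [coe_inf]; ring))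
    (fun p q r => Subtype.ext (by simp only [coe_inf]; ring))
    (fun p q => Subtype.ext (by
      have h := p.2.isIdempotentElem.eq
      simp only [coe_sup, coe_inf]; linear_combination (-q.1) * h))
    (fun p q => Subtype.ext (by
      have h := p.2.isIdempotentElem.eq
      simp only [coe_sup, coe_inf]; linear_combination (1 - q.1) * h))

theorem le_iff {p q : Proj A} : p ≤ q ↔ p.1 * q.1 = p.1 := by
  rw [← inf_eq_left, ← Subtype.coe_inj, coe_inf]

instance : DistribLattice (Proj A) where
  le_sup_inf p q r := by
    have h := p.2.isIdempotentElem.eq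
    refine le_of_eq (Subtype.ext ?_)
    simp only [coe_sup, coe_inf]
    linear_combination (1 - q.1) * (1 - r.1) * h

instance : BooleanAlgebra (Proj A) where
  top := ⟨1, .one A⟩
  bot := ⟨0, .zero A⟩
  inf_compl_le_bot p := le_of_eq (Subtype.ext (by
    have h := p.2.isIdempotentElem.eq
    change p.1 * (1 - p.1) = 0
    linear_combination -h))
  top_le_sup_compl p := le_of_eq (Subtype.ext (by
    have h := p.2.isIdempotentElem.eq
    change 1 = 1 - (1 - p.1) * (1 - (1 - p.1))
    linear_combination -h))
  le_top p := le_iff.2 (mul_one _)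
  bot_le p := le_iff.2 (zero_mul _)
  sdiff_eq _ _ := rfl
  himp_eq _ _ := rfl

/-- The map on projections induced by a `⋆`-homomorphism. -/
def map {A B : VonNeumannTau.{u}} (Φ : A ⟶ B) :
    BoundedLatticeHom (Proj A.carrier) (Proj B.carrier) where
  toFun p := ⟨Φ.toStarAlgHom p.1, p.2.map Φ.toStarAlgHom⟩
  map_sup' p q := Subtype.ext (by simp [coe_sup])
  map_inf' p q := Subtype.ext (by simp [coe_inf])
  map_top' := Subtype.ext (map_one Φ.toStarAlgHom)
  map_bot' := Subtype.ext (map_zero Φ.toStarAlgHom)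

/-- The measure of a projection is its trace. -/
def measure (A : VonNeumannTau.{u}) (p : Proj A.carrier) : ℝ := (A.trace p.1).re

theorem measure_pos (A : VonNeumannTau.{u}) (p : Proj A.carrier) (hp : p ≠ ⊥) :
    0 < measure A p := by
  have h : p.1 * star p.1 = p.1 := by
    rw [p.2.isSelfAdjoint.star_eq, p.2.isIdempotentElem.eq]
  have h1 := TracialVonNeumann.trace_nonneg p.1
  have h2 := (TracialVonNeumann.trace_faithful p.1).1
  rw [h] at h1 h2
  obtain ⟨hre, him⟩ := Complex.le_def.1 h1
  refine lt_of_le_of_ne hre fun h0 => hp (Subtype.ext (h2 ?_))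
  exact Complex.ext h0.symm him.symm

end Proj

/-- The well-definedness of the functor of projections: the projections of a tracial commutative von
Neumann algebra form a `σ`-complete Boolean algebra on which the trace is a countably additive
probability measure, and homomorphisms induce `σ`-homomorphisms. -/
structure IdemWellDefined : Prop where
  sigma : ∀ A : VonNeumannTau.{u}, IsSigmaComplete (Proj A.carrier)
  isProb : ∀ A : VonNeumannTau.{u}, IsProbMeasure (Proj.measure A)
  map_isLUB : ∀ {A B : VonNeumannTau.{u}} (Φ : A ⟶ B) (E : ℕ → Proj A.carrier)
    (p : Proj A.carrier), IsLUB (Set.range E) p →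
      IsLUB (Set.range fun n => Proj.map Φ (E n)) (Proj.map Φ p)

/-- The functor taking a tracial commutative von Neumann algebra to the probability algebra of its
projections. -/
def IdemWellDefined.functor (w : IdemWellDefined.{u}) :
    VonNeumannTau.{u}ᵒᵖ ⥤ ProbAlg.{u} where
  obj A :=
    { carrier := Proj A.unop.carrier
      sigma := w.sigma A.unop
      μ := Proj.measure A.unop
      isProb := w.isProb A.unop
      pos := Proj.measure_pos A.unop }
  map Φ :=
    { pull := .ofIsLUB (Proj.map Φ.unop) (w.map_isLUB Φ.unop)
      measure_pull := fun p => congrArg Complex.re (Φ.unop.trace_map p.1) }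

/-! ### The Riesz functor -/

open WeakDual

/-- A measure on (the Baire sets of) the Gelfand spectrum represents the state of a tracial
`C⋆`-algebra if it is a Radon probability measure and the state is the integral of the Gelfand
transform. -/
structure Represents (A : CStarTau.{u})
    (μ : @Measure (characterSpace ℂ A.carrier) (baire _)) : Prop where
  isProb : @IsProbabilityMeasure _ (baire _) μ
  radon : @IsRadon _ _ (baire _) μ
  integral_eq : ∀ a : A.carrier,
    @integral _ _ _ _ (baire _) μ (fun φ : characterSpace ℂ A.carrier => φ a) = A.state a

/-- The well-definedness of the Riesz functor: every state is represented by a unique Radon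
probability measure on the spectrum, and homomorphisms induce measure-preserving maps. -/
structure RieszWellDefined : Prop where
  existsUnique : ∀ A : CStarTau.{u}, ∃! μ, Represents A μ
  measurePreserving : ∀ {A B : CStarTau.{u}} (Φ : A ⟶ B) (μ ν),
    Represents A μ → Represents B ν →
      @MeasurePreserving _ _ (baire _) (baire _)
        (CharacterSpace.compContinuousMap Φ.toStarAlgHom) ν μ

/-- The Riesz functor, taking a tracial commutative `C⋆`-algebra to its Gelfand spectrum with the
representing measure. -/
def RieszWellDefined.functor (w : RieszWellDefined.{u}) : CStarTau.{u}ᵒᵖ ⥤ CHProb.{u} where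
  obj A :=
    letI := baire (characterSpace ℂ A.unop.carrier)
    { carrier := characterSpace ℂ A.unop.carrier
      meas := baire _
      baire := ⟨rfl⟩
      μ := (w.existsUnique A.unop).choose
      isProb := (w.existsUnique A.unop).choose_spec.1.isProb
      radon := (w.existsUnique A.unop).choose_spec.1.radon }
  map Φ :=
    { toMap := CharacterSpace.compContinuousMap Φ.unop.toStarAlgHom
      measurePreserving := w.measurePreserving Φ.unop _ _
        (w.existsUnique _).choose_spec.1 (w.existsUnique _).choose_spec.1 }
  map_id A := CHProb.Hom.ext (CharacterSpace.compContinuousMap_id A.unop.carrier)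
  map_comp Φ Ψ := CHProb.Hom.ext
    (CharacterSpace.compContinuousMap_comp Φ.unop.toStarAlgHom Ψ.unop.toStarAlgHom)

/-! ### The canonical model functor -/

/-- The functor `L^∞` on abstract probability spaces. -/
def LinftyWellDefined.absFunctor (w : LinftyWellDefined.{u}) :
    AbsProb.{u} ⥤ VonNeumannTau.{u}ᵒᵖ :=
  mes ⋙ w.functor

/-- The canonical model functor: the Riesz functor applied to `L^∞`, regarded as a `C⋆`-algebra
with a state. -/
def stone (wL : LinftyWellDefined.{u}) (wR : RieszWellDefined.{u}) : ProbAlg.{u} ⥤ CHProb.{u} :=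
  wL.functor ⋙ VonNeumannTau.forget.op ⋙ wR.functor

end CanonicalModel

end

open CanonicalModel

noncomputable section
namespace CanonicalModel

open WeakDual Filter Topology

/-! ### Commutative `C⋆`-algebras through their characters -/

section Characters

variable {A : Type*} [CommCStarAlgebra A]

/-! Two dualities are proved separately and then glued along the forgetful functor.

The first is Gelfand duality with measures. On a compact space every Baire set depends on countably
many continuous functions, hence is pulled back from the metrizable space `ℕ → ℂ`. Finite Baire
measures are therefore automatically Radon and are determined by integrals of continuous functions.
With the Riesz–Markov–Kakutani theorem this gives `rieszWellDefined`, and the two natural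
isomorphisms come from the Gelfand transform and from evaluation at points.

The second is the duality of `L^∞` and projections. For a concrete space, `L^∞` is the dual of `L^1`
(`ConcLinfty.exists_pairing_eq`). A probability algebra is modelled by its Stone space: the content
carried by the basic sets extends to a measure because of compactness, and measurable sets modulo
null sets give back the algebra (`ProbAlg.stoneModel`). Abstractly measurable functions lift to the
model because `ℂ` is standard Borel (`Model.exists_measurable_lift`), so the whole structure on the
abstract `L^∞` can be transported from the model. The projections of `L^∞` are the indicator
functions, whence `linftyIdemIso`.

For the other composite, a predual forces bounded directed sets to have suprema
(`exists_isLUB_of_predual`): order intervals are intersections of balls, and balls are weak-*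
compact. Combined with normality and faithfulness of the trace, this shows that every bounded Baire
function on the spectrum of a tracial von Neumann algebra `A` agrees almost everywhere with exactly
one Gelfand transform. Thus `A` is `L^∞` of the probability algebra `specAlg` of its spectrum. The
rest is formal: Idem ≅ Idem ∘ L^∞ ∘ specAlg ≅ specAlg, and so L^∞ ∘ Idem ≅ L^∞ ∘ specAlg ≅ id.

Fullness of the forgetful functor is the separate fact that trace-preserving `⋆`-homomorphisms are
automatically normal (`isNormalMap_of_trace`). The other full and faithful functors are
equivalences, or, for `stone`, a composite of full and faithful functors. -/

theorem exists_apply_eq (g : C(characterSpace ℂ A, ℂ)) :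
    ∃ a : A, ∀ φ : characterSpace ℂ A, φ a = g φ := by
  obtain ⟨a, rfl⟩ := (gelfandStarTransform A).surjective g
  exact ⟨a, fun _ => rfl⟩

theorem ext_of_characters {a b : A} (h : ∀ φ : characterSpace ℂ A, φ a = φ b) : a = b :=
  (gelfandStarTransform A).injective (ContinuousMap.ext h)

theorem norm_gelfandStarTransform (a : A) : ‖gelfandStarTransform A a‖ = ‖a‖ :=
  (gelfandTransform_isometry A).norm_map_of_map_zero (map_zero _) a

theorem norm_le_iff_characters {a : A} {c : ℝ} (hc : 0 ≤ c) :
    ‖a‖ ≤ c ↔ ∀ φ : characterSpace ℂ A, ‖φ a‖ ≤ c := by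
  rw [← norm_gelfandStarTransform, ContinuousMap.norm_le _ hc]
  rfl

theorem norm_character_le (φ : characterSpace ℂ A) (a : A) : ‖φ a‖ ≤ ‖a‖ :=
  (norm_le_iff_characters (norm_nonneg a)).1 le_rfl φ

theorem continuous_character_apply (a : A) : Continuous fun φ : characterSpace ℂ A => φ a :=
  (gelfandStarTransform A a).continuous

attribute [local instance] CStarAlgebra.spectralOrder CStarAlgebra.spectralOrderedRing

open scoped ComplexOrder

/-- Conversely, the pointwise square root of the transform is continuous on the spectrum, hence is
the transform of some `c`, and then `a = star c * c`. -/
theorem nonneg_iff_characters {a : A} : 0 ≤ a ↔ ∀ φ : characterSpace ℂ A, 0 ≤ φ a := by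
  constructor
  · intro h φ
    obtain ⟨c, rfl⟩ := CStarAlgebra.nonneg_iff_eq_star_mul_self.1 h
    rw [map_mul, map_star]
    exact star_mul_self_nonneg _
  · intro h
    obtain ⟨c, hc⟩ := exists_apply_eq (A := A)
      ⟨fun φ => ((Real.sqrt (φ a).re : ℝ) : ℂ), Complex.continuous_ofReal.comp
        (Real.continuous_sqrt.comp (Complex.continuous_re.comp (continuous_character_apply a)))⟩
    refine CStarAlgebra.nonneg_iff_eq_star_mul_self.2 ⟨c, ext_of_characters fun φ => ?_⟩
    obtain ⟨h1, h2⟩ := Complex.le_def.1 (h φ)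
    rw [map_mul, map_star, hc]
    change _ = starRingEnd ℂ ((Real.sqrt (φ a).re : ℝ) : ℂ) * ((Real.sqrt (φ a).re : ℝ) : ℂ)
    rw [Complex.conj_ofReal, ← Complex.ofReal_mul, Real.mul_self_sqrt h1]
    exact Complex.ext rfl h2.symm

theorem le_iff_characters {a b : A} : a ≤ b ↔ ∀ φ : characterSpace ℂ A, φ a ≤ φ b := by
  rw [← sub_nonneg, nonneg_iff_characters]
  simp only [map_sub, sub_nonneg]

/-- The bound with `‖b - a‖` alone already holds; the factor 2 gives it the shape of the intervals
in `mem_interval_iff_norm`, whose length is twice the radius `r`. -/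
theorem le_add_norm_smul_one {a b : A} (h : a ≤ b) :
    b ≤ a + ((2 * ‖b - a‖ : ℝ) : ℂ) • (1 : A) := by
  rw [le_iff_characters] at h ⊢
  intro φ
  have h1 := norm_character_le φ (b - a)
  have h2 := Complex.le_def.1 (h φ)
  rw [map_sub] at h1
  have h3 := (le_abs_self _).trans (Complex.abs_re_le_norm (φ b - φ a))
  rw [map_add, map_smul, map_one, Complex.le_def]
  simp only [Complex.sub_re, smul_eq_mul, mul_one, Complex.add_re, Complex.ofReal_re,
    Complex.add_im, Complex.ofReal_im, add_zero] at h3 ⊢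
  refine ⟨?_, h2.2.symm⟩
  have := norm_nonneg (b - a)
  linarith

/-- The circle of centre `t * I` and radius `√(r² + t²)` passes through `r` and `-r`. As `t` runs to
both infinities the discs tend to the two half-planes, and only the segment `[-r, r]` is common to
all of them. -/
theorem mem_segment_iff_norm {w : ℂ} {r : ℝ} (hr : 0 ≤ r) :
    (∀ t : ℝ, ‖w - t * Complex.I‖ ≤ Real.sqrt (r ^ 2 + t ^ 2)) ↔
      w.im = 0 ∧ |w.re| ≤ r := by
  have key : ∀ t : ℝ, ‖w - t * Complex.I‖ ≤ Real.sqrt (r ^ 2 + t ^ 2) ↔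
      w.re ^ 2 + w.im ^ 2 - 2 * t * w.im ≤ r ^ 2 := by
    intro t
    rw [Real.le_sqrt (norm_nonneg _) (by positivity), ← Complex.normSq_eq_norm_sq,
      Complex.normSq_apply]
    simp only [Complex.sub_re, Complex.mul_re, Complex.ofReal_re, Complex.I_re, mul_zero,
      Complex.ofReal_im, Complex.I_im, Complex.sub_im, Complex.mul_im]
    constructor <;> intro h <;> nlinarith
  simp only [key]
  constructor
  · intro h
    have h0 : w.im = 0 := by
      by_contra h0
      -- The condition is affine in `t` with slope `-2 * w.im`; this `t` makes its left side equal
      -- to `r ^ 2 + 1`.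
      have := h ((w.re ^ 2 + w.im ^ 2 - r ^ 2 - 1) / (2 * w.im))
      have e : 2 * ((w.re ^ 2 + w.im ^ 2 - r ^ 2 - 1) / (2 * w.im)) * w.im =
        w.re ^ 2 + w.im ^ 2 - r ^ 2 - 1 := by field_simp
      rw [e] at this
      linarith
    refine ⟨h0, abs_le_of_sq_le_sq ?_ hr⟩
    have := h 0
    rw [h0] at this
    linarith
  · rintro ⟨h0, h1⟩ t
    rw [h0]
    have := sq_le_sq' (abs_le.1 h1).1 (abs_le.1 h1).2
    linarith

/-- Order intervals are intersections of closed balls. -/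
theorem mem_interval_iff_norm {p z : A} {r : ℝ} (hr : 0 ≤ r) :
    (∀ t : ℝ, ‖z - (p + ((r : ℂ) + t * Complex.I) • (1 : A))‖ ≤ Real.sqrt (r ^ 2 + t ^ 2)) ↔
      p ≤ z ∧ z ≤ p + ((2 * r : ℝ) : ℂ) • (1 : A) := by
  have h1 : ∀ t : ℝ,
      ‖z - (p + ((r : ℂ) + t * Complex.I) • (1 : A))‖ ≤ Real.sqrt (r ^ 2 + t ^ 2) ↔
      ∀ φ : characterSpace ℂ A,
        ‖(φ z - φ p - r) - t * Complex.I‖ ≤ Real.sqrt (r ^ 2 + t ^ 2) := by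
    intro t
    rw [norm_le_iff_characters (Real.sqrt_nonneg _)]
    refine forall_congr' fun φ => ?_
    rw [map_sub, map_add, map_smul, map_one, smul_eq_mul, mul_one]
    ring_nf
  simp only [h1]
  -- With the character fixed and `t` varying, the claim is the scalar one about discs and a
  -- segment.
  rw [forall_comm]
  simp only [mem_segment_iff_norm hr, le_iff_characters]
  rw [← forall_and]
  refine forall_congr' fun φ => ?_
  rw [map_add, map_smul, map_one, Complex.le_def, Complex.le_def, abs_le]
  simp only [Complex.sub_re, smul_eq_mul, mul_one, Complex.add_re, Complex.ofReal_re,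
    Complex.add_im, Complex.ofReal_im, add_zero, Complex.sub_im, sub_zero]
  constructor
  · rintro ⟨h1, h2, h3⟩
    refine ⟨⟨?_, ?_⟩, ?_, ?_⟩ <;> linarith
  · rintro ⟨⟨h1, h2⟩, h3, h4⟩
    refine ⟨?_, ?_, ?_⟩ <;> linarith

end Characters

/-! ### Compactness and suprema of bounded directed sets -/

section Predual

variable {A : Type*} [CommCStarAlgebra A] {X : Type*} [NormedAddCommGroup X] [NormedSpace ℂ X]

/-- Banach–Alaoglu and the finite intersection property: balls of the dual are weak-* compact, and
the half-space `Re f(x) ≤ s` is weak-* closed. The half-space is carried along so that the supremum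
found below is also controlled by an element of the predual, which yields normality. -/
theorem exists_mem_closedBalls (e : StrongDual ℂ X ≃ₗᵢ⋆[ℂ] A) {ι : Type*} [Nonempty ι]
    (c : ι → A) (r : ι → ℝ) (x : X) (s : ℝ)
    (h : ∀ F : Finset ι, ∃ z, (∀ i ∈ F, ‖z - c i‖ ≤ r i) ∧ (e.symm z x).re ≤ s) :
    ∃ z, (∀ i, ‖z - c i‖ ≤ r i) ∧ (e.symm z x).re ≤ s := by
  classical
  let i₀ : ι := Classical.arbitrary ι
  let B : ι → Set (WeakDual ℂ X) := fun i =>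
    WeakDual.toStrongDual ⁻¹' Metric.closedBall (e.symm (c i)) (r i)
  have hB : ∀ (i : ι) (z : A), StrongDual.toWeakDual (e.symm z) ∈ B i ↔ ‖z - c i‖ ≤ r i := by
    intro i z
    change dist (e.symm z) (e.symm (c i)) ≤ r i ↔ _
    rw [e.symm.dist_map, dist_eq_norm]
  let H : Set (WeakDual ℂ X) := {f | (f x).re ≤ s}
  have hH : IsClosed H := isClosed_le
    (Complex.continuous_re.comp (WeakDual.eval_continuous x)) continuous_const
  have hc : IsCompact (B i₀ ∩ H) :=
    (WeakDual.isCompact_closedBall (e.symm (c i₀)) (r i₀)).inter_right hH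
  obtain ⟨f, hf⟩ := hc.inter_iInter_nonempty B
    (fun i => WeakDual.isClosed_closedBall (e.symm (c i)) (r i)) (by
      intro F
      obtain ⟨z, hz, hs⟩ := h (insert i₀ F)
      refine ⟨StrongDual.toWeakDual (e.symm z),
        ⟨(hB _ _).2 (hz _ (Finset.mem_insert_self _ _)), hs⟩, ?_⟩
      simp only [Set.mem_iInter]
      exact fun i hi => (hB _ _).2 (hz _ (Finset.mem_insert_of_mem hi)))
  refine ⟨e (WeakDual.toStrongDual f), fun i => ?_, ?_⟩
  · rw [← hB]
    have := Set.mem_iInter.1 hf.2 i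
    simpa using this
  · rw [e.symm_apply_apply]
    exact hf.1.2

attribute [local instance] CStarAlgebra.spectralOrder CStarAlgebra.spectralOrderedRing

/-- In a commutative `C⋆`-algebra with a predual, bounded directed sets have suprema, and these are
compatible with the functionals in the predual. -/
theorem exists_isLUB_of_predual (e : StrongDual ℂ X ≃ₗᵢ⋆[ℂ] A) {d : Set A} (hne : d.Nonempty)
    (hd : DirectedOn (· ≤ ·) d) (hb : BddAbove d) (x : X) (s : ℝ)
    (hs : ∀ y ∈ d, (e.symm y x).re ≤ s) :
    ∃ a, IsLUB d a ∧ (e.symm a x).re ≤ s := by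
  obtain ⟨y₀, hy₀⟩ := hne
  obtain ⟨u₀, hu₀⟩ := hb
  -- Each `y ∈ d` gives an interval starting at `y` and reaching beyond `u₀`, each upper bound `u`
  -- an interval ending at `u` and starting below `y₀`. A common point of all these intervals is an
  -- upper bound of `d` lying below every upper bound.
  let p : d ⊕ upperBounds d → A := Sum.elim (fun y => y.1)
    fun u => u.1 - ((2 * ‖u.1 - y₀‖ : ℝ) : ℂ) • (1 : A)
  let R : d ⊕ upperBounds d → ℝ := Sum.elim (fun y => ‖u₀ - y.1‖) fun u => ‖u.1 - y₀‖
  have hR : ∀ i, 0 ≤ R i := by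
    rintro (i | i) <;> exact norm_nonneg _
  have : Nonempty ((d ⊕ upperBounds d) × ℝ) := ⟨(.inl ⟨y₀, hy₀⟩, 0)⟩
  have key : ∃ z, (∀ i : (d ⊕ upperBounds d) × ℝ,
      ‖z - (p i.1 + ((R i.1 : ℂ) + i.2 * Complex.I) • (1 : A))‖ ≤
        Real.sqrt (R i.1 ^ 2 + i.2 ^ 2)) ∧ (e.symm z x).re ≤ s := by
    refine exists_mem_closedBalls e _ _ x s fun F => ?_
    classical
    -- Only finitely many lower constraints are present, so by directedness one member of `d`
    -- satisfies them all; being in `d`, it also satisfies the upper ones.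
    have hF : ∃ y ∈ d, y₀ ≤ y ∧ ∀ i ∈ F, ∀ w, i.1 = Sum.inl w → w.1 ≤ y := by
      induction F using Finset.induction_on with
      | empty => exact ⟨y₀, hy₀, le_rfl, by simp⟩
      | insert i F _ ih =>
        obtain ⟨y, hy, h0, h⟩ := ih
        obtain ⟨(w | u), t⟩ := i
        · obtain ⟨y', hy', h1, h2⟩ := hd y hy w.1 w.2
          refine ⟨y', hy', h0.trans h1, fun j hj v hv => ?_⟩
          rcases Finset.mem_insert.1 hj with rfl | hj
          · cases hv; exact h2
          · exact (h j hj v hv).trans h1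
        · refine ⟨y, hy, h0, fun j hj v hv => ?_⟩
          rcases Finset.mem_insert.1 hj with rfl | hj
          · cases hv
          · exact h j hj v hv
    obtain ⟨y, hy, h0, h⟩ := hF
    refine ⟨y, fun i hi => ?_, hs y hy⟩
    refine (mem_interval_iff_norm (hR i.1)).2 ?_ i.2
    obtain ⟨(w | u), t⟩ := i
    · refine ⟨h _ hi w rfl, (hu₀ hy).trans ?_⟩
      exact le_add_norm_smul_one (hu₀ w.2)
    · refine ⟨?_, ?_⟩
      · refine le_trans ?_ h0
        exact sub_le_iff_le_add.2 (le_add_norm_smul_one (u.2 hy₀))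
      · change y ≤ u.1 - ((2 * ‖u.1 - y₀‖ : ℝ) : ℂ) • (1 : A) + ((2 * ‖u.1 - y₀‖ : ℝ) : ℂ) • 1
        rw [sub_add_cancel]
        exact u.2 hy
  obtain ⟨z, hz, hzs⟩ := key
  refine ⟨z, ⟨fun y hy => ?_, fun u hu => ?_⟩, hzs⟩
  · exact ((mem_interval_iff_norm (hR (.inl ⟨y, hy⟩))).1 fun t => hz (.inl ⟨y, hy⟩, t)).1
  · have := ((mem_interval_iff_norm (hR (.inr ⟨u, hu⟩))).1 fun t => hz (.inr ⟨u, hu⟩, t)).2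
    refine this.trans ?_
    change u - ((2 * ‖u - y₀‖ : ℝ) : ℂ) • (1 : A) + ((2 * ‖u - y₀‖ : ℝ) : ℂ) • 1 ≤ u
    rw [sub_add_cancel]

theorem exists_isLUB_of_directedOn {A : Type u} [CommCStarAlgebra A] [h : WStarAlgebra A]
    {d : Set A} (hne : d.Nonempty)
    (hd : DirectedOn (· ≤ ·) d) (hb : BddAbove d) : ∃ a, IsLUB d a := by
  obtain ⟨X, _, _, _, ⟨e⟩⟩ := h.exists_predual
  -- With the zero vector of the predual and `s = 0` the half-space condition is void.
  obtain ⟨a, ha, _⟩ := exists_isLUB_of_predual e hne hd hb 0 0 (by simp)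
  exact ⟨a, ha⟩

/-- A monotone functional given by an element of the predual is normal. -/
theorem isNormalFunctional_of_predual (e : StrongDual ℂ X ≃ₗᵢ⋆[ℂ] A) (τ : A → ℂ) (x : X)
    (hτ : ∀ a, (τ a).re = (e.symm a x).re) (hmono : ∀ a b, a ≤ b → (τ a).re ≤ (τ b).re) :
    IsNormalFunctional τ := by
  intro d hne hd a ha
  refine ⟨?_, fun s hs => ?_⟩
  · rintro _ ⟨y, hy, rfl⟩
    exact hmono _ _ (ha.1 hy)
  -- A bound `s` for the functional on `d` is a weak-* closed condition, hence passes to the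
  -- supremum.
  · obtain ⟨b, hb, hbs⟩ := exists_isLUB_of_predual e hne hd ⟨a, ha.1⟩ x s
      fun y hy => (hτ y).symm.trans_le (hs ⟨y, hy, rfl⟩)
    rw [ha.unique hb]
    exact (hτ b).trans_le hbs

end Predual

/-! ### Positivity and automatic normality -/

section Trace

attribute [local instance] CStarAlgebra.spectralOrder CStarAlgebra.spectralOrderedRing

open scoped ComplexOrder

variable {A B : Type u} [TracialVonNeumann A] [TracialVonNeumann B]

open TracialVonNeumann

theorem trace_nonneg_of_nonneg {a : A} (h : 0 ≤ a) : 0 ≤ trace a := by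
  obtain ⟨c, rfl⟩ := CStarAlgebra.nonneg_iff_eq_star_mul_self.1 h
  rw [mul_comm]
  exact trace_nonneg c

theorem eq_zero_of_trace_nonpos {a : A} (h : 0 ≤ a) (ht : (trace a).re ≤ 0) : a = 0 := by
  have h1 := Complex.le_def.1 (trace_nonneg_of_nonneg h)
  obtain ⟨c, rfl⟩ := CStarAlgebra.nonneg_iff_eq_star_mul_self.1 h
  have h2 : trace (c * star c) = 0 := by
    rw [mul_comm]
    exact Complex.ext (le_antisymm ht h1.1) h1.2.symm
  rw [(trace_faithful c).1 h2, star_zero, zero_mul]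

theorem trace_re_mono {a b : A} (h : a ≤ b) : (trace a).re ≤ (trace b).re := by
  have := (Complex.le_def.1 (trace_nonneg_of_nonneg (sub_nonneg.2 h))).1
  rw [map_sub, Complex.sub_re, Complex.zero_re] at this
  linarith

theorem starAlgHom_mono {A B : Type*} [CommCStarAlgebra A] [CommCStarAlgebra B]
    (Φ : A →⋆ₐ[ℂ] B) {a b : A} (h : a ≤ b) : Φ a ≤ Φ b := by
  obtain ⟨c, hc⟩ := CStarAlgebra.nonneg_iff_eq_star_mul_self.1 (sub_nonneg.2 h)
  rw [← sub_nonneg, ← map_sub, hc, map_mul, map_star]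
  exact star_mul_self_nonneg _

/-- A trace-preserving `⋆`-homomorphism is automatically normal. -/
theorem isNormalMap_of_trace (Φ : A →⋆ₐ[ℂ] B) (h : ∀ a, trace (Φ a) = trace a) :
    IsNormalMap Φ := by
  intro d hne hd a ha
  refine ⟨?_, fun c hc => ?_⟩
  · rintro _ ⟨y, hy, rfl⟩
    exact starAlgHom_mono Φ (ha.1 hy)
  -- `w` is the positive part of `Φ a - c`. It lies below `Φ a - Φ y` for every `y ∈ d`, so its
  -- trace is at most `trace a - trace y`, and normality of the trace on the source makes this
  -- arbitrarily small. Faithfulness then gives `w = 0`.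
  · obtain ⟨w, hw⟩ := exists_apply_eq (A := B)
      ⟨fun φ => ((max (φ (Φ a - c)).re 0 : ℝ) : ℂ), Complex.continuous_ofReal.comp
        ((Complex.continuous_re.comp (continuous_character_apply _)).max continuous_const)⟩
    have hw0 : 0 ≤ w := nonneg_iff_characters.2 fun φ => by
      rw [hw]
      exact Complex.zero_le_real.2 (le_max_right _ _)
    have hle : ∀ y ∈ d, w ≤ Φ a - Φ y := by
      intro y hy
      rw [le_iff_characters]
      intro φ
      have h1 := Complex.le_def.1 (le_iff_characters.1 (hc ⟨y, hy, rfl⟩) φ)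
      have h2 := Complex.le_def.1 (le_iff_characters.1 (starAlgHom_mono Φ (ha.1 hy)) φ)
      rw [hw, Complex.le_def]
      simp only [map_sub, ContinuousMap.coe_mk, Complex.sub_re, Complex.ofReal_re,
        Complex.ofReal_im, Complex.sub_im]
      refine ⟨max_le ?_ ?_, ?_⟩ <;> linarith [h1.1, h2.1, h2.2]
    have hτ : (trace w).re ≤ 0 := by
      have h1 : (trace a).re ≤ (trace a).re - (trace w).re := by
        refine (trace_normal hne hd ha).2 ?_
        rintro _ ⟨y, hy, rfl⟩
        have := trace_re_mono (hle y hy)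
        rw [map_sub, h, h, Complex.sub_re] at this
        change (trace y).re ≤ _
        linarith
      linarith
    have hw1 := eq_zero_of_trace_nonpos hw0 hτ
    -- The order of `ℂ` also requires equal imaginary parts: `Φ a` and `c` both dominate this `Φ y`.
    obtain ⟨y, hy⟩ := hne
    rw [le_iff_characters]
    intro φ
    have h1 := Complex.le_def.1 (le_iff_characters.1 (hc ⟨y, hy, rfl⟩) φ)
    have h2 := Complex.le_def.1 (le_iff_characters.1 (starAlgHom_mono Φ (ha.1 hy)) φ)
    have h3 := hw φ
    rw [hw1, map_zero] at h3
    have h4 : max (φ (Φ a - c)).re 0 = 0 := Complex.ofReal_eq_zero.1 h3.symm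
    have h5 := max_eq_right_iff.1 h4
    rw [map_sub, Complex.sub_re] at h5
    exact Complex.le_def.2 ⟨by linarith, by rw [← h2.2, h1.2]⟩

end Trace

/-- Trace-preserving `⋆`-homomorphisms are morphisms of tracial von Neumann algebras. -/
def VonNeumannTau.homOfTrace {A B : VonNeumannTau.{u}} (Φ : A.carrier →⋆ₐ[ℂ] B.carrier)
    (h : ∀ a, B.trace (Φ a) = A.trace a) : A ⟶ B :=
  VonNeumannTau.Hom.mk Φ (isNormalMap_of_trace Φ h) h

/-- A bijective morphism of tracial von Neumann algebras is an isomorphism. -/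
def VonNeumannTau.isoOfBijective {A B : VonNeumannTau.{u}} (Φ : A ⟶ B)
    (h : Function.Bijective Φ.toStarAlgHom) : A ≅ B where
  hom := Φ
  inv := VonNeumannTau.homOfTrace
    ((StarAlgEquiv.ofBijective Φ.toStarAlgHom h).symm : B.carrier →⋆ₐ[ℂ] A.carrier) (fun b => by
      obtain ⟨a, rfl⟩ := h.2 b
      rw [Φ.trace_map]
      exact congrArg _ ((StarAlgEquiv.ofBijective Φ.toStarAlgHom h).symm_apply_apply a))
  hom_inv_id := VonNeumannTau.hom_ext fun a =>
    (StarAlgEquiv.ofBijective Φ.toStarAlgHom h).symm_apply_apply a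
  inv_hom_id := VonNeumannTau.hom_ext fun a =>
    (StarAlgEquiv.ofBijective Φ.toStarAlgHom h).apply_symm_apply a

/-- A bijective morphism of tracial `C⋆`-algebras is an isomorphism. -/
def CStarTau.isoOfBijective {A B : CStarTau.{u}} (Φ : A ⟶ B)
    (h : Function.Bijective Φ.toStarAlgHom) : A ≅ B where
  hom := Φ
  inv := CStarTau.Hom.mk
    ((StarAlgEquiv.ofBijective Φ.toStarAlgHom h).symm : B.carrier →⋆ₐ[ℂ] A.carrier) (fun b => by
      obtain ⟨a, rfl⟩ := h.2 b
      rw [Φ.state_map]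
      exact congrArg _ ((StarAlgEquiv.ofBijective Φ.toStarAlgHom h).symm_apply_apply a))
  hom_inv_id := CStarTau.Hom.ext (StarAlgHom.ext fun a =>
    (StarAlgEquiv.ofBijective Φ.toStarAlgHom h).symm_apply_apply a)
  inv_hom_id := CStarTau.Hom.ext (StarAlgHom.ext fun a =>
    (StarAlgEquiv.ofBijective Φ.toStarAlgHom h).apply_symm_apply a)

instance : VonNeumannTau.forget.{u}.Faithful where
  map_injective h := VonNeumannTau.hom_ext fun a =>
    DFunLike.congr_fun (congrArg CStarTau.Hom.toStarAlgHom h) a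

/-- Fullness is exactly automatic normality: the morphisms downstairs are only required to preserve
the trace. -/
instance : VonNeumannTau.forget.{u}.Full where
  map_surjective Φ := ⟨VonNeumannTau.homOfTrace Φ.toStarAlgHom Φ.state_map, rfl⟩

end CanonicalModel
end

noncomputable section
namespace CanonicalModel

open WeakDual Filter Topology

/-! ### Baire sets and Baire measures on compact spaces -/

section Baire

variable {X : Type*} [TopologicalSpace X]

/-- Every Baire set is determined by countably many continuous functions. -/
theorem exists_preimage_eq_of_measurableSet_baire {S : Set X} (hS : MeasurableSet[baire X] S) :
    ∃ (F : ℕ → C(X, ℂ)) (T : Set (ℕ → ℂ)), MeasurableSet T ∧ S = (fun x n => F n x) ⁻¹' T := by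
  rw [baire, MeasurableSpace.measurableSet_iSup] at hS
  induction hS with
  | basic S hS =>
    obtain ⟨f, U, hU, rfl⟩ := hS
    exact ⟨fun _ => f, (fun z => z 0) ⁻¹' U, measurable_pi_apply 0 hU, rfl⟩
  | empty => exact ⟨fun _ => 0, ∅, .empty, rfl⟩
  | compl S _ ih =>
    obtain ⟨F, T, hT, rfl⟩ := ih
    exact ⟨F, Tᶜ, hT.compl, rfl⟩
  | iUnion S _ ih =>
    choose F T hT h using ih
    -- The pairing function merges countably many sequences of functions into one.
    refine ⟨fun n => F n.unpair.1 n.unpair.2,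
      ⋃ k, (fun (z : ℕ → ℂ) m => z (Nat.pair k m)) ⁻¹' T k, ?_, ?_⟩
    · exact .iUnion fun k => (measurable_pi_lambda _ fun m => measurable_pi_apply _) (hT k)
    · rw [Set.preimage_iUnion]
      refine Set.iUnion_congr fun k => ?_
      rw [h k, ← Set.preimage_comp]
      congr 1
      funext x m
      simp

variable [m : MeasurableSpace X] [hm : IsBaireSigmaAlgebra X]

theorem measurable_of_continuous_complex (f : C(X, ℂ)) : Measurable f := by
  have h : MeasurableSpace.comap f inferInstance ≤ m := by
    rw [hm.eq_baire]
    exact le_iSup (fun f : C(X, ℂ) => MeasurableSpace.comap f inferInstance) f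
  exact fun s hs => h _ ⟨s, hs, rfl⟩

theorem measurable_sequence (F : ℕ → C(X, ℂ)) : Measurable fun x n => F n x :=
  measurable_pi_lambda _ fun n => measurable_of_continuous_complex (F n)

/-- Finite Baire measures on compact spaces are Radon. -/
theorem isRadon_of_isFiniteMeasure [CompactSpace X] (μ : Measure X) [IsFiniteMeasure μ] :
    IsRadon μ := by
  intro S hS r hr
  obtain ⟨F, T, hT, rfl⟩ := exists_preimage_eq_of_measurableSet_baire (hm.eq_baire ▸ hS)
  have hF := measurable_sequence F
  rw [← Measure.map_apply hF hT] at hr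
  -- Finite measures on the metrizable space `ℕ → ℂ` are inner regular for closed sets. A closed set
  -- there is `Gδ`, and its preimage in the compact space is a compact `Gδ`.
  obtain ⟨K, hKT, hK, hrK⟩ := Measure.WeaklyRegular.innerRegular_measurable
    (μ := μ.map fun x n => F n x) ⟨hT, measure_ne_top _ _⟩ r hr
  have hc : Continuous fun x n => F n x := continuous_pi fun n => (F n).continuous
  refine ⟨(fun x n => F n x) ⁻¹' K, Set.preimage_mono hKT,
    ⟨hF hK.measurableSet, (hK.preimage hc).isCompact, hK.isGδ.preimage hc⟩, ?_⟩
  rwa [Measure.map_apply hF hK.measurableSet] at hrK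

/-- Finite Baire measures are determined by the integrals of continuous functions. -/
theorem measure_ext_of_integral (μ ν : Measure X) [IsFiniteMeasure μ] [IsFiniteMeasure ν]
    (h : ∀ f : C(X, ℂ), ∫ x, f x ∂μ = ∫ x, f x ∂ν) : μ = ν := by
  ext S hS
  obtain ⟨F, T, hT, rfl⟩ := exists_preimage_eq_of_measurableSet_baire (hm.eq_baire ▸ hS)
  have hF := measurable_sequence F
  have hc : Continuous fun x n => F n x := continuous_pi fun n => (F n).continuous
  -- On `ℕ → ℂ`, which is metrizable, bounded continuous functions determine finite measures, and
  -- they pull back to continuous functions on `X`.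
  suffices H : μ.map (fun x n => F n x) = ν.map fun x n => F n x by
    rw [← Measure.map_apply hF hT, H, Measure.map_apply hF hT]
  refine ext_of_forall_integral_eq_of_IsFiniteMeasure fun g => ?_
  rw [integral_map hF.aemeasurable g.continuous.aestronglyMeasurable,
    integral_map hF.aemeasurable g.continuous.aestronglyMeasurable]
  have := h ⟨fun x => ((g fun n => F n x : ℝ) : ℂ),
    Complex.continuous_ofReal.comp (g.continuous.comp hc)⟩
  simp only [ContinuousMap.coe_mk] at this
  rw [integral_complex_ofReal, integral_complex_ofReal] at this
  exact_mod_cast this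

end Baire

/-! ### The representing measure of a state -/

/-- A real continuous function as a complex continuous function. -/
def complexify {X : Type*} [TopologicalSpace X] (f : C(X, ℝ)) : C(X, ℂ) :=
  ⟨fun x => (f x : ℂ), Complex.continuous_ofReal.comp f.continuous⟩

theorem baire_le_borel (X : Type*) [TopologicalSpace X] : baire X ≤ borel X := by
  refine iSup_le fun f => ?_
  let := borel X
  have : BorelSpace X := ⟨rfl⟩
  exact f.continuous.measurable.comap_le

open scoped ComplexOrder CompactlySupported in
-- The real Riesz–Markov–Kakutani theorem applies to the real part of `Λ` on real functions, where
-- `Λ` is real and positive. Its Borel measure is then restricted to the Baire sets, and complex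
-- functions are split into real and imaginary parts.
theorem exists_measure_of_positive {X : Type*} [TopologicalSpace X] [CompactSpace X] [T2Space X]
    (Λ : C(X, ℂ) →ₗ[ℂ] ℂ) (hΛ : ∀ f, 0 ≤ Λ (star f * f)) :
    ∃ μ : @Measure X (baire X), @IsFiniteMeasure X (baire X) μ ∧
      ∀ f : C(X, ℂ), @integral _ _ _ _ (baire X) μ f = Λ f := by
  have hpos : ∀ f : C(X, ℝ), (∀ x, 0 ≤ f x) → 0 ≤ Λ (complexify f) := by
    intro f hf
    let g : C(X, ℝ) := ⟨fun x => Real.sqrt (f x), Real.continuous_sqrt.comp f.continuous⟩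
    have : complexify f = star (complexify g) * complexify g := by
      ext x
      change ((f x : ℝ) : ℂ) = starRingEnd ℂ ((Real.sqrt (f x) : ℝ) : ℂ) * (Real.sqrt (f x) : ℝ)
      rw [Complex.conj_ofReal, ← Complex.ofReal_mul, Real.mul_self_sqrt (hf x)]
    rw [this]
    exact hΛ _
  -- `f` is the difference of the two non-negative functions `f + ‖f‖` and `‖f‖`, on which `Λ` is
  -- real.
  have him : ∀ f : C(X, ℝ), (Λ (complexify f)).im = 0 := by
    intro f
    have h1 := (Complex.le_def.1 (hpos (ContinuousMap.const X ‖f‖) fun _ => norm_nonneg f)).2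
    have h2 := (Complex.le_def.1 (hpos (f + ContinuousMap.const X ‖f‖) fun x => by
      have := neg_le_of_abs_le (f.norm_coe_le_norm x)
      change 0 ≤ f x + ‖f‖
      linarith)).2
    have h3 : complexify (f + ContinuousMap.const X ‖f‖) =
        complexify f + complexify (ContinuousMap.const X ‖f‖) := by
      ext x
      exact Complex.ofReal_add _ _
    rw [h3, map_add, Complex.add_im] at h2
    rw [Complex.zero_im] at h1 h2
    linarith
  let : MeasurableSpace X := borel X
  have : BorelSpace X := ⟨rfl⟩
  let L : C_c(X, ℝ) →ₗ[ℝ] ℝ :=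
    { toFun := fun f => (Λ (complexify f.toContinuousMap)).re
      map_add' := fun f g => by
        rw [← Complex.add_re, ← map_add]
        congr 2
        ext x
        exact Complex.ofReal_add _ _
      map_smul' := fun c f => by
        have : complexify (c • f).toContinuousMap =
            (c : ℂ) • complexify f.toContinuousMap := by
          ext x
          exact Complex.ofReal_mul _ _
        change (Λ (complexify (c • f).toContinuousMap)).re = _
        rw [this, map_smul, smul_eq_mul, Complex.re_ofReal_mul]
        rfl }
  let P : C_c(X, ℝ) →ₚ[ℝ] ℝ := PositiveLinearMap.mk₀ L fun f hf =>
    (Complex.le_def.1 (hpos f.toContinuousMap fun x => hf x)).1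
  let ν : Measure X := RealRMK.rieszMeasure P
  have hreal : ∀ f : C(X, ℝ), ∫ x, f x ∂ν = (Λ (complexify f)).re := fun f =>
    RealRMK.integral_rieszMeasure P ⟨f, HasCompactSupport.of_compactSpace f⟩
  have hint : ∀ f : C(X, ℝ), Integrable f ν := fun f =>
    f.continuous.integrable_of_hasCompactSupport (HasCompactSupport.of_compactSpace f)
  -- Continuous functions are Baire measurable, so trimming the measure does not affect their
  -- integrals.
  refine ⟨ν.trim (baire_le_borel X), isFiniteMeasure_trim _, fun f => ?_⟩
  have hm : StronglyMeasurable[baire X] f := by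
    let : MeasurableSpace X := baire X
    have : IsBaireSigmaAlgebra X := ⟨rfl⟩
    exact (measurable_of_continuous_complex f).stronglyMeasurable
  rw [← integral_trim _ hm]
  let a : C(X, ℝ) := ⟨fun x => (f x).re, Complex.continuous_re.comp f.continuous⟩
  let b : C(X, ℝ) := ⟨fun x => (f x).im, Complex.continuous_im.comp f.continuous⟩
  have hf : f = complexify a + Complex.I • complexify b := by
    ext x
    change f x = ((f x).re : ℂ) + Complex.I * ((f x).im : ℂ)
    rw [mul_comm, Complex.re_add_im]
  have hca : ∀ c : C(X, ℝ), Λ (complexify c) = ((∫ x, c x ∂ν : ℝ) : ℂ) := fun c => by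
    rw [hreal]
    exact Complex.ext rfl (him c)
  rw [hf, map_add, map_smul, hca, hca]
  have h1 : ∀ c : C(X, ℝ), Integrable (complexify c) ν := fun c => (hint c).ofReal
  change ∫ x, (complexify a x + Complex.I • complexify b x) ∂ν = _
  have h2 : Integrable (fun x => Complex.I • complexify b x) ν := (h1 b).smul Complex.I
  rw [integral_add (h1 a) h2, integral_smul]
  congr 1
  · exact integral_ofReal
  · congr 1
    exact integral_ofReal

theorem exists_gelfandStarTransform_eq {A : Type*} [CommCStarAlgebra A]
    (f : C(characterSpace ℂ A, ℂ)) : ∃ a, gelfandStarTransform A a = f :=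
  ⟨(gelfandStarTransform A).symm f, (gelfandStarTransform A).apply_symm_apply f⟩

theorem represents_of_integral (A : CStarTau.{u})
    (μ : @Measure (characterSpace ℂ A.carrier) (baire _))
    (h : @IsProbabilityMeasure _ (baire _) μ)
    (hi : ∀ f : C(characterSpace ℂ A.carrier, ℂ), @integral _ _ _ _ (baire _) μ f =
      A.state ((gelfandStarTransform A.carrier).symm f)) : Represents A μ := by
  let : MeasurableSpace (characterSpace ℂ A.carrier) := baire _
  have : IsBaireSigmaAlgebra (characterSpace ℂ A.carrier) := ⟨rfl⟩
  refine ⟨h, isRadon_of_isFiniteMeasure μ, fun a => ?_⟩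
  have := hi (gelfandStarTransform A.carrier a)
  rw [StarAlgEquiv.symm_apply_apply] at this
  exact this

theorem Represents.integral_continuous {A : CStarTau.{u}}
    {μ : @Measure (characterSpace ℂ A.carrier) (baire _)} (h : Represents A μ)
    (f : C(characterSpace ℂ A.carrier, ℂ)) : @integral _ _ _ _ (baire _) μ f =
      A.state ((gelfandStarTransform A.carrier).symm f) := by
  obtain ⟨a, rfl⟩ := exists_gelfandStarTransform_eq f
  rw [StarAlgEquiv.symm_apply_apply]
  exact h.integral_eq a

open scoped ComplexOrder in
-- The total mass is the value of the state at `1`. It is at most the norm of the state, which is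
-- `1`; conversely the integral formula bounds the norm of the state by the mass.
theorem exists_represents (A : CStarTau.{u}) : ∃ μ, Represents A μ := by
  let : MeasurableSpace (characterSpace ℂ A.carrier) := baire _
  have : IsBaireSigmaAlgebra (characterSpace ℂ A.carrier) := ⟨rfl⟩
  obtain ⟨μ, hμ, h⟩ := exists_measure_of_positive
    (A.state.toLinearMap.comp ((gelfandStarTransform A.carrier).symm :
      C(characterSpace ℂ A.carrier, ℂ) →⋆ₐ[ℂ] A.carrier).toAlgHom.toLinearMap) (fun f => by
        change 0 ≤ A.state ((gelfandStarTransform A.carrier).symm (star f * f))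
        rw [map_mul, map_star]
        exact A.state_nonneg _)
  have h' : ∀ f : C(characterSpace ℂ A.carrier, ℂ), ∫ x, f x ∂μ =
      A.state ((gelfandStarTransform A.carrier).symm f) := h
  refine ⟨μ, represents_of_integral A μ ⟨?_⟩ h'⟩
  have h1 : A.state 1 = μ.real Set.univ := by
    have := h' 1
    rw [map_one] at this
    rw [← this]
    simp
  -- Needed for `‖1‖ = 1`; a functional on the zero algebra cannot have norm `1`.
  have hnt : Nontrivial A.carrier := by
    by_contra hn
    rw [not_nontrivial_iff_subsingleton] at hn
    have : A.state = 0 := ContinuousLinearMap.ext fun a => by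
      rw [Subsingleton.elim a 0, map_zero, map_zero]
    have h2 := A.norm_state
    rw [this, norm_zero] at h2
    exact zero_ne_one h2
  have h2 : μ.real Set.univ ≤ 1 := by
    have := A.state.le_opNorm 1
    rw [h1, A.norm_state, norm_one, mul_one, Complex.norm_real] at this
    exact (le_abs_self _).trans this
  have h3 : 1 ≤ μ.real Set.univ := by
    rw [← A.norm_state]
    refine ContinuousLinearMap.opNorm_le_bound _ measureReal_nonneg fun a => ?_
    have := h' (gelfandStarTransform A.carrier a)
    rw [StarAlgEquiv.symm_apply_apply] at this
    rw [← this, mul_comm]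
    refine norm_integral_le_of_norm_le_const (ae_of_all _ fun x => ?_)
    exact norm_character_le x a
  have h4 := le_antisymm h2 h3
  rw [measureReal_def] at h4
  rw [← ENNReal.ofReal_toReal (measure_ne_top μ _), h4, ENNReal.ofReal_one]

/-- Uniqueness and preservation of measures both reduce to comparing integrals of continuous
functions, each of which is a Gelfand transform. -/
theorem rieszWellDefined : RieszWellDefined.{u} where
  existsUnique A := by
    obtain ⟨μ, hμ⟩ := exists_represents A
    refine ⟨μ, hμ, fun ν hν => ?_⟩
    let : MeasurableSpace (characterSpace ℂ A.carrier) := baire _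
    have : IsBaireSigmaAlgebra (characterSpace ℂ A.carrier) := ⟨rfl⟩
    have := hμ.isProb
    have := hν.isProb
    refine measure_ext_of_integral ν μ fun f => ?_
    exact (hν.integral_continuous f).trans (hμ.integral_continuous f).symm
  measurePreserving {A B} Φ μ ν hμ hν := by
    let : MeasurableSpace (characterSpace ℂ A.carrier) := baire _
    have : IsBaireSigmaAlgebra (characterSpace ℂ A.carrier) := ⟨rfl⟩
    let : MeasurableSpace (characterSpace ℂ B.carrier) := baire _
    have : IsBaireSigmaAlgebra (characterSpace ℂ B.carrier) := ⟨rfl⟩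
    have := hμ.isProb
    have := hν.isProb
    have hT : Measurable (CharacterSpace.compContinuousMap Φ.toStarAlgHom) := by
      intro S hS
      obtain ⟨F, T, hT, rfl⟩ := exists_preimage_eq_of_measurableSet_baire hS
      exact measurable_sequence
        (fun n => (F n).comp (CharacterSpace.compContinuousMap Φ.toStarAlgHom)) hT
    refine ⟨hT, ?_⟩
    have := Measure.isProbabilityMeasure_map (μ := ν) hT.aemeasurable
    refine measure_ext_of_integral _ _ fun f => ?_
    rw [integral_map hT.aemeasurable
      (measurable_of_continuous_complex f).aestronglyMeasurable]
    obtain ⟨a, rfl⟩ := exists_gelfandStarTransform_eq f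
    refine (hν.integral_eq (Φ.toStarAlgHom a)).trans ?_
    rw [Φ.state_map]
    exact (hμ.integral_eq a).symm

/-! ### The duality between compact Hausdorff probability spaces and tracial `C⋆`-algebras -/

theorem CHProb.measurable_continuousMap' {X Y : CHProb.{u}} (T : C(X.carrier, Y.carrier)) :
    Measurable T := by
  intro S hS
  obtain ⟨F, U, hU, rfl⟩ := exists_preimage_eq_of_measurableSet_baire (Y.baire.eq_baire ▸ hS)
  exact measurable_sequence (fun n => (F n).comp T) hU

theorem CHProb.measurePreserving_of_integral {X Y : CHProb.{u}} (T : C(X.carrier, Y.carrier))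
    (h : ∀ f : C(Y.carrier, ℂ), ∫ x, f (T x) ∂X.μ = ∫ y, f y ∂Y.μ) :
    MeasurePreserving T X.μ Y.μ := by
  have hT := CHProb.measurable_continuousMap' T
  refine ⟨hT, ?_⟩
  have := Measure.isProbabilityMeasure_map (μ := X.μ) hT.aemeasurable
  refine measure_ext_of_integral _ _ fun f => ?_
  rw [integral_map hT.aemeasurable (measurable_of_continuous_complex f).aestronglyMeasurable]
  exact h f

/-- A measure-preserving homeomorphism is an isomorphism of compact Hausdorff probability
spaces. -/
def CHProb.isoOfHomeomorph {X Y : CHProb.{u}} (T : X.carrier ≃ₜ Y.carrier)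
    (h : ∀ f : C(Y.carrier, ℂ), ∫ x, f (T x) ∂X.μ = ∫ y, f y ∂Y.μ) : X ≅ Y where
  hom := CHProb.Hom.mk (T : C(X.carrier, Y.carrier)) (CHProb.measurePreserving_of_integral _ h)
  inv := CHProb.Hom.mk (T.symm : C(Y.carrier, X.carrier))
    (CHProb.measurePreserving_of_integral _ fun f => by
      refine (h (f.comp (T.symm : C(Y.carrier, X.carrier)))).symm.trans ?_
      refine integral_congr_ae (ae_of_all _ fun x => ?_)
      exact congrArg f (T.symm_apply_apply x))
  hom_inv_id := CHProb.Hom.ext (ContinuousMap.ext T.symm_apply_apply)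
  inv_hom_id := CHProb.Hom.ext (ContinuousMap.ext T.apply_symm_apply)

theorem RieszWellDefined.integral_eq (w : RieszWellDefined.{u}) (A : CStarTau.{u}ᵒᵖ)
    (a : A.unop.carrier) :
    (∫ φ : (w.functor.obj A).carrier, gelfandStarTransform A.unop.carrier a φ
      ∂(w.functor.obj A).μ) = A.unop.state a :=
  (w.existsUnique A.unop).choose_spec.1.integral_eq a

/-- A compact Hausdorff probability space is the spectrum of its algebra of continuous functions. -/
def cfuncRieszIso (w : RieszWellDefined.{u}) : CHProb.cfunc.{u} ⋙ w.functor ≅ 𝟭 CHProb.{u} :=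
  (NatIso.ofComponents (fun X => CHProb.isoOfHomeomorph (CharacterSpace.homeoEval X.carrier ℂ)
    (fun f => by
      obtain ⟨g, rfl⟩ := exists_gelfandStarTransform_eq f
      exact (w.integral_eq (CHProb.cfunc.obj X) g).symm))
    (fun _ => CHProb.Hom.ext (ContinuousMap.ext fun _ => rfl))).symm

/-- A tracial `C⋆`-algebra is the algebra of continuous functions on its spectrum. -/
def rieszCfuncIso (w : RieszWellDefined.{u}) :
    w.functor ⋙ CHProb.cfunc.{u} ≅ 𝟭 CStarTau.{u}ᵒᵖ :=
  NatIso.ofComponents (fun A => (CStarTau.isoOfBijective (A := A.unop)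
    (B := (CHProb.cfunc.obj (w.functor.obj A)).unop)
    (CStarTau.Hom.mk (gelfandStarTransform A.unop.carrier :
      A.unop.carrier →⋆ₐ[ℂ] C(characterSpace ℂ A.unop.carrier, ℂ)) (fun a => w.integral_eq A a))
    (gelfandStarTransform A.unop.carrier).bijective).op)
    (fun _ => Quiver.Hom.unop_inj (CStarTau.Hom.ext (StarAlgHom.ext fun _ => rfl)))

end CanonicalModel
end

noncomputable section
namespace CanonicalModel

open WeakDual Filter Topology

/-! ### The commutative ring `L^∞` of a concrete probability space -/

namespace BddMeas

variable {X : ConcProb.{u}}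

instance : Zero (BddMeas X) := ⟨⟨0, measurable_const, 0, fun x => by simp⟩⟩

instance : One (BddMeas X) := ⟨⟨1, measurable_const, 1, fun x => by simp⟩⟩

instance : Add (BddMeas X) := ⟨fun f g => ⟨f.1 + g.1, f.2.1.add g.2.1, by
  obtain ⟨M, hM⟩ := f.2.2
  obtain ⟨N, hN⟩ := g.2.2
  exact ⟨M + N, fun x => (norm_add_le _ _).trans (add_le_add (hM x) (hN x))⟩⟩⟩

instance : Mul (BddMeas X) := ⟨fun f g => ⟨f.1 * g.1, f.2.1.mul g.2.1, by
  obtain ⟨M, hM⟩ := f.2.2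
  obtain ⟨N, hN⟩ := g.2.2
  exact ⟨M * N, fun x => (norm_mul_le _ _).trans
    (mul_le_mul (hM x) (hN x) (norm_nonneg _) ((norm_nonneg _).trans (hM x)))⟩⟩⟩

instance : Neg (BddMeas X) := ⟨fun f => ⟨-f.1, f.2.1.neg, by
  obtain ⟨M, hM⟩ := f.2.2
  exact ⟨M, fun x => (norm_neg _).trans_le (hM x)⟩⟩⟩

instance : SMul ℂ (BddMeas X) := ⟨fun c f => ⟨c • f.1, f.2.1.const_smul c, by
  obtain ⟨M, hM⟩ := f.2.2
  exact ⟨‖c‖ * M, fun x => (norm_smul_le c (f.1 x)).trans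
    (mul_le_mul_of_nonneg_left (hM x) (norm_nonneg _))⟩⟩⟩

instance : Star (BddMeas X) := ⟨fun f =>
  ⟨star f.1, Complex.continuous_conj.measurable.comp f.2.1, by
  obtain ⟨M, hM⟩ := f.2.2
  exact ⟨M, fun x => (norm_star _).trans_le (hM x)⟩⟩⟩

theorem memLp (f : BddMeas X) (p : ENNReal) : MemLp f.1 p X.μ := by
  obtain ⟨M, hM⟩ := f.2.2
  exact MemLp.of_bound f.2.1.aestronglyMeasurable M (ae_of_all _ hM)

end BddMeas

namespace ConcLinfty

variable {X : ConcProb.{u}}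

theorem mk_eq {f g : BddMeas X} : (mk f : ConcLinfty X) = mk g ↔ f.1 =ᵐ[X.μ] g.1 :=
  Quotient.eq (r := aeSetoid X)

theorem mk_surjective : Function.Surjective (mk : BddMeas X → ConcLinfty X) :=
  Quotient.mk_surjective

instance : Zero (ConcLinfty X) := ⟨mk 0⟩

instance : One (ConcLinfty X) := ⟨mk 1⟩

instance : Add (ConcLinfty X) :=
  ⟨Quotient.map₂ (· + ·) fun _ _ h _ _ h' => EventuallyEq.add h h'⟩

instance : Mul (ConcLinfty X) :=
  ⟨Quotient.map₂ (· * ·) fun _ _ h _ _ h' => EventuallyEq.mul h h'⟩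

instance : Neg (ConcLinfty X) := ⟨Quotient.map (- ·) fun _ _ h => EventuallyEq.neg h⟩

instance : SMul ℂ (ConcLinfty X) :=
  ⟨fun c => Quotient.map (c • ·) fun _ _ h => EventuallyEq.const_smul h c⟩

instance : Star (ConcLinfty X) :=
  ⟨Quotient.map star fun _ _ h => EventuallyEq.fun_comp h (starRingEnd ℂ)⟩

instance : CommRing (ConcLinfty X) where
  add_assoc a b c := Quotient.inductionOn₃ a b c fun _ _ _ =>
    congrArg mk (Subtype.ext (add_assoc _ _ _))
  zero_add a := Quotient.inductionOn a fun _ => congrArg mk (Subtype.ext (zero_add _))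
  add_zero a := Quotient.inductionOn a fun _ => congrArg mk (Subtype.ext (add_zero _))
  add_comm a b := Quotient.inductionOn₂ a b fun _ _ => congrArg mk (Subtype.ext (add_comm _ _))
  neg_add_cancel a := Quotient.inductionOn a fun _ =>
    congrArg mk (Subtype.ext (neg_add_cancel _))
  left_distrib a b c := Quotient.inductionOn₃ a b c fun _ _ _ =>
    congrArg mk (Subtype.ext (mul_add _ _ _))
  right_distrib a b c := Quotient.inductionOn₃ a b c fun _ _ _ =>
    congrArg mk (Subtype.ext (add_mul _ _ _))
  zero_mul a := Quotient.inductionOn a fun _ => congrArg mk (Subtype.ext (zero_mul _))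
  mul_zero a := Quotient.inductionOn a fun _ => congrArg mk (Subtype.ext (mul_zero _))
  mul_assoc a b c := Quotient.inductionOn₃ a b c fun _ _ _ =>
    congrArg mk (Subtype.ext (mul_assoc _ _ _))
  one_mul a := Quotient.inductionOn a fun _ => congrArg mk (Subtype.ext (one_mul _))
  mul_one a := Quotient.inductionOn a fun _ => congrArg mk (Subtype.ext (mul_one _))
  mul_comm a b := Quotient.inductionOn₂ a b fun _ _ => congrArg mk (Subtype.ext (mul_comm _ _))
  nsmul := nsmulRec
  zsmul := zsmulRec

instance : Module ℂ (ConcLinfty X) where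
  one_smul a := Quotient.inductionOn a fun _ => congrArg mk (Subtype.ext (one_smul _ _))
  mul_smul _ _ a := Quotient.inductionOn a fun _ => congrArg mk (Subtype.ext (mul_smul _ _ _))
  smul_zero _ := congrArg mk (Subtype.ext (smul_zero _))
  smul_add _ a b := Quotient.inductionOn₂ a b fun _ _ =>
    congrArg mk (Subtype.ext (smul_add _ _ _))
  add_smul _ _ a := Quotient.inductionOn a fun _ => congrArg mk (Subtype.ext (add_smul _ _ _))
  zero_smul a := Quotient.inductionOn a fun _ => congrArg mk (Subtype.ext (zero_smul _ _))

instance : Algebra ℂ (ConcLinfty X) := Algebra.ofModule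
  (fun _ a b => Quotient.inductionOn₂ a b fun _ _ =>
    congrArg mk (Subtype.ext (smul_mul_assoc _ _ _)))
  (fun _ a b => Quotient.inductionOn₂ a b fun _ _ =>
    congrArg mk (Subtype.ext (mul_smul_comm _ _ _)))

instance : StarRing (ConcLinfty X) where
  star_involutive a := Quotient.inductionOn a fun _ => congrArg mk (Subtype.ext (star_star _))
  star_mul a b := Quotient.inductionOn₂ a b fun _ _ => congrArg mk (Subtype.ext (star_mul _ _))
  star_add a b := Quotient.inductionOn₂ a b fun _ _ => congrArg mk (Subtype.ext (star_add _ _))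

instance : StarModule ℂ (ConcLinfty X) where
  star_smul _ a := Quotient.inductionOn a fun _ => congrArg mk (Subtype.ext (star_smul _ _))

/-! ### The essential supremum norm -/

/-- The class in Mathlib's `L^∞` space. -/
def toLp : ConcLinfty X →+ Lp ℂ ⊤ X.μ where
  toFun := Quotient.lift (fun f => (f.memLp ⊤).toLp f.1) fun f g h =>
    MemLp.toLp_congr (f.memLp ⊤) (g.memLp ⊤) h
  map_zero' := rfl
  map_add' a b := Quotient.inductionOn₂ a b fun _ _ => rfl

theorem toLp_mk (f : BddMeas X) : toLp (mk f) = (f.memLp ⊤).toLp f.1 := rfl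

theorem toLp_injective : Function.Injective (toLp : ConcLinfty X → Lp ℂ ⊤ X.μ) := by
  intro a b h
  obtain ⟨f, rfl⟩ := mk_surjective a
  obtain ⟨g, rfl⟩ := mk_surjective b
  exact mk_eq.2 ((MemLp.toLp_eq_toLp_iff (f.memLp ⊤) (g.memLp ⊤)).1 h)

theorem norm_Lp_top_le_iff {f : X.carrier → ℂ} (hf : MemLp f ⊤ X.μ) {M : ℝ} (hM : 0 ≤ M) :
    ‖hf.toLp f‖ ≤ M ↔ ∀ᵐ x ∂X.μ, ‖f x‖ ≤ M := by
  rw [Lp.norm_toLp, eLpNorm_exponent_top]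
  constructor
  · intro h
    filter_upwards [ae_le_eLpNormEssSup (f := f) (μ := X.μ)] with x hx
    refine le_trans ?_ h
    rw [← toReal_enorm]
    exact ENNReal.toReal_mono (by simpa using hf.2.ne) hx
  · intro h
    exact ENNReal.toReal_le_of_le_ofReal hM (eLpNormEssSup_le_of_ae_bound h)

/-- Almost everywhere bounded measurable functions have classes. -/
theorem exists_mk_ae_eq {g : X.carrier → ℂ} (hg : AEStronglyMeasurable g X.μ) {M : ℝ}
    (h : ∀ᵐ x ∂X.μ, ‖g x‖ ≤ M) : ∃ f : BddMeas X, f.1 =ᵐ[X.μ] g := by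
  let g' := hg.mk g
  have hg' : Measurable g' := hg.stronglyMeasurable_mk.measurable
  let S : Set X.carrier := {x | ‖g' x‖ ≤ M}
  have hS : MeasurableSet S := measurableSet_le hg'.norm measurable_const
  refine ⟨⟨S.indicator g', hg'.indicator hS, |M|, fun x => ?_⟩, ?_⟩
  · by_cases hx : x ∈ S
    · rw [Set.indicator_of_mem hx]
      exact (show ‖g' x‖ ≤ M from hx).trans (le_abs_self M)
    · rw [Set.indicator_of_notMem hx, norm_zero]
      exact abs_nonneg M
  · filter_upwards [h, hg.ae_eq_mk] with x h1 h2
    have hx : x ∈ S := by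
      change ‖hg.mk g x‖ ≤ M
      rwa [← h2]
    change S.indicator g' x = _
    rw [Set.indicator_of_mem hx, h2]

/-- Completeness of `ConcLinfty X` is inherited through this. A class in `Lp` is bounded only almost
everywhere, so a representative has to be cut off on a null set. -/
theorem toLp_surjective : Function.Surjective (toLp : ConcLinfty X → Lp ℂ ⊤ X.μ) := by
  intro g
  have h : ∀ᵐ x ∂X.μ, ‖g x‖ ≤ ‖g‖ := by
    have := (norm_Lp_top_le_iff (Lp.memLp g) (norm_nonneg g)).1
    rw [Lp.toLp_coeFn] at this
    exact this le_rfl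
  obtain ⟨f, hf⟩ := exists_mk_ae_eq (Lp.aestronglyMeasurable g) h
  refine ⟨mk f, ?_⟩
  rw [toLp_mk]
  exact Lp.ext ((MemLp.coeFn_toLp _).trans hf)

instance : NormedAddCommGroup (ConcLinfty X) :=
  NormedAddCommGroup.induced _ _ toLp toLp_injective

theorem norm_mk_le_iff {f : BddMeas X} {M : ℝ} (hM : 0 ≤ M) :
    ‖mk f‖ ≤ M ↔ ∀ᵐ x ∂X.μ, ‖f.1 x‖ ≤ M :=
  norm_Lp_top_le_iff (f.memLp ⊤) hM

theorem norm_le_ae (f : BddMeas X) : ∀ᵐ x ∂X.μ, ‖f.1 x‖ ≤ ‖mk f‖ :=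
  (norm_mk_le_iff (norm_nonneg _)).1 le_rfl

instance : CompleteSpace (ConcLinfty X) := by
  have h : Isometry (toLp : ConcLinfty X → Lp ℂ ⊤ X.μ) :=
    AddMonoidHomClass.isometry_of_norm toLp fun _ => rfl
  exact (IsometryEquiv.mk (Equiv.ofBijective _ ⟨toLp_injective, toLp_surjective⟩) h).completeSpace

instance : NormedCommRing (ConcLinfty X) where
  dist_eq := NormedAddCommGroup.dist_eq
  norm_mul_le a b := by
    obtain ⟨f, rfl⟩ := mk_surjective a
    obtain ⟨g, rfl⟩ := mk_surjective b
    change ‖mk (f * g)‖ ≤ _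
    rw [norm_mk_le_iff (by positivity)]
    filter_upwards [norm_le_ae f, norm_le_ae g] with x hx hy
    exact (norm_mul_le _ _).trans (mul_le_mul hx hy (norm_nonneg _) (norm_nonneg _))

instance : NormedAlgebra ℂ (ConcLinfty X) where
  norm_smul_le c a := by
    obtain ⟨f, rfl⟩ := mk_surjective a
    change ‖mk (c • f)‖ ≤ _
    rw [norm_mk_le_iff (by positivity)]
    filter_upwards [norm_le_ae f] with x hx
    exact (norm_smul_le c (f.1 x)).trans (mul_le_mul_of_nonneg_left hx (norm_nonneg _))

instance : CStarRing (ConcLinfty X) where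
  norm_mul_self_le a := by
    obtain ⟨f, rfl⟩ := mk_surjective a
    change _ ≤ ‖mk (star f * f)‖
    rw [← sq]
    refine (Real.le_sqrt (norm_nonneg _) (norm_nonneg _)).1 ?_
    rw [norm_mk_le_iff (Real.sqrt_nonneg _)]
    filter_upwards [norm_le_ae (star f * f)] with x hx
    refine Real.le_sqrt_of_sq_le (le_trans (le_of_eq ?_) hx)
    change _ = ‖starRingEnd ℂ (f.1 x) * f.1 x‖
    rw [norm_mul, RCLike.norm_conj, sq]

instance : CommCStarAlgebra (ConcLinfty X) where

theorem norm_mk (f : BddMeas X) :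
    ‖mk f‖ = sInf {M : ℝ | 0 ≤ M ∧ ∀ᵐ x ∂X.μ, ‖f.1 x‖ ≤ M} := by
  have h : {M : ℝ | 0 ≤ M ∧ ∀ᵐ x ∂X.μ, ‖f.1 x‖ ≤ M} = Set.Ici ‖mk f‖ := by
    ext M
    constructor
    · rintro ⟨h1, h2⟩
      exact (norm_mk_le_iff h1).2 h2
    · intro h
      have h0 : 0 ≤ M := (norm_nonneg _).trans h
      exact ⟨h0, (norm_mk_le_iff h0).1 h⟩
  rw [h, csInf_Ici]

/-! ### The trace and the predual -/

/-- Integration. -/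
def integral : ConcLinfty X →ₗ[ℂ] ℂ where
  toFun := Quotient.lift (fun f => ∫ x, f.1 x ∂X.μ) fun _ _ h => integral_congr_ae h
  map_add' a b := Quotient.inductionOn₂ a b fun f g =>
    integral_add (memLp_one_iff_integrable.1 (f.memLp 1)) (memLp_one_iff_integrable.1 (g.memLp 1))
  map_smul' c a := Quotient.inductionOn a fun f => integral_const_mul c f.1

theorem integral_mk (f : BddMeas X) : integral (mk f) = ∫ x, f.1 x ∂X.μ := rfl

theorem integral_mul_star (f : BddMeas X) :
    integral (mk f * star (mk f)) = ((∫ x, ‖f.1 x‖ ^ 2 ∂X.μ : ℝ) : ℂ) := by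
  change ∫ x, f.1 x * starRingEnd ℂ (f.1 x) ∂X.μ = _
  rw [← integral_complex_ofReal]
  refine integral_congr_ae (ae_of_all _ fun x => ?_)
  change f.1 x * starRingEnd ℂ (f.1 x) = _
  rw [Complex.mul_conj, Complex.normSq_eq_norm_sq]

theorem integrable_mul (f : BddMeas X) (h : Lp ℂ 1 X.μ) :
    Integrable (fun x => starRingEnd ℂ (f.1 x) * h x) X.μ := by
  obtain ⟨M, hM⟩ := f.2.2
  exact (L1.integrable_coeFn h).bdd_mul
    (Complex.continuous_conj.measurable.comp f.2.1).aestronglyMeasurable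
    (ae_of_all _ fun x => (RCLike.norm_conj _).trans_le (hM x))

/-- The conjugate-linear pairing of `L^∞` with `L^1`. -/
def pairing (f : BddMeas X) : StrongDual ℂ (Lp ℂ 1 X.μ) :=
  -- The conjugate on `f` makes the pairing conjugate-linear in `f`, as the conjugate-linear
  -- isometry with the dual of the predual demands.
  LinearMap.mkContinuous
    { toFun := fun h => ∫ x, starRingEnd ℂ (f.1 x) * h x ∂X.μ
      map_add' := fun h k => by
        rw [← integral_add (integrable_mul f h) (integrable_mul f k)]
        refine integral_congr_ae ?_
        filter_upwards [Lp.coeFn_add h k] with x hx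
        rw [hx, Pi.add_apply, mul_add]
      map_smul' := fun c h => by
        rw [RingHom.id_apply, smul_eq_mul, ← integral_const_mul]
        refine integral_congr_ae ?_
        filter_upwards [Lp.coeFn_smul c h] with x hx
        rw [hx, Pi.smul_apply, smul_eq_mul, mul_left_comm] }
    ‖mk f‖ (fun h => by
      change ‖∫ x, starRingEnd ℂ (f.1 x) * h x ∂X.μ‖ ≤ _
      rw [L1.norm_eq_integral_norm, ← integral_const_mul]
      refine norm_integral_le_of_norm_le ((L1.integrable_coeFn h).norm.const_mul _) ?_
      filter_upwards [norm_le_ae f] with x hx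
      rw [norm_mul, RCLike.norm_conj]
      exact mul_le_mul_of_nonneg_right hx (norm_nonneg _))

theorem pairing_apply (f : BddMeas X) (h : Lp ℂ 1 X.μ) :
    pairing f h = ∫ x, starRingEnd ℂ (f.1 x) * h x ∂X.μ := rfl

theorem norm_pairing_le (f : BddMeas X) : ‖pairing f‖ ≤ ‖mk f‖ :=
  LinearMap.mkContinuous_norm_le _ (norm_nonneg _) _

theorem pairing_congr {f g : BddMeas X} (h : f.1 =ᵐ[X.μ] g.1) : pairing f = pairing g := by
  ext k
  refine integral_congr_ae ?_
  filter_upwards [h] with x hx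
  rw [hx]

/-- The inclusion of `L^2` into `L^1`. -/
def inclL2L1 (X : ConcProb.{u}) : Lp ℂ 2 X.μ →L[ℂ] Lp ℂ 1 X.μ :=
  LinearMap.mkContinuous
    { toFun := fun h => ((Lp.memLp h).mono_exponent one_le_two).toLp h
      map_add' := fun h k => Lp.ext (by
        refine (MemLp.coeFn_toLp _).trans ((Lp.coeFn_add h k).trans ?_)
        refine EventuallyEq.trans ?_ (Lp.coeFn_add _ _).symm
        exact (MemLp.coeFn_toLp _).symm.add (MemLp.coeFn_toLp _).symm)
      map_smul' := fun c h => Lp.ext (by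
        refine (MemLp.coeFn_toLp _).trans ((Lp.coeFn_smul c h).trans ?_)
        refine EventuallyEq.trans ?_ (Lp.coeFn_smul _ _).symm
        exact (MemLp.coeFn_toLp _).symm.const_smul c) } 1 (fun h => by
      change ‖((Lp.memLp h).mono_exponent one_le_two).toLp h‖ ≤ _
      rw [one_mul, Lp.norm_toLp, Lp.norm_def]
      exact ENNReal.toReal_mono (Lp.eLpNorm_ne_top h)
        (eLpNorm_le_eLpNorm_of_exponent_le one_le_two (Lp.aestronglyMeasurable h)))

theorem coeFn_inclL2L1 (h : Lp ℂ 2 X.μ) : inclL2L1 X h =ᵐ[X.μ] h :=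
  MemLp.coeFn_toLp ((Lp.memLp h).mono_exponent one_le_two)

/-- Every bounded functional on `L^1` is given by a bounded measurable function. -/
theorem exists_pairing_eq (Λ : StrongDual ℂ (Lp ℂ 1 X.μ)) :
    ∃ f : BddMeas X, ‖mk f‖ ≤ ‖Λ‖ ∧ pairing f = Λ := by
  -- On a probability space `L²` maps into `L¹`, so the Riesz representation theorem in the Hilbert
  -- space `L²` supplies the density of `Λ`.
  let g : Lp ℂ 2 X.μ := (InnerProductSpace.toDual ℂ (Lp ℂ 2 X.μ)).symm (Λ.comp (inclL2L1 X))
  have hg : ∀ h : Lp ℂ 2 X.μ, ∫ x, starRingEnd ℂ (g x) * h x ∂X.μ = Λ (inclL2L1 X h) := by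
    intro h
    have : inner ℂ g h = Λ (inclL2L1 X h) :=
      InnerProductSpace.toDual_symm_apply (y := Λ.comp (inclL2L1 X))
    rw [← this, L2.inner_def]
    refine integral_congr_ae (ae_of_all _ fun x => ?_)
    change starRingEnd ℂ (g x) * h x = inner ℂ (g x) (h x)
    rw [RCLike.inner_apply, mul_comm]
  have hgm : Measurable g := (Lp.stronglyMeasurable g).measurable
  have hgi : Integrable g X.μ := (Lp.memLp g).integrable one_le_two
  -- Testing `Λ` on the phase `g / |g|` restricted to `S` gives `∫_S |g| ≤ ‖Λ‖ μ(S)` for every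
  -- measurable `S`. Where `g` vanishes the quotient is `0` by convention, which does no harm.
  have hbound : ∀ᵐ x ∂X.μ, ‖g x‖ ≤ ‖Λ‖ := by
    refine ae_le_of_forall_setIntegral_le hgi.norm (integrable_const _) fun S hS _ => ?_
    have hm : Measurable (S.indicator fun x => g x / (‖g x‖ : ℂ)) :=
      (hgm.div (Complex.measurable_ofReal.comp hgm.norm)).indicator hS
    have hb : ∀ x, ‖S.indicator (fun x => g x / (‖g x‖ : ℂ)) x‖ ≤ S.indicator 1 x := by
      intro x
      by_cases hx : x ∈ S
      · rw [Set.indicator_of_mem hx, Set.indicator_of_mem hx, norm_div, Complex.norm_real,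
          norm_norm, Pi.one_apply]
        exact div_self_le_one _
      · rw [Set.indicator_of_notMem hx, Set.indicator_of_notMem hx, norm_zero]
    have hM : MemLp (S.indicator fun x => g x / (‖g x‖ : ℂ)) 2 X.μ :=
      MemLp.of_bound hm.aestronglyMeasurable 1 (ae_of_all _ fun x =>
        (hb x).trans (Set.indicator_le_self' (fun _ _ => zero_le_one) x))
    have h1 := hg (hM.toLp _)
    have h2 : ∫ x, starRingEnd ℂ (g x) * (hM.toLp _ : Lp ℂ 2 X.μ) x ∂X.μ =
        ((∫ x in S, ‖g x‖ ∂X.μ : ℝ) : ℂ) := by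
      rw [← integral_complex_ofReal, ← integral_indicator hS]
      refine integral_congr_ae ?_
      filter_upwards [hM.coeFn_toLp] with x hx
      rw [hx]
      by_cases hxS : x ∈ S
      · rw [Set.indicator_of_mem hxS, Set.indicator_of_mem hxS, ← mul_div_assoc,
          Complex.conj_mul', sq, mul_self_div_self]
      · rw [Set.indicator_of_notMem hxS, Set.indicator_of_notMem hxS, mul_zero]
    have h3 : ‖inclL2L1 X (hM.toLp _)‖ ≤ ∫ x in S, (1 : ℝ) ∂X.μ := by
      rw [L1.norm_eq_integral_norm, ← integral_indicator hS]
      refine integral_mono_ae (L1.integrable_coeFn _).norm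
        ((integrable_const _).indicator hS) ?_
      filter_upwards [coeFn_inclL2L1 (hM.toLp _), hM.coeFn_toLp] with x hx hx'
      rw [hx, hx']
      exact hb x
    have h4 : ∫ x in S, ‖g x‖ ∂X.μ ≤ ‖Λ (inclL2L1 X (hM.toLp _))‖ := by
      rw [← h1, h2, Complex.norm_real]
      exact le_abs_self _
    refine h4.trans ((Λ.le_opNorm _).trans ?_)
    refine (mul_le_mul_of_nonneg_left h3 (norm_nonneg _)).trans (le_of_eq ?_)
    rw [← integral_const_mul, mul_one]
  obtain ⟨f, hf⟩ := exists_mk_ae_eq (Lp.aestronglyMeasurable g) hbound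
  refine ⟨f, ?_, ?_⟩
  · rw [norm_mk_le_iff (norm_nonneg _)]
    filter_upwards [hf, hbound] with x hx hx'
    rwa [hx]
  · have hind : ∀ h : Lp ℂ 2 X.μ, pairing f (inclL2L1 X h) = Λ (inclL2L1 X h) := by
      intro h
      rw [← hg, pairing_apply]
      refine integral_congr_ae ?_
      filter_upwards [hf, coeFn_inclL2L1 h] with x hx hx'
      rw [hx, hx']
    refine ContinuousLinearMap.ext fun h => ?_
    -- Agreement is known on the image of `L²`, which contains the indicators of sets; their
    -- combinations are dense in `L¹`.
    refine Lp.induction ENNReal.one_ne_top (fun h => pairing f h = Λ h) ?_ ?_ ?_ h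
    · intro c S hS hμ
      convert hind (indicatorConstLp 2 hS hμ.ne c) using 2 <;>
      · refine Lp.ext ?_
        rw [Lp.simpleFunc.coe_indicatorConst]
        exact indicatorConstLp_coeFn.trans
          ((coeFn_inclL2L1 _).trans indicatorConstLp_coeFn).symm
    · intro h k hh hk _ h1 h2
      rw [map_add, map_add, h1, h2]
    · exact isClosed_eq (pairing f).continuous Λ.continuous

/-- Pairing with indicators recovers all integrals over measurable sets, and these determine an
integrable function. -/
theorem ae_eq_of_pairing_eq {f g : BddMeas X} (h : pairing f = pairing g) :
    f.1 =ᵐ[X.μ] g.1 := by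
  have hfi : ∀ k : BddMeas X, Integrable (fun x => starRingEnd ℂ (k.1 x)) X.μ := fun k =>
    memLp_one_iff_integrable.1 ((star k).memLp 1)
  have : (fun x => starRingEnd ℂ (f.1 x)) =ᵐ[X.μ] fun x => starRingEnd ℂ (g.1 x) := by
    refine Integrable.ae_eq_of_forall_setIntegral_eq _ _ (hfi f) (hfi g) fun S hS hμ => ?_
    have key : ∀ k : BddMeas X, ∫ x in S, starRingEnd ℂ (k.1 x) ∂X.μ =
        pairing k (indicatorConstLp 1 hS hμ.ne 1) := by
      intro k
      rw [pairing_apply, ← integral_indicator hS]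
      refine integral_congr_ae ?_
      filter_upwards [indicatorConstLp_coeFn (p := 1) (hs := hS) (hμs := hμ.ne) (c := (1 : ℂ))]
        with x hx
      rw [hx]
      by_cases hxS : x ∈ S
      · rw [Set.indicator_of_mem hxS, Set.indicator_of_mem hxS, mul_one]
      · rw [Set.indicator_of_notMem hxS, Set.indicator_of_notMem hxS, mul_zero]
    rw [key, key, h]
  filter_upwards [this] with x hx
  exact (starRingEnd ℂ).injective hx

/-- No near-extremal test function is needed: `exists_pairing_eq` represents the functional by some
`g` of norm at most that of the functional, and injectivity identifies `g` with `f`. -/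
theorem norm_pairing (f : BddMeas X) : ‖pairing f‖ = ‖mk f‖ := by
  refine le_antisymm (norm_pairing_le f) ?_
  obtain ⟨g, h1, h2⟩ := exists_pairing_eq (pairing f)
  rwa [mk_eq.2 (ae_eq_of_pairing_eq h2)] at h1

/-- `L^∞` is the dual of `L^1`. -/
def toDual (X : ConcProb.{u}) : ConcLinfty X ≃ₗᵢ⋆[ℂ] StrongDual ℂ (Lp ℂ 1 X.μ) :=
  LinearIsometryEquiv.ofSurjective
    { toFun := Quotient.lift pairing fun _ _ h => pairing_congr h
      map_add' := fun a b => Quotient.inductionOn₂ a b fun f g =>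
        ContinuousLinearMap.ext fun h => by
        change ∫ x, starRingEnd ℂ (f.1 x + g.1 x) * h x ∂X.μ = _
        simp only [map_add, add_mul]
        exact integral_add (integrable_mul f h) (integrable_mul g h)
      map_smul' := fun c a => Quotient.inductionOn a fun f => ContinuousLinearMap.ext fun h => by
        change ∫ x, starRingEnd ℂ (c * f.1 x) * h x ∂X.μ = _
        simp only [map_mul, mul_assoc]
        exact integral_const_mul _ _
      norm_map' := fun a => Quotient.inductionOn a norm_pairing }
    (fun Λ => by
      obtain ⟨f, _, hf⟩ := exists_pairing_eq Λ
      exact ⟨mk f, hf⟩)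

theorem toDual_mk (f : BddMeas X) : toDual X (mk f) = pairing f := rfl

/-- Pairing with the constant `1` gives the conjugate of the integral; the real parts agree, and
normality of a functional refers to nothing else. -/
theorem integral_re_eq_toDual (a : ConcLinfty X) :
    (integral a).re = (toDual X a (Lp.const 1 X.μ 1)).re := by
  obtain ⟨f, rfl⟩ := mk_surjective a
  have : toDual X (mk f) (Lp.const 1 X.μ 1) = starRingEnd ℂ (∫ x, f.1 x ∂X.μ) := by
    rw [toDual_mk, pairing_apply, ← integral_conj]
    refine integral_congr_ae ?_
    filter_upwards [Lp.coeFn_const (p := 1) (μ := X.μ) (1 : ℂ)] with x hx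
    rw [hx, Function.const_apply, mul_one]
  rw [this, Complex.conj_re, integral_mk]

open scoped ComplexOrder in
theorem integral_mul_star_nonneg (a : ConcLinfty X) : 0 ≤ integral (a * star a) := by
  obtain ⟨f, rfl⟩ := mk_surjective a
  rw [integral_mul_star]
  exact Complex.zero_le_real.2 (integral_nonneg fun x => by positivity)

instance tracial : TracialVonNeumann (ConcLinfty X) where
  wstar := ⟨Lp ℂ 1 X.μ, inferInstance, inferInstance, inferInstance, ⟨(toDual X).symm⟩⟩
  trace := integral
  trace_star a := Quotient.inductionOn a fun f => integral_conj
  trace_one := by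
    change ∫ x, (1 : ℂ) ∂X.μ = 1
    simp
  trace_nonneg := integral_mul_star_nonneg
  trace_faithful a := by
    constructor
    · intro h
      obtain ⟨f, rfl⟩ := mk_surjective a
      rw [integral_mul_star, Complex.ofReal_eq_zero,
        integral_eq_zero_iff_of_nonneg (fun x => by positivity)] at h
      · refine mk_eq.2 ?_
        filter_upwards [h] with x hx
        exact norm_eq_zero.1 (pow_eq_zero_iff two_ne_zero |>.1 hx)
      · exact ((f.memLp 2).integrable_norm_pow two_ne_zero)
    · rintro rfl
      rw [zero_mul, map_zero]
  trace_normal := by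
    -- Integration is given, up to conjugation, by the element `1` of the predual `L¹`, hence is
    -- normal.
    refine isNormalFunctional_of_predual (toDual X).symm _ (Lp.const 1 X.μ 1)
      integral_re_eq_toDual fun a b h => ?_
    let _ := CStarAlgebra.spectralOrder (ConcLinfty X)
    have := CStarAlgebra.spectralOrderedRing (ConcLinfty X)
    obtain ⟨c, hc⟩ := CStarAlgebra.nonneg_iff_eq_star_mul_self.1 (sub_nonneg.2 h)
    have h1 := (Complex.le_def.1 (integral_mul_star_nonneg c)).1
    rw [mul_comm, ← hc, map_sub, Complex.sub_re, Complex.zero_re] at h1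
    linarith

/-- The tracial von Neumann algebra of bounded measurable functions. -/
def str (X : ConcProb.{u}) : ConcLinftyStr X where
  toTracialVonNeumann := tracial
  mk_add _ _ _ e := congrArg mk (Subtype.ext (funext e))
  mk_mul _ _ _ e := congrArg mk (Subtype.ext (funext e))
  mk_smul _ _ _ e := congrArg mk (Subtype.ext (funext e))
  mk_star _ _ e := congrArg mk (Subtype.ext (funext e))
  norm_mk := norm_mk
  trace_mk _ := rfl

/-- The Koopman operator as a `⋆`-homomorphism. -/
def koopmanHom {X Y : ConcProb.{u}} (T : X ⟶ Y) : ConcLinfty Y →⋆ₐ[ℂ] ConcLinfty X where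
  toFun := koopman T
  map_one' := rfl
  map_mul' a b := Quotient.inductionOn₂ a b fun _ _ => rfl
  map_zero' := rfl
  map_add' a b := Quotient.inductionOn₂ a b fun _ _ => rfl
  commutes' c := by
    rw [Algebra.algebraMap_eq_smul_one, Algebra.algebraMap_eq_smul_one]
    rfl
  map_star' a := Quotient.inductionOn a fun _ => rfl

theorem integral_koopman {X Y : ConcProb.{u}} (T : X ⟶ Y) (a : ConcLinfty Y) :
    integral (koopman T a) = integral a := by
  obtain ⟨f, rfl⟩ := mk_surjective a
  have h := integral_map (μ := X.μ) T.measurePreserving.measurable.aemeasurable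
    (f := f.1) f.2.1.aestronglyMeasurable
  rw [T.measurePreserving.map_eq] at h
  exact h.symm

end ConcLinfty

/-- `L^∞` is a functor on concrete probability spaces. -/
def concLinftyWellDefined : ConcLinftyWellDefined.{u} where
  str := ConcLinfty.str
  koopman_isHom T := ⟨VonNeumannTau.homOfTrace
    (A := VonNeumannTau.mk (ConcLinfty _)) (B := VonNeumannTau.mk (ConcLinfty _))
    (ConcLinfty.koopmanHom T) (ConcLinfty.integral_koopman T), fun _ => rfl⟩

end CanonicalModel
end

noncomputable section
namespace CanonicalModel

open Filter Topology

/-! ### The Stone space of a probability algebra as a measure space -/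

/-- The points of the Stone space of a Boolean algebra, as prime ideals. -/
abbrev StonePoint (B : Type*) [BooleanAlgebra B] : Type _ := {I : Order.Ideal B // I.IsPrime}

namespace StonePoint

variable {B : Type*} [BooleanAlgebra B]

/-- The subset of the Stone space corresponding to an element of the Boolean algebra. -/
def basic (E : B) : Set (StonePoint B) := {I | E ∉ I.1}

theorem mem_basic {E : B} {I : StonePoint B} : I ∈ basic E ↔ E ∉ I.1 := Iff.rfl

theorem basic_bot : basic (⊥ : B) = ∅ := by
  ext I
  simp [mem_basic]

theorem basic_sup (E F : B) : basic (E ⊔ F) = basic E ∪ basic F := by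
  ext I
  rw [Set.mem_union, mem_basic, mem_basic, mem_basic, Order.Ideal.sup_mem_iff, not_and_or]

theorem basic_compl (E : B) : basic Eᶜ = (basic E)ᶜ := by
  ext I
  rw [Set.mem_compl_iff, mem_basic, mem_basic, not_not]
  refine ⟨fun h => (I.2.mem_or_compl_mem (x := E)).resolve_right h, fun h h' => ?_⟩
  refine I.2.toIsProper.ne_univ (Set.eq_univ_of_forall fun F => ?_)
  refine I.1.lower ?_ (Order.Ideal.sup_mem h h')
  rw [sup_compl_eq_top]
  exact le_top

theorem basic_top : basic (⊤ : B) = Set.univ := by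
  rw [← compl_bot, basic_compl, basic_bot, Set.compl_empty]

theorem basic_inf (E F : B) : basic (E ⊓ F) = basic E ∩ basic F := by
  rw [← compl_inj_iff, ← basic_compl, compl_inf, basic_sup, basic_compl, basic_compl,
    Set.compl_inter]

theorem basic_sdiff (E F : B) : basic (E \ F) = basic E \ basic F := by
  rw [sdiff_eq, basic_inf, basic_compl, Set.sdiff_eq]

theorem basic_mono {E F : B} (h : E ≤ F) : basic E ⊆ basic F := by
  intro I hI hF
  exact hI (I.1.lower h hF)

/-- The prime ideal theorem, separating `D` from the principal filter of `E`. Principal `D` gives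
injectivity of `basic`; the ideal generated by a sequence gives compactness. -/
theorem exists_mem_basic {D : Order.Ideal B} {E : B} (h : E ∉ D) :
    ∃ I ∈ basic E, D ≤ I.1 := by
  obtain ⟨J, h1, h2, h3⟩ := DistribLattice.prime_ideal_of_disjoint_filter_ideal
    (F := Order.PFilter.principal E) (I := D) (Set.disjoint_left.2 fun F hF hD =>
      h (D.lower (Order.PFilter.mem_principal.1 hF) hD))
  exact ⟨⟨J, h1⟩, fun hE => Set.disjoint_left.1 h3 (Order.PFilter.mem_principal.2 le_rfl) hE, h2⟩

theorem basic_injective : Function.Injective (basic : B → Set (StonePoint B)) := by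
  have key : ∀ E F : B, basic E ⊆ basic F → E ≤ F := by
    intro E F h
    by_contra hle
    obtain ⟨I, hI, hF⟩ := exists_mem_basic (D := Order.Ideal.principal F) (E := E)
      (fun h' => hle (Order.Ideal.mem_principal.1 h'))
    exact h hI (hF (Order.Ideal.mem_principal.2 le_rfl))
  exact fun E F h => le_antisymm (key E F h.subset) (key F E h.superset)

/-- Compactness of the Stone space. -/
theorem exists_le_partialSups {E : B} {F : ℕ → B} (h : basic E ⊆ ⋃ n, basic (F n)) :
    ∃ N, E ≤ partialSups F N := by
  by_contra hN
  push Not at hN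
  -- The ideal generated by all `F n`. If it omits `E`, a prime ideal above it is a point of `basic
  -- E` that no `basic (F n)` covers.
  let D : Order.Ideal B := Order.IsIdeal.toIdeal (I := {a | ∃ N, a ≤ partialSups F N})
    { IsLowerSet := fun a b hba ⟨N, hN⟩ => ⟨N, hba.trans hN⟩
      Nonempty := ⟨⊥, 0, bot_le⟩
      Directed := by
        rintro a ⟨M, hM⟩ b ⟨N, hN⟩
        exact ⟨a ⊔ b, ⟨max M N, sup_le
          (hM.trans ((partialSups F).monotone (le_max_left _ _)))
          (hN.trans ((partialSups F).monotone (le_max_right _ _)))⟩, le_sup_left, le_sup_right⟩ }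
  obtain ⟨I, hI, hD⟩ := exists_mem_basic (D := D) (E := E) (fun ⟨N, h⟩ => hN N h)
  obtain ⟨n, hn⟩ := Set.mem_iUnion.1 (h hI)
  exact hn (hD ⟨n, le_partialSups F n⟩)

instance : MeasurableSpace (StonePoint B) := MeasurableSpace.generateFrom (Set.range basic)

theorem measurableSet_basic (E : B) : MeasurableSet (basic E) :=
  MeasurableSpace.measurableSet_generateFrom ⟨E, rfl⟩

theorem isSetRing_basic : IsSetRing (Set.range (basic : B → Set (StonePoint B))) where
  empty_mem := ⟨⊥, basic_bot⟩
  union_mem := by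
    rintro _ _ ⟨E, rfl⟩ ⟨F, rfl⟩
    exact ⟨E ⊔ F, basic_sup E F⟩
  sdiff_mem := by
    rintro _ _ ⟨E, rfl⟩ ⟨F, rfl⟩
    exact ⟨E \ F, basic_sdiff E F⟩

end StonePoint

theorem IsProbMeasure.sup_le {B : Type*} [BooleanAlgebra B] {μ : B → ℝ} (h : IsProbMeasure μ)
    (a b : B) : μ (a ⊔ b) ≤ μ a + μ b := by
  have : a ⊔ b = a ⊔ b \ a := by simp
  rw [this, h.sup_of_disjoint (by simp)]
  exact add_le_add le_rfl (h.mono sdiff_le)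

theorem IsProbMeasure.partialSups_le {B : Type*} [BooleanAlgebra B] {μ : B → ℝ}
    (h : IsProbMeasure μ) (F : ℕ → B) (N : ℕ) :
    μ (partialSups F N) ≤ ∑ n ∈ Finset.range (N + 1), μ (F n) := by
  induction N with
  | zero => simp
  | succ N ih =>
    rw [partialSups_add_one, Finset.sum_range_succ]
    exact (h.sup_le _ _).trans (add_le_add ih le_rfl)

namespace ProbAlg

variable (P : ProbAlg.{u})

open StonePoint

open scoped Classical in
/-- The content on the Stone space of a probability algebra. -/
def stoneContentFun (S : Set (StonePoint P.carrier)) : ENNReal :=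
  if h : ∃ E, basic E = S then ENNReal.ofReal (P.μ h.choose) else 0

theorem stoneContentFun_basic (E : P.carrier) :
    P.stoneContentFun (basic E) = ENNReal.ofReal (P.μ E) := by
  have h : ∃ F : P.carrier, basic F = basic E := ⟨E, rfl⟩
  rw [stoneContentFun, dif_pos h, basic_injective h.choose_spec]

/-- The content on the Stone space of a probability algebra. -/
def stoneContent : AddContent ENNReal (Set.range (basic : P.carrier → Set (StonePoint _))) :=
  isSetRing_basic.addContent_of_union P.stoneContentFun
    (by
      rw [← basic_bot (B := P.carrier), stoneContentFun_basic, P.isProb.map_bot,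
        ENNReal.ofReal_zero])
    (by
      rintro _ _ ⟨E, rfl⟩ ⟨F, rfl⟩ h
      have hd : E ⊓ F = ⊥ := basic_injective (by
        rw [basic_inf, basic_bot]
        exact Set.disjoint_iff_inter_eq_empty.1 h)
      rw [← basic_sup, stoneContentFun_basic, stoneContentFun_basic, stoneContentFun_basic,
        P.isProb.sup_of_disjoint hd,
        ENNReal.ofReal_add (P.isProb.nonneg _) (P.isProb.nonneg _)])

theorem stoneContent_basic (E : P.carrier) :
    P.stoneContent (basic E) = ENNReal.ofReal (P.μ E) := P.stoneContentFun_basic E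

/-- By compactness a countable cover of a basic set by basic sets has a finite subcover, so finite
subadditivity of `P.μ` is enough. -/
theorem isSigmaSubadditive_stoneContent : P.stoneContent.IsSigmaSubadditive := by
  intro f hf hU
  choose F hF using hf
  obtain ⟨E, hE⟩ := hU
  obtain ⟨N, hN⟩ := exists_le_partialSups (E := E) (F := F) (by simp only [hF, hE]; rfl)
  rw [← hE, stoneContent_basic]
  refine le_trans ?_ (ENNReal.sum_le_tsum (Finset.range (N + 1)))
  simp only [← hF, stoneContent_basic]
  rw [← ENNReal.ofReal_sum_of_nonneg fun n _ => P.isProb.nonneg _]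
  exact ENNReal.ofReal_le_ofReal ((P.isProb.mono hN).trans (P.isProb.partialSups_le F N))

/-- The measure on the Stone space of a probability algebra. -/
def stoneMeasure : Measure (StonePoint P.carrier) :=
  P.stoneContent.measure isSetRing_basic.isSetSemiring le_rfl P.isSigmaSubadditive_stoneContent

theorem stoneMeasure_basic (E : P.carrier) :
    P.stoneMeasure (basic E) = ENNReal.ofReal (P.μ E) :=
  (P.stoneContent.measure_eq isSetRing_basic.isSetSemiring rfl
    P.isSigmaSubadditive_stoneContent ⟨E, rfl⟩).trans (P.stoneContent_basic E)

instance : IsProbabilityMeasure P.stoneMeasure where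
  measure_univ := by
    rw [← basic_top, stoneMeasure_basic, P.isProb.map_top, ENNReal.ofReal_one]

/-- The union of the basic sets may be strictly smaller than the basic set of the join. Countable
additivity of `P.μ` on the disjointed sequence shows that the difference is null. -/
theorem basic_ae_eq_iUnion {E : ℕ → P.carrier} {a : P.carrier} (h : IsLUB (Set.range E) a) :
    (⋃ n, basic (E n) : Set _) =ᵐ[P.stoneMeasure] basic a := by
  refine ae_eq_of_subset_of_measure_ge (Set.iUnion_subset fun n => basic_mono (h.1 ⟨n, rfl⟩)) ?_
    (MeasurableSet.iUnion fun n => measurableSet_basic _).nullMeasurableSet (measure_ne_top _ _)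
  have h1 : (⋃ n, basic (disjointed E n) : Set _) ⊆ ⋃ n, basic (E n) :=
    Set.iUnion_mono fun n => basic_mono (disjointed_le E n)
  refine le_trans (le_of_eq ?_) (measure_mono h1)
  have h2 := P.isProb.hasSum_disjointed h
  rw [measure_iUnion (fun m n hmn => Set.disjoint_iff_inter_eq_empty.2 (by
    rw [← basic_inf, (disjoint_disjointed E hmn).eq_bot, basic_bot]))
    fun n => measurableSet_basic _, stoneMeasure_basic, ← h2.tsum_eq,
    ENNReal.ofReal_tsum_of_nonneg (fun n => P.isProb.nonneg _) h2.summable]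
  simp only [stoneMeasure_basic]

/-- The sets almost everywhere equal to a basic set form a `σ`-algebra; `σ`-completeness of `P`
handles countable unions. -/
theorem exists_ae_eq_basic {S : Set (StonePoint P.carrier)} (hS : MeasurableSet S) :
    ∃ E, S =ᵐ[P.stoneMeasure] basic E := by
  induction hS with
  | basic S hS =>
    obtain ⟨E, rfl⟩ := hS
    exact ⟨E, EventuallyEq.rfl⟩
  | empty => exact ⟨⊥, by rw [basic_bot]; exact EventuallyEq.rfl⟩
  | compl S _ ih =>
    obtain ⟨E, hE⟩ := ih
    exact ⟨Eᶜ, by rw [basic_compl]; exact hE.compl⟩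
  | iUnion S _ ih =>
    choose E hE using ih
    obtain ⟨a, ha⟩ := IsSigmaComplete.exists_isLUB E
    exact ⟨a, (Filter.EventuallyEq.countable_iUnion hE).trans (P.basic_ae_eq_iUnion ha)⟩

/-- Strict positivity of `P.μ` on nonzero elements enters here. -/
theorem eq_of_basic_ae_eq {E F : P.carrier} (h : basic E =ᵐ[P.stoneMeasure] basic F) :
    E = F := by
  have key : ∀ E F : P.carrier, basic E =ᵐ[P.stoneMeasure] basic F → E ≤ F := by
    intro E F h
    rw [← sdiff_eq_bot_iff]
    by_contra hne
    have h1 := P.pos _ hne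
    have h2 := (ae_eq_set.1 h).1
    rw [← basic_sdiff, stoneMeasure_basic, ENNReal.ofReal_eq_zero] at h2
    exact absurd h1 (not_lt.2 h2)
  exact le_antisymm (key E F h) (key F E h.symm)

end ProbAlg

/-! ### Concrete models of probability algebras -/

/-- A concrete model of a probability algebra: a probability space whose measurable sets modulo
null sets are identified with the elements of the probability algebra. -/
structure Model (P : ProbAlg.{u}) where
  space : ConcProb.{u}
  proj : SigmaHom (MeasAlg space.carrier) P.carrier
  measure_proj : ∀ S, P.μ (proj S) = space.μ.real S.1
  surjective : Function.Surjective proj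

namespace ProbAlg

variable (P : ProbAlg.{u})

open StonePoint

/-- The element of a probability algebra represented by a measurable subset of its Stone space. -/
def stoneProj (S : MeasAlg (StonePoint P.carrier)) : P.carrier :=
  (P.exists_ae_eq_basic S.2).choose

theorem ae_eq_basic_stoneProj (S : MeasAlg (StonePoint P.carrier)) :
    S.1 =ᵐ[P.stoneMeasure] basic (P.stoneProj S) :=
  (P.exists_ae_eq_basic S.2).choose_spec

theorem stoneProj_eq {S : MeasAlg (StonePoint P.carrier)} {E : P.carrier}
    (h : S.1 =ᵐ[P.stoneMeasure] basic E) : P.stoneProj S = E :=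
  P.eq_of_basic_ae_eq ((P.ae_eq_basic_stoneProj S).symm.trans h)

/-- The Stone space as a model of a probability algebra. -/
def stoneModel : Model P where
  space := { carrier := StonePoint P.carrier, μ := P.stoneMeasure }
  proj := .ofIsLUB
    { toFun := P.stoneProj
      map_sup' := fun S T => P.stoneProj_eq (by
        rw [basic_sup]
        exact (P.ae_eq_basic_stoneProj S).union (P.ae_eq_basic_stoneProj T))
      map_inf' := fun S T => P.stoneProj_eq (by
        rw [basic_inf]
        exact (P.ae_eq_basic_stoneProj S).inter (P.ae_eq_basic_stoneProj T))
      map_top' := P.stoneProj_eq (by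
        rw [basic_top]
        exact EventuallyEq.rfl)
      map_bot' := P.stoneProj_eq (by
        rw [basic_bot]
        exact EventuallyEq.rfl) }
    (by
      intro S a h
      obtain ⟨b, hb⟩ := IsSigmaComplete.exists_isLUB fun n => P.stoneProj (S n)
      have : P.stoneProj a = b := P.stoneProj_eq (by
        rw [MeasAlg.isLUB_iff.1 h]
        exact (Filter.EventuallyEq.countable_iUnion fun n => P.ae_eq_basic_stoneProj (S n)).trans
          (P.basic_ae_eq_iUnion hb))
      change IsLUB (Set.range fun n => P.stoneProj (S n)) (P.stoneProj a)
      rwa [this])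
  measure_proj S := by
    change P.μ (P.stoneProj S) = P.stoneMeasure.real S.1
    rw [measureReal_def, measure_congr (P.ae_eq_basic_stoneProj S), stoneMeasure_basic,
      ENNReal.toReal_ofReal (P.isProb.nonneg _)]
  surjective E := ⟨⟨basic E, measurableSet_basic E⟩, P.stoneProj_eq EventuallyEq.rfl⟩

end ProbAlg

/-- A concrete probability space is a model of its own probability algebra. -/
def ConcProb.model (X : ConcProb.{u}) : Model (mes.obj (abstraction.obj X)) where
  space := X
  proj := .ofIsLUB
    { toFun := NullQuotient.mk (X := abstraction.obj X)
      map_sup' := fun _ _ => rfl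
      map_inf' := fun _ _ => rfl
      map_top' := rfl
      map_bot' := rfl }
    fun _ _ h => NullQuotient.isLUB_mk (X := abstraction.obj X) h
  measure_proj _ := rfl
  surjective := NullQuotient.mk_surjective (X := abstraction.obj X)

/-- `σ`-homomorphisms on measurable sets are determined by a generating family. -/
theorem SigmaHom.ext_of_generateFrom {α B : Type*} [m : MeasurableSpace α] [BooleanAlgebra B]
    {C : Set (Set α)} (hm : m = MeasurableSpace.generateFrom C) {f g : SigmaHom (MeasAlg α) B}
    (h : ∀ S (hS : MeasurableSet S), S ∈ C → f ⟨S, hS⟩ = g ⟨S, hS⟩) : f = g := by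
  have hC : ∀ S, MeasurableSpace.GenerateMeasurable C S ↔ MeasurableSet S := fun S => by
    rw [hm]
    exact Iff.rfl
  refine SigmaHom.ext ?_
  rintro ⟨S, hS⟩
  -- Agreement survives complements and arbitrary countable unions, disjoint or not, so the
  -- generating family need not be a `π`-system.
  induction (hC S).2 hS with
  | basic S hSC => exact h S hS hSC
  | empty => exact (BotHomClass.map_bot f).trans (BotHomClass.map_bot g).symm
  | compl S hS' ih =>
    have h1 := map_compl' f ⟨S, (hC S).1 hS'⟩
    have h2 := map_compl' g ⟨S, (hC S).1 hS'⟩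
    rw [ih] at h1
    exact h1.trans h2.symm
  | iUnion S hS' ih =>
    replace hS' := fun n => (hC _).1 (hS' n)
    replace ih := fun n => ih n (hS' n)
    have h1 := f.map_isLUB (MeasAlg.isLUB_iUnion fun n => ⟨S n, hS' n⟩)
    have h2 := g.map_isLUB (MeasAlg.isLUB_iUnion fun n => ⟨S n, hS' n⟩)
    simp only [ih] at h1
    exact h1.unique h2

namespace Model

variable {P : ProbAlg.{u}} (M : Model P)

theorem proj_eq_bot {S : MeasAlg M.space.carrier} : M.proj S = ⊥ ↔ M.space.μ S.1 = 0 := by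
  have h : M.space.μ S.1 = 0 ↔ P.μ (M.proj S) = 0 := by
    rw [M.measure_proj, measureReal_eq_zero_iff]
  rw [h]
  constructor
  · intro h
    rw [h, P.isProb.map_bot]
  · intro h
    by_contra hne
    exact (P.pos _ hne).ne' h

theorem proj_eq_iff {S T : MeasAlg M.space.carrier} :
    M.proj S = M.proj T ↔ S.1 =ᵐ[M.space.μ] T.1 := by
  rw [ae_eq_set, ← symmDiff_eq_bot, ← map_symmDiff', proj_eq_bot,
    ← measure_union_null_iff]
  rfl

theorem proj_eq_top {S : MeasAlg M.space.carrier} :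
    M.proj S = ⊤ ↔ ∀ᵐ x ∂M.space.μ, x ∈ S.1 := by
  rw [← TopHomClass.map_top M.proj, proj_eq_iff]
  exact eventuallyEq_univ

/-- The abstractly measurable function given by a bounded measurable function on a model. -/
def ofBddMeas (f : BddMeas M.space) : Linfty P :=
  ⟨M.proj.comp (pullback f.1 f.2.1), by
    obtain ⟨r, hr⟩ := f.2.2
    refine ⟨|r|, abs_nonneg r, ?_⟩
    rw [SigmaHom.comp_apply, proj_eq_top]
    exact ae_of_all _ fun x => (hr x).trans (le_abs_self r)⟩

theorem ofBddMeas_apply (f : BddMeas M.space) (S : MeasAlg ℂ) :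
    (M.ofBddMeas f).1 S = M.proj ⟨f.1 ⁻¹' S.1, f.2.1 S.2⟩ := rfl

/-- Each Borel set yields a null exceptional set. Only the countably many members of a base of `ℂ`
are used, so one null set suffices, and off it the values cannot be separated. -/
theorem ofBddMeas_eq_iff {f g : BddMeas M.space} :
    M.ofBddMeas f = M.ofBddMeas g ↔ f.1 =ᵐ[M.space.μ] g.1 := by
  constructor
  · intro h
    have h1 : ∀ U ∈ TopologicalSpace.countableBasis ℂ, ∀ᵐ x ∂M.space.μ, f.1 x ∈ U → g.1 x ∈ U := by
      intro U hU
      have hU' := (TopologicalSpace.isOpen_of_mem_countableBasis hU).measurableSet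
      have := congrArg (fun k => k.1 ⟨U, hU'⟩) h
      simp only [ofBddMeas_apply] at this
      filter_upwards [M.proj_eq_iff.1 this] with x hx hf
      exact (iff_of_eq hx).1 hf
    rw [← ae_ball_iff (TopologicalSpace.countable_countableBasis ℂ)] at h1
    filter_upwards [h1] with x hx
    by_contra hne
    obtain ⟨U, hU, hxU, hsub⟩ :=
      (TopologicalSpace.isBasis_countableBasis ℂ).exists_subset_of_mem_open
        (show f.1 x ∈ ({g.1 x}ᶜ : Set ℂ) from hne) isOpen_compl_singleton
    exact hsub (hx U hU hxU) rfl
  · intro h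
    refine Subtype.ext (SigmaHom.ext fun S => ?_)
    rw [ofBddMeas_apply, ofBddMeas_apply, proj_eq_iff]
    filter_upwards [h] with x hx
    change (f.1 x ∈ S.1) = (g.1 x ∈ S.1)
    rw [hx]

/-- Embed `α` measurably into `ℕ → Bool` by `c`. There a `σ`-homomorphism is determined by the
coordinate sets; the image of each is lifted to a measurable set `A n`, and together these sets are
the coordinates of a map `G` into `ℕ → Bool`. A measurable left inverse `l` of `c`, defined
everywhere, brings `G` back to `α`. -/
theorem exists_measurable_lift {α : Type*} [MeasurableSpace α] [StandardBorelSpace α] [Nonempty α]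
    (h : SigmaHom (MeasAlg α) P.carrier) :
    ∃ (F : M.space.carrier → α) (hF : Measurable F), M.proj.comp (pullback F hF) = h := by
  obtain ⟨c, hc, hci⟩ := MeasurableSpace.measurable_injection_nat_bool_of_countablySeparated α
  have hemb : MeasurableEmbedding c := hc.measurableEmbedding hci
  obtain ⟨l, hl, hlc⟩ := hemb.exists_measurable_extend measurable_id fun _ => inferInstance
  have hB : ∀ n, MeasurableSet ((fun z : ℕ → Bool => z n) ⁻¹' {true}) := fun n =>
    measurable_pi_apply n (measurableSet_singleton _)
  choose A hA using fun n => M.surjective (h ⟨c ⁻¹' ((fun z => z n) ⁻¹' {true}), hc (hB n)⟩)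
  classical
  let G : M.space.carrier → ℕ → Bool := fun x n => decide (x ∈ (A n).1)
  have hG : Measurable G := measurable_pi_lambda _ fun n => measurable_to_bool (by
    convert (A n).2 using 1
    ext x
    exact decide_eq_true_iff)
  have key : M.proj.comp (pullback G hG) = h.comp (pullback c hc) := by
    refine SigmaHom.ext_of_generateFrom
      (C := ⋃ n, {t | MeasurableSet[MeasurableSpace.comap (fun z : ℕ → Bool => z n) ⊤] t})
      (MeasurableSpace.generateFrom_iUnion_measurableSet _).symm fun S hS hSC => ?_
    obtain ⟨n, T, -, rfl⟩ := Set.mem_iUnion.1 hSC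
    have h1 : M.proj.comp (pullback G hG) ⟨_, hB n⟩ = h.comp (pullback c hc) ⟨_, hB n⟩ := by
      refine Eq.trans ?_ (hA n)
      change M.proj _ = _
      congr 1
      refine Subtype.ext (Set.ext fun x => ?_)
      change decide (x ∈ (A n).1) = true ↔ _
      exact decide_eq_true_iff
    have h2 : ∀ S : MeasAlg (ℕ → Bool), M.proj.comp (pullback G hG) S =
        h.comp (pullback c hc) S → M.proj.comp (pullback G hG) Sᶜ =
        h.comp (pullback c hc) Sᶜ := fun S hS => by
      rw [map_compl', map_compl', hS]
    -- A set depending on the single coordinate `n` is one of four: everything, the coordinate set,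
    -- its complement, or empty.
    by_cases ht : true ∈ T <;> by_cases hf : false ∈ T
    · have : (⟨_, hS⟩ : MeasAlg (ℕ → Bool)) = ⊤ := Subtype.ext (Set.eq_univ_of_forall fun z => by
        change z n ∈ T
        cases z n <;> assumption)
      rw [this, TopHomClass.map_top, TopHomClass.map_top]
    · have : (⟨_, hS⟩ : MeasAlg (ℕ → Bool)) = ⟨_, hB n⟩ := Subtype.ext (Set.ext fun z => by
        change z n ∈ T ↔ z n ∈ ({true} : Set Bool)
        cases z n <;> simp [ht, hf])
      rw [this, h1]
    · have : (⟨_, hS⟩ : MeasAlg (ℕ → Bool)) = (⟨_, hB n⟩ : MeasAlg (ℕ → Bool))ᶜ :=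
        Subtype.ext (Set.ext fun z => by
          change z n ∈ T ↔ z n ∉ ({true} : Set Bool)
          cases z n <;> simp [ht, hf])
      rw [this, h2 _ h1]
    · have : (⟨_, hS⟩ : MeasAlg (ℕ → Bool)) = ⊥ :=
        Subtype.ext (Set.eq_empty_of_forall_notMem fun z => by
          change z n ∉ T
          cases z n <;> assumption)
      rw [this, BotHomClass.map_bot, BotHomClass.map_bot]
  refine ⟨fun x => l (G x), hl.comp hG, SigmaHom.ext fun S => ?_⟩
  have h1 := congrArg (fun k => k ⟨l ⁻¹' S.1, hl S.2⟩) key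
  refine h1.trans (congrArg h (Subtype.ext ?_))
  change c ⁻¹' (l ⁻¹' S.1) = S.1
  rw [← Set.preimage_comp, hlc, Set.preimage_id]

/-- The lift is only essentially bounded, so it is replaced by a bounded function equal to it almost
everywhere. -/
theorem ofBddMeas_surjective : Function.Surjective M.ofBddMeas := by
  rintro ⟨h, r, hr, hd⟩
  obtain ⟨F, hF, rfl⟩ := M.exists_measurable_lift h
  rw [SigmaHom.comp_apply, proj_eq_top] at hd
  obtain ⟨f, hf⟩ := ConcLinfty.exists_mk_ae_eq hF.aestronglyMeasurable hd
  refine ⟨f, Subtype.ext (SigmaHom.ext fun S => ?_)⟩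
  rw [ofBddMeas_apply, SigmaHom.comp_apply, proj_eq_iff]
  filter_upwards [hf] with x hx
  change (f.1 x ∈ S.1) = (F x ∈ S.1)
  rw [hx]

/-- The identification of the concrete and the abstract `L^∞` algebras of a model. -/
def equiv : ConcLinfty M.space ≃ Linfty P :=
  Equiv.ofBijective (Quotient.lift M.ofBddMeas fun _ _ h => M.ofBddMeas_eq_iff.2 h)
    ⟨fun a b => Quotient.inductionOn₂ a b fun _ _ h =>
      ConcLinfty.mk_eq.2 (M.ofBddMeas_eq_iff.1 h), fun b => by
      obtain ⟨f, hf⟩ := M.ofBddMeas_surjective b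
      exact ⟨ConcLinfty.mk f, hf⟩⟩

theorem isBinaryOp {op : ℂ × ℂ → ℂ} (hop : Measurable op) {f g h : BddMeas M.space}
    (e : ∀ x, h.1 x = op (f.1 x, g.1 x)) :
    Linfty.IsBinaryOp op hop (M.ofBddMeas f) (M.ofBddMeas g) (M.ofBddMeas h) := by
  refine ⟨M.proj.comp (pullback (fun x => (f.1 x, g.1 x)) (f.2.1.prodMk g.2.1)),
    rfl, rfl, SigmaHom.ext fun S => ?_⟩
  refine congrArg M.proj (Subtype.ext (Set.ext fun x => ?_))
  change op (f.1 x, g.1 x) ∈ S.1 ↔ h.1 x ∈ S.1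
  rw [e]

theorem isUnaryOp {op : ℂ → ℂ} (hop : Measurable op) {f h : BddMeas M.space}
    (e : ∀ x, h.1 x = op (f.1 x)) :
    Linfty.IsUnaryOp op hop (M.ofBddMeas f) (M.ofBddMeas h) := by
  refine SigmaHom.ext fun S => congrArg M.proj (Subtype.ext (Set.ext fun x => ?_))
  change op (f.1 x) ∈ S.1 ↔ h.1 x ∈ S.1
  rw [e]

end Model

/-- The joint map is determined by its two components, since measurable rectangles generate the
product `σ`-algebra. Hence any map that respects the relation `IsBinaryOp` is automatically additive
and multiplicative. -/
theorem Linfty.IsBinaryOp.unique {P : ProbAlg.{u}} {op : ℂ × ℂ → ℂ} {hop : Measurable op}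
    {f g h h' : Linfty P} (H : IsBinaryOp op hop f g h) (H' : IsBinaryOp op hop f g h') :
    h = h' := by
  obtain ⟨J, h1, h2, h3⟩ := H
  obtain ⟨J', h1', h2', h3'⟩ := H'
  suffices J = J' by
    subst this
    exact Subtype.ext (h3.symm.trans h3')
  refine SigmaHom.ext_of_generateFrom generateFrom_prod.symm ?_
  rintro _ hS ⟨S, hS', T, hT', rfl⟩
  have key : (⟨S ×ˢ T, hS⟩ : MeasAlg (ℂ × ℂ)) =
      pullback Prod.fst measurable_fst ⟨S, hS'⟩ ⊓ pullback Prod.snd measurable_snd ⟨T, hT'⟩ := rfl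
  rw [key, InfHomClass.map_inf, InfHomClass.map_inf]
  change J.comp (pullback Prod.fst measurable_fst) _ ⊓
    J.comp (pullback Prod.snd measurable_snd) _ = J'.comp (pullback Prod.fst measurable_fst) _ ⊓
    J'.comp (pullback Prod.snd measurable_snd) _
  rw [h1, h2, h1', h2']

theorem Linfty.IsUnaryOp.unique {P : ProbAlg.{u}} {op : ℂ → ℂ} {hop : Measurable op}
    {f h h' : Linfty P} (H : IsUnaryOp op hop f h) (H' : IsUnaryOp op hop f h') : h = h' :=
  Subtype.ext (H.symm.trans H')

end CanonicalModel
end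

noncomputable section
namespace CanonicalModel

/-! ### Transport of tracial von Neumann algebras along bijections -/

/-- A copy of `B`, to carry the structure transported along `e : B ≃ A`. -/
def Transported {A B : Type u} (_ : B ≃ A) : Type u := B

namespace Transported

variable {A B : Type u} [TracialVonNeumann A] (e : B ≃ A)

instance : CommRing (Transported e) := e.commRing

instance : Algebra ℂ (Transported e) := e.algebra ℂ

/-- The transporting bijection as an isomorphism of algebras. -/
def algEquiv : Transported e ≃ₐ[ℂ] A where
  __ := e
  map_mul' _ _ := e.apply_symm_apply _
  map_add' _ _ := e.apply_symm_apply _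
  commutes' _ := e.apply_symm_apply _

instance : NormedCommRing (Transported e) :=
  NormedCommRing.induced (Transported e) A (algEquiv e) (algEquiv e).injective

instance : NormedAlgebra ℂ (Transported e) :=
  NormedAlgebra.induced ℂ (Transported e) A (algEquiv e)

theorem norm_eq (a : Transported e) : ‖a‖ = ‖algEquiv e a‖ := rfl

instance : CompleteSpace (Transported e) :=
  (IsometryEquiv.mk (algEquiv e).toEquiv
    (AddMonoidHomClass.isometry_of_norm (algEquiv e) fun _ => rfl)).completeSpace

instance : Star (Transported e) := ⟨fun a => (algEquiv e).symm (star (algEquiv e a))⟩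

theorem algEquiv_star (a : Transported e) : algEquiv e (star a) = star (algEquiv e a) :=
  (algEquiv e).apply_symm_apply _

instance : StarRing (Transported e) where
  star_involutive a := (algEquiv e).injective (by simp only [algEquiv_star, star_star])
  star_mul a b := (algEquiv e).injective (by simp only [algEquiv_star, map_mul, star_mul])
  star_add a b := (algEquiv e).injective (by simp only [algEquiv_star, map_add, star_add])

instance : StarModule ℂ (Transported e) where
  star_smul c a := (algEquiv e).injective (by simp only [algEquiv_star, map_smul, star_smul])

instance : CStarRing (Transported e) where
  norm_mul_self_le a := by
    rw [norm_eq, norm_eq, map_mul, algEquiv_star, CStarRing.norm_star_mul_self]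

instance : CommCStarAlgebra (Transported e) where
  star_add := star_add
  norm_mul_self_le := CStarRing.norm_mul_self_le

/-- The transporting bijection as an isomorphism of `⋆`-algebras. -/
def starAlgEquiv : Transported e ≃⋆ₐ[ℂ] A :=
  StarAlgEquiv.ofAlgEquiv (algEquiv e) (algEquiv_star e)

/-- The transporting bijection as an isometry. -/
def isometryEquiv : Transported e ≃ₗᵢ[ℂ] A where
  __ := (algEquiv e).toLinearEquiv
  norm_map' _ := rfl

open scoped ComplexOrder in
instance tracial : TracialVonNeumann (Transported e) where
  wstar := by
    obtain ⟨X, _, _, _, ⟨i⟩⟩ := (TracialVonNeumann.wstar : WStarAlgebra A).exists_predual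
    exact ⟨X, _, _, inferInstance, ⟨i.trans (isometryEquiv e).symm⟩⟩
  trace := TracialVonNeumann.trace.comp (algEquiv e).toLinearMap
  trace_star a := by
    change TracialVonNeumann.trace (algEquiv e (star a)) = _
    rw [algEquiv_star, TracialVonNeumann.trace_star]
    rfl
  trace_one := by
    change TracialVonNeumann.trace (algEquiv e 1) = _
    rw [map_one, TracialVonNeumann.trace_one]
  trace_nonneg a := by
    change _ ≤ TracialVonNeumann.trace (algEquiv e (a * star a))
    rw [map_mul, algEquiv_star]
    exact TracialVonNeumann.trace_nonneg _
  trace_faithful a := by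
    change TracialVonNeumann.trace (algEquiv e (a * star a)) = 0 ↔ _
    rw [map_mul, algEquiv_star, TracialVonNeumann.trace_faithful, map_eq_zero_iff _
      (algEquiv e).injective]
  trace_normal := by
    let _ := CStarAlgebra.spectralOrder A
    let _ := CStarAlgebra.spectralOrder (Transported e)
    let Φ : Transported e →⋆ₐ[ℂ] A := starAlgEquiv e
    let Ψ : A →⋆ₐ[ℂ] Transported e := (starAlgEquiv e).symm
    have hΨ : ∀ a, Φ (Ψ a) = a := (starAlgEquiv e).apply_symm_apply
    have hΦ : ∀ a, Ψ (Φ a) = a := (starAlgEquiv e).symm_apply_apply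
    intro d hne hd a ha
    -- `Φ` and its inverse are both monotone, so `Φ` is an order isomorphism and carries suprema
    -- across.
    have h1 : IsLUB (Φ '' d) (Φ a) := by
      refine ⟨?_, fun c hc => ?_⟩
      · rintro _ ⟨y, hy, rfl⟩
        exact starAlgHom_mono Φ (ha.1 hy)
      · rw [← hΨ c]
        refine starAlgHom_mono Φ (ha.2 fun y hy => ?_)
        rw [← hΦ y]
        exact starAlgHom_mono Ψ (hc ⟨y, hy, rfl⟩)
    have h2 : DirectedOn (· ≤ ·) (Φ '' d) := by
      rintro _ ⟨x, hx, rfl⟩ _ ⟨y, hy, rfl⟩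
      obtain ⟨z, hz, hxz, hyz⟩ := hd x hx y hy
      exact ⟨Φ z, ⟨z, hz, rfl⟩, starAlgHom_mono Φ hxz, starAlgHom_mono Φ hyz⟩
    have h3 := TracialVonNeumann.trace_normal (hne.image Φ) h2 h1
    rwa [Set.image_image] at h3

end Transported

/-! ### The tracial von Neumann algebra `L^∞` of a probability algebra -/

namespace Linfty

variable {P Q : ProbAlg.{u}}

/-- Everything is imported from the Stone model. The relations proved below characterize the
operations and the norm intrinsically, and the trace depends only on distributions, so the choice of
model leaves no trace. -/
instance tracial : TracialVonNeumann (Linfty P) :=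
  Transported.tracial (A := ConcLinfty P.stoneModel.space) P.stoneModel.equiv.symm

theorem exists_rep (f : Linfty P) : ∃ g, P.stoneModel.ofBddMeas g = f :=
  P.stoneModel.ofBddMeas_surjective f

theorem stone_add (f g : BddMeas P.stoneModel.space) :
    P.stoneModel.ofBddMeas f + P.stoneModel.ofBddMeas g = P.stoneModel.ofBddMeas (f + g) := by
  change P.stoneModel.equiv (P.stoneModel.equiv.symm (P.stoneModel.equiv (ConcLinfty.mk f)) +
    P.stoneModel.equiv.symm (P.stoneModel.equiv (ConcLinfty.mk g))) = _
  rw [Equiv.symm_apply_apply, Equiv.symm_apply_apply]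
  rfl

theorem stone_mul (f g : BddMeas P.stoneModel.space) :
    P.stoneModel.ofBddMeas f * P.stoneModel.ofBddMeas g = P.stoneModel.ofBddMeas (f * g) := by
  change P.stoneModel.equiv (P.stoneModel.equiv.symm (P.stoneModel.equiv (ConcLinfty.mk f)) *
    P.stoneModel.equiv.symm (P.stoneModel.equiv (ConcLinfty.mk g))) = _
  rw [Equiv.symm_apply_apply, Equiv.symm_apply_apply]
  rfl

theorem stone_smul (c : ℂ) (f : BddMeas P.stoneModel.space) :
    c • P.stoneModel.ofBddMeas f = P.stoneModel.ofBddMeas (c • f) := by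
  change P.stoneModel.equiv (c • P.stoneModel.equiv.symm
    (P.stoneModel.equiv (ConcLinfty.mk f))) = _
  rw [Equiv.symm_apply_apply]
  rfl

theorem stone_star (f : BddMeas P.stoneModel.space) :
    star (P.stoneModel.ofBddMeas f) = P.stoneModel.ofBddMeas (star f) := by
  change P.stoneModel.equiv (star (P.stoneModel.equiv.symm
    (P.stoneModel.equiv (ConcLinfty.mk f)))) = _
  rw [Equiv.symm_apply_apply]
  rfl

theorem stone_one : (1 : Linfty P) = P.stoneModel.ofBddMeas 1 := rfl

theorem stone_norm (f : BddMeas P.stoneModel.space) :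
    ‖P.stoneModel.ofBddMeas f‖ = ‖ConcLinfty.mk f‖ := by
  change ‖P.stoneModel.equiv.symm (P.stoneModel.equiv (ConcLinfty.mk f))‖ = _
  rw [Equiv.symm_apply_apply]

theorem stone_trace (f : BddMeas P.stoneModel.space) :
    TracialVonNeumann.trace (P.stoneModel.ofBddMeas f) = ∫ x, f.1 x ∂P.stoneModel.space.μ := by
  change ConcLinfty.integral (P.stoneModel.equiv.symm (P.stoneModel.equiv (ConcLinfty.mk f))) = _
  rw [Equiv.symm_apply_apply]
  rfl

theorem isBinaryOp_add (f g : Linfty P) :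
    IsBinaryOp (fun z => z.1 + z.2) (by fun_prop) f g (f + g) := by
  obtain ⟨f, rfl⟩ := exists_rep f
  obtain ⟨g, rfl⟩ := exists_rep g
  rw [stone_add]
  exact P.stoneModel.isBinaryOp _ fun _ => rfl

theorem isBinaryOp_mul (f g : Linfty P) :
    IsBinaryOp (fun z => z.1 * z.2) (by fun_prop) f g (f * g) := by
  obtain ⟨f, rfl⟩ := exists_rep f
  obtain ⟨g, rfl⟩ := exists_rep g
  rw [stone_mul]
  exact P.stoneModel.isBinaryOp _ fun _ => rfl

theorem isUnaryOp_smul (c : ℂ) (f : Linfty P) :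
    IsUnaryOp (fun z => c * z) (by fun_prop) f (c • f) := by
  obtain ⟨f, rfl⟩ := exists_rep f
  rw [stone_smul]
  exact P.stoneModel.isUnaryOp _ fun _ => rfl

theorem isUnaryOp_star (f : Linfty P) :
    IsUnaryOp (starRingEnd ℂ) Complex.continuous_conj.measurable f (star f) := by
  obtain ⟨f, rfl⟩ := exists_rep f
  rw [stone_star]
  exact P.stoneModel.isUnaryOp _ fun _ => rfl

end Linfty

/-- The integral of a bounded measurable function depends only on its distribution. -/
theorem integral_eq_of_law {X Y : ConcProb.{u}} (f : BddMeas X) (g : BddMeas Y)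
    (h : ∀ S : MeasAlg ℂ, X.μ.real (f.1 ⁻¹' S.1) = Y.μ.real (g.1 ⁻¹' S.1)) :
    ∫ x, f.1 x ∂X.μ = ∫ y, g.1 y ∂Y.μ := by
  have h1 : X.μ.map f.1 = Y.μ.map g.1 := by
    ext S hS
    rw [Measure.map_apply f.2.1 hS, Measure.map_apply g.2.1 hS]
    exact (measureReal_eq_measureReal_iff).1 (h ⟨S, hS⟩)
  have h2 := integral_map f.2.1.aemeasurable (f := fun z : ℂ => z) (μ := X.μ)
    measurable_id.aestronglyMeasurable
  have h3 := integral_map g.2.1.aemeasurable (f := fun z : ℂ => z) (μ := Y.μ)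
    measurable_id.aestronglyMeasurable
  rw [← h2, ← h3, h1]

namespace Model

variable {P : ProbAlg.{u}} (M : Model P)

theorem measure_ofBddMeas (f : BddMeas M.space) (S : MeasAlg ℂ) :
    P.μ ((M.ofBddMeas f).1 S) = M.space.μ.real (f.1 ⁻¹' S.1) := M.measure_proj _

/-- The trace was defined through the Stone model. The distribution of a function is read off from
`P`, so its integral is the same in every model. -/
theorem trace_ofBddMeas (f : BddMeas M.space) :
    TracialVonNeumann.trace (M.ofBddMeas f) = ∫ x, f.1 x ∂M.space.μ := by
  obtain ⟨g, hg⟩ := Linfty.exists_rep (M.ofBddMeas f)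
  rw [← hg, Linfty.stone_trace]
  refine integral_eq_of_law g f fun S => ?_
  rw [← measure_ofBddMeas, ← measure_ofBddMeas, hg]

/-- Pointwise sums in `M` and the sum from the Stone model satisfy the same relation `IsBinaryOp`,
which has at most one solution. The other operations follow the same pattern. -/
theorem equiv_add (a b : ConcLinfty M.space) : M.equiv (a + b) = M.equiv a + M.equiv b :=
  Quotient.inductionOn₂ a b fun _ _ =>
    (M.isBinaryOp _ fun _ => rfl).unique (Linfty.isBinaryOp_add _ _)

theorem equiv_mul (a b : ConcLinfty M.space) : M.equiv (a * b) = M.equiv a * M.equiv b :=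
  Quotient.inductionOn₂ a b fun _ _ =>
    (M.isBinaryOp _ fun _ => rfl).unique (Linfty.isBinaryOp_mul _ _)

theorem equiv_smul (c : ℂ) (a : ConcLinfty M.space) : M.equiv (c • a) = c • M.equiv a :=
  Quotient.inductionOn a fun _ =>
    (M.isUnaryOp (by fun_prop) fun _ => rfl).unique (Linfty.isUnaryOp_smul c _)

theorem equiv_star (a : ConcLinfty M.space) : M.equiv (star a) = star (M.equiv a) :=
  Quotient.inductionOn a fun _ => (M.isUnaryOp _ fun _ => rfl).unique (Linfty.isUnaryOp_star _)

/-- The isomorphism between the concrete and the abstract `L^∞` algebras of a model. -/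
def starAlgEquiv : ConcLinfty M.space ≃⋆ₐ[ℂ] Linfty P where
  __ := M.equiv
  map_mul' := M.equiv_mul
  map_add' := M.equiv_add
  map_smul' := M.equiv_smul
  map_star' := M.equiv_star

theorem trace_starAlgEquiv (a : ConcLinfty M.space) :
    TracialVonNeumann.trace (M.starAlgEquiv a) = TracialVonNeumann.trace a :=
  Quotient.inductionOn a M.trace_ofBddMeas

/-- The indicator function of a measurable set. -/
def indicatorFun {X : ConcProb.{u}} (S : MeasAlg X.carrier) : BddMeas X :=
  ⟨S.1.indicator 1, measurable_const.indicator S.2, 1, fun x => by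
    by_cases hx : x ∈ S.1 <;> simp [hx]⟩

theorem ofBddMeas_indicatorFun (S : MeasAlg M.space.carrier) :
    M.ofBddMeas (indicatorFun S) = Linfty.indicator (M.proj S) := by
  classical
  refine Subtype.ext (SigmaHom.ext fun T => ?_)
  rw [ofBddMeas_apply]
  change _ = (if (1 : ℂ) ∈ T.1 then M.proj S else ⊥) ⊔ (if (0 : ℂ) ∈ T.1 then (M.proj S)ᶜ else ⊥)
  have h : (⟨(indicatorFun S).1 ⁻¹' T.1, (indicatorFun S).2.1 T.2⟩ : MeasAlg M.space.carrier) =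
      (if (1 : ℂ) ∈ T.1 then S else ⊥) ⊔ (if (0 : ℂ) ∈ T.1 then Sᶜ else ⊥) := by
    refine Subtype.ext (Set.ext fun x => ?_)
    change S.1.indicator 1 x ∈ T.1 ↔ x ∈ (if (1 : ℂ) ∈ T.1 then S else ⊥).1 ∪
      (if (0 : ℂ) ∈ T.1 then Sᶜ else ⊥).1
    have hb : x ∉ (⊥ : MeasAlg M.space.carrier).1 := fun h => h
    have hc : x ∈ (Sᶜ : MeasAlg M.space.carrier).1 ↔ x ∉ S.1 := Iff.rfl
    rw [Set.mem_union]
    by_cases hx : x ∈ S.1 <;> by_cases h1 : (1 : ℂ) ∈ T.1 <;> by_cases h0 : (0 : ℂ) ∈ T.1 <;>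
      simp only [hx, h1, h0, Set.indicator_of_mem, Set.indicator_of_notMem, if_true, if_false,
        Pi.one_apply, hb, hc, not_true, not_false_iff, or_true, or_false]
  rw [h, map_sup, apply_ite M.proj, apply_ite M.proj, map_bot, map_compl']

end Model

namespace Linfty

variable {P Q : ProbAlg.{u}}

theorem norm_eq (f : Linfty P) : ‖f‖ = sInf {M : ℝ | 0 ≤ M ∧ f.1 (disc M) = ⊤} := by
  obtain ⟨f, rfl⟩ := exists_rep f
  rw [stone_norm, ConcLinfty.norm_mk]
  congr 1
  ext M
  refine and_congr_right fun _ => ?_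
  rw [Model.ofBddMeas_apply, Model.proj_eq_top]
  exact Iff.rfl

theorem trace_indicator (E : P.carrier) :
    TracialVonNeumann.trace (indicator E : Linfty P) = P.μ E := by
  obtain ⟨S, rfl⟩ := P.stoneModel.surjective E
  rw [← Model.ofBddMeas_indicatorFun, stone_trace, Model.measure_proj]
  change ∫ x, S.1.indicator (1 : P.stoneModel.space.carrier → ℂ) x ∂P.stoneModel.space.μ = _
  rw [integral_indicator S.2]
  simp

/-- The tracial von Neumann algebra of bounded abstractly measurable functions. -/
def str (P : ProbAlg.{u}) : LinftyStr P where
  toTracialVonNeumann := tracial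
  isBinaryOp_add := isBinaryOp_add
  isBinaryOp_mul := isBinaryOp_mul
  isUnaryOp_smul := isUnaryOp_smul
  isUnaryOp_star := isUnaryOp_star
  norm_eq := norm_eq
  trace_indicator := trace_indicator

theorem IsBinaryOp.koopman {op : ℂ × ℂ → ℂ} {hop : Measurable op} {f g h : Linfty Q}
    (H : IsBinaryOp op hop f g h) (T : P ⟶ Q) :
    IsBinaryOp op hop (koopman T f) (koopman T g) (koopman T h) := by
  obtain ⟨J, h1, h2, h3⟩ := H
  exact ⟨(AbsProb.Hom.pull T).comp J, congrArg (AbsProb.Hom.pull T).comp h1,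
    congrArg (AbsProb.Hom.pull T).comp h2, congrArg (AbsProb.Hom.pull T).comp h3⟩

theorem IsUnaryOp.koopman {op : ℂ → ℂ} {hop : Measurable op} {f h : Linfty Q}
    (H : IsUnaryOp op hop f h) (T : P ⟶ Q) :
    IsUnaryOp op hop (Linfty.koopman T f) (Linfty.koopman T h) :=
  congrArg (AbsProb.Hom.pull T).comp H

/-- Composition with `T` preserves the defining relation of the operation, and uniqueness does the
rest. -/
theorem koopman_add (T : P ⟶ Q) (f g : Linfty Q) :
    koopman T (f + g) = koopman T f + koopman T g :=
  ((isBinaryOp_add f g).koopman T).unique (isBinaryOp_add _ _)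

theorem koopman_mul (T : P ⟶ Q) (f g : Linfty Q) :
    koopman T (f * g) = koopman T f * koopman T g :=
  ((isBinaryOp_mul f g).koopman T).unique (isBinaryOp_mul _ _)

theorem koopman_smul (T : P ⟶ Q) (c : ℂ) (f : Linfty Q) :
    koopman T (c • f) = c • koopman T f :=
  ((isUnaryOp_smul c f).koopman T).unique (isUnaryOp_smul c _)

theorem koopman_star (T : P ⟶ Q) (f : Linfty Q) : koopman T (star f) = star (koopman T f) :=
  ((isUnaryOp_star f).koopman T).unique (isUnaryOp_star _)

theorem koopman_indicator (T : P ⟶ Q) (E : Q.carrier) :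
    koopman T (indicator E) = indicator (AbsProb.Hom.pull T E) := by
  classical
  refine Subtype.ext (SigmaHom.ext fun S => ?_)
  change AbsProb.Hom.pull T ((if (1 : ℂ) ∈ S.1 then E else ⊥) ⊔
    (if (0 : ℂ) ∈ S.1 then Eᶜ else ⊥)) = (if (1 : ℂ) ∈ S.1 then AbsProb.Hom.pull T E else ⊥) ⊔
    (if (0 : ℂ) ∈ S.1 then (AbsProb.Hom.pull T E)ᶜ else ⊥)
  rw [map_sup, apply_ite (AbsProb.Hom.pull T), apply_ite (AbsProb.Hom.pull T), map_bot, map_compl']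

theorem indicator_top : (indicator ⊤ : Linfty P) = 1 := by
  rw [← map_top P.stoneModel.proj, ← Model.ofBddMeas_indicatorFun, stone_one]
  congr 1
  exact Subtype.ext (Set.indicator_univ _)

theorem koopman_one (T : P ⟶ Q) : koopman T (1 : Linfty Q) = 1 := by
  rw [← indicator_top, koopman_indicator, map_top, indicator_top]

/-- The Koopman operator as a `⋆`-homomorphism. -/
def koopmanHom (T : P ⟶ Q) : Linfty Q →⋆ₐ[ℂ] Linfty P where
  toFun := koopman T
  map_one' := koopman_one T
  map_mul' := koopman_mul T
  map_zero' := by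
    have := koopman_smul T 0 (0 : Linfty Q)
    rwa [zero_smul, zero_smul] at this
  map_add' := koopman_add T
  commutes' c := by
    rw [Algebra.algebraMap_eq_smul_one, Algebra.algebraMap_eq_smul_one, koopman_smul, koopman_one]
  map_star' := koopman_star T

/-- Representatives of `f` and of its pullback live on different Stone spaces but have the same
distribution, as `T` preserves measure. -/
theorem trace_koopman (T : P ⟶ Q) (f : Linfty Q) :
    TracialVonNeumann.trace (koopman T f) = TracialVonNeumann.trace f := by
  obtain ⟨g, hg⟩ := exists_rep (koopman T f)
  obtain ⟨f, rfl⟩ := exists_rep f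
  rw [← hg, stone_trace, stone_trace]
  refine integral_eq_of_law g f fun S => ?_
  rw [← Model.measure_ofBddMeas, ← Model.measure_ofBddMeas, hg]
  exact AbsProb.Hom.measure_pull T _

end Linfty

/-- `L^∞` is a functor on probability algebras. -/
def linftyWellDefined : LinftyWellDefined.{u} where
  str := Linfty.str
  koopman_isHom T := ⟨VonNeumannTau.homOfTrace
    (A := VonNeumannTau.mk (Linfty _)) (B := VonNeumannTau.mk (Linfty _))
    (Linfty.koopmanHom T) (Linfty.trace_koopman T), fun _ => rfl⟩

/-- The concrete and the abstract `L^∞` algebras of a concrete probability space agree. -/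
def absLinftyIso : abstraction ⋙ linftyWellDefined.{u}.absFunctor ≅
    concLinftyWellDefined.{u}.functor :=
  NatIso.ofComponents (fun X => (VonNeumannTau.isoOfBijective
      (A := (concLinftyWellDefined.{u}.functor.obj X).unop)
      (B := ((abstraction ⋙ linftyWellDefined.{u}.absFunctor).obj X).unop)
      (VonNeumannTau.homOfTrace
        (A := (concLinftyWellDefined.{u}.functor.obj X).unop)
        (B := ((abstraction ⋙ linftyWellDefined.{u}.absFunctor).obj X).unop)
        (X.model.starAlgEquiv :
          ConcLinfty X.model.space →⋆ₐ[ℂ] Linfty (mes.obj (abstraction.obj X)))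
        X.model.trace_starAlgEquiv)
      X.model.starAlgEquiv.bijective).op)
    (fun {X Y} T => by
      refine Quiver.Hom.unop_inj (VonNeumannTau.hom_ext fun a => ?_)
      refine ((linftyWellDefined.{u}.koopman_isHom (mes.map (abstraction.map T))).choose_spec
        (Y.model.starAlgEquiv a)).trans ?_
      refine Eq.trans ?_ (congrArg X.model.starAlgEquiv
        ((concLinftyWellDefined.{u}.koopman_isHom T).choose_spec a).symm)
      exact Quotient.inductionOn a fun _ => rfl)

end CanonicalModel
end

noncomputable section
namespace CanonicalModel

open Topology WeakDual

/-! ### Projections of a tracial von Neumann algebra -/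

namespace Proj

section Order

/-- As a subtype, `Proj A` would also inherit the spectral order of `A` once that is a local
instance. The raised priorities select the lattice order; `coe_le_coe` shows that the two agree. -/
instance (priority := 1100) partialOrder {A : Type*} [CommRing A] [StarRing A] :
    PartialOrder (Proj A) := (inferInstance : Lattice (Proj A)).toPartialOrder

instance (priority := 1100) preorder {A : Type*} [CommRing A] [StarRing A] : Preorder (Proj A) :=
  (partialOrder (A := A)).toPreorder

instance (priority := 1100) le {A : Type*} [CommRing A] [StarRing A] : LE (Proj A) :=
  (preorder (A := A)).toLE

attribute [local instance] CStarAlgebra.spectralOrder CStarAlgebra.spectralOrderedRing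

open scoped ComplexOrder

variable {A B : VonNeumannTau.{u}}

theorem coe_le_coe {p q : Proj A.carrier} : p.1 ≤ q.1 ↔ p ≤ q := by
  rw [le_iff]
  exact p.2.le_iff_mul_eq_left q.2

theorem isLUB_of_isLUB_coe {E : ℕ → Proj A.carrier} {p : Proj A.carrier}
    (h : IsLUB (Set.range fun n => (E n).1) p.1) : IsLUB (Set.range E) p := by
  constructor
  · rintro _ ⟨n, rfl⟩
    exact coe_le_coe.1 (h.1 ⟨n, rfl⟩)
  · intro q hq
    refine coe_le_coe.1 (h.2 ?_)
    rintro _ ⟨n, rfl⟩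
    exact coe_le_coe.2 (hq ⟨n, rfl⟩)

theorem directedOn_coe {E : ℕ → Proj A.carrier} (hE : Monotone E) :
    DirectedOn (· ≤ ·) (Set.range fun n => (E n).1) := by
  rintro _ ⟨m, rfl⟩ _ ⟨n, rfl⟩
  exact ⟨_, ⟨max m n, rfl⟩, coe_le_coe.2 (hE (le_max_left m n)),
    coe_le_coe.2 (hE (le_max_right m n))⟩

/-- The supremum `a` in the algebra is idempotent: `0 ≤ a ≤ 1` gives `a * a ≤ a`, while `a * a`
dominates every `E n = E n * E n`, so `a ≤ a * a`. -/
theorem exists_isLUB_coe {E : ℕ → Proj A.carrier} (hE : Monotone E) :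
    ∃ p : Proj A.carrier, IsLUB (Set.range fun n => (E n).1) p.1 := by
  have _ := TracialVonNeumann.wstar (A := A.carrier)
  obtain ⟨a, ha⟩ := exists_isLUB_of_directedOn (Set.range_nonempty _) (directedOn_coe hE)
    ⟨1, by rintro _ ⟨n, rfl⟩; exact (E n).2.le_one⟩
  have h0 : 0 ≤ a := (E 0).2.nonneg.trans (ha.1 ⟨0, rfl⟩)
  have h1 : a ≤ 1 := ha.2 (by rintro _ ⟨n, rfl⟩; exact (E n).2.le_one)
  have h2 : a * a ≤ a := by
    rw [le_iff_characters] at h0 h1 ⊢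
    intro φ
    have := mul_le_mul_of_nonneg_left (h1 φ) (by simpa using h0 φ : 0 ≤ φ a)
    simpa using this
  have h3 : a ≤ a * a := by
    refine ha.2 ?_
    rintro _ ⟨n, rfl⟩
    have h := ha.1 ⟨n, rfl⟩
    have hn := (E n).2.nonneg
    have hi := (E n).2.isIdempotentElem.eq
    rw [le_iff_characters] at h hn h0 ⊢
    intro φ
    have := mul_le_mul (h φ) (h φ) (by simpa using hn φ) (by simpa using h0 φ)
    rwa [← map_mul, ← map_mul, hi] at this
  exact ⟨⟨a, le_antisymm h2 h3, IsSelfAdjoint.of_nonneg h0⟩, ha⟩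

/-- For increasing sequences the supremum among projections is also the supremum in the algebra,
which is what normality speaks about. -/
theorem isLUB_coe {E : ℕ → Proj A.carrier} (hE : Monotone E) {p : Proj A.carrier}
    (h : IsLUB (Set.range E) p) : IsLUB (Set.range fun n => (E n).1) p.1 := by
  obtain ⟨q, hq⟩ := exists_isLUB_coe hE
  have hpq : p = q := h.unique (isLUB_of_isLUB_coe hq)
  rwa [hpq]

theorem isLUB_partialSups {L : Type*} [Lattice L] {E : ℕ → L} {p : L} :
    IsLUB (Set.range (partialSups E)) p ↔ IsLUB (Set.range E) p := by
  simp only [IsLUB, upperBounds_range_partialSups]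

theorem tendsto_measure {E : ℕ → Proj A.carrier} (hE : Monotone E) {p : Proj A.carrier}
    (h : IsLUB (Set.range E) p) :
    Filter.Tendsto (fun n => measure A (E n)) Filter.atTop (𝓝 (measure A p)) := by
  refine tendsto_atTop_isLUB (fun m n hmn => trace_re_mono (coe_le_coe.2 (hE hmn))) ?_
  have := TracialVonNeumann.trace_normal (Set.range_nonempty _) (directedOn_coe hE) (isLUB_coe hE h)
  rwa [← Set.range_comp] at this

theorem measure_nonneg (p : Proj A.carrier) : 0 ≤ measure A p :=
  (Complex.le_def.1 (trace_nonneg_of_nonneg p.2.nonneg)).1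

theorem measure_sup_of_disjoint {p q : Proj A.carrier} (h : p ⊓ q = ⊥) :
    measure A (p ⊔ q) = measure A p + measure A q := by
  have h0 : p.1 * q.1 = 0 := congrArg Subtype.val h
  have h1 : (p ⊔ q).1 = p.1 + q.1 := by
    rw [coe_sup]
    linear_combination -h0
  rw [measure, h1, map_add, Complex.add_re, measure, measure]

theorem isProbMeasure : IsProbMeasure (measure A) where
  mem_Icc p := by
    refine ⟨measure_nonneg p, ?_⟩
    have := trace_re_mono p.2.le_one
    rwa [TracialVonNeumann.trace_one] at this
  map_bot := by
    change (A.trace 0).re = 0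
    rw [map_zero, Complex.zero_re]
  map_top := by
    change (A.trace 1).re = 1
    rw [TracialVonNeumann.trace_one, Complex.one_re]
  hasSum E hE p hp := by
    -- Countable additivity is normality of the trace along the partial joins. The index is shifted
    -- because `partialSups E n` joins `n + 1` projections.
    rw [hasSum_iff_tendsto_nat_of_nonneg fun n => measure_nonneg _,
      ← Filter.tendsto_add_atTop_iff_nat 1]
    refine (tendsto_measure (partialSups_monotone E) (isLUB_partialSups.2 hp)).congr fun n => ?_
    induction n with
    | zero => simp
    | succ n ih =>
      rw [Finset.sum_range_succ, ← ih, partialSups_add_one, measure_sup_of_disjoint]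
      refine Disjoint.eq_bot ?_
      rw [partialSups_eq_sup_range, Finset.disjoint_sup_left]
      intro i hi
      exact disjoint_iff.2 (hE _ _ (by have := Finset.mem_range.1 hi; omega))

/-- Normality applies to directed sets only, so the sequence is replaced by its partial joins, which
`Φ` respects. -/
theorem map_isLUB (Φ : A ⟶ B) (E : ℕ → Proj A.carrier) (p : Proj A.carrier)
    (h : IsLUB (Set.range E) p) : IsLUB (Set.range fun n => map Φ (E n)) (map Φ p) := by
  rw [← isLUB_partialSups] at h
  have h1 := Φ.normal (Set.range_nonempty _) (directedOn_coe (partialSups_monotone E))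
    (isLUB_coe (partialSups_monotone E) h)
  rw [← Set.range_comp] at h1
  have h2 := isLUB_of_isLUB_coe (E := fun n => map Φ (partialSups E n)) (p := map Φ p) h1
  have h3 : (fun n => map Φ (partialSups E n)) = partialSups fun n => map Φ (E n) :=
    funext fun n => (map_partialSups (map Φ) E n).symm
  rw [h3] at h2
  exact isLUB_partialSups.1 h2

end Order

end Proj

/-- The projections of a tracial von Neumann algebra form a probability algebra, functorially. -/
theorem idemWellDefined : IdemWellDefined.{u} where
  sigma A := .of_isLUB fun E => by
    obtain ⟨p, hp⟩ := Proj.exists_isLUB_coe (partialSups_monotone E)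
    exact ⟨p, Proj.isLUB_partialSups.1 (Proj.isLUB_of_isLUB_coe hp)⟩
  isProb _ := Proj.isProbMeasure
  map_isLUB := Proj.map_isLUB

/-! ### The projections of `L^∞` -/

/-- A bijective homomorphism of Boolean algebras as an isomorphism of orders. -/
def orderIsoOfBijective {B C : Type*} [BooleanAlgebra B] [BooleanAlgebra C]
    (f : BoundedLatticeHom B C) (h : Function.Bijective f) : B ≃o C where
  toEquiv := Equiv.ofBijective f h
  map_rel_iff' {a b} := by
    change f a ≤ f b ↔ a ≤ b
    rw [← inf_eq_left, ← map_inf, h.1.eq_iff, inf_eq_left]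

/-- An isomorphism of orders between Boolean algebras is a `σ`-homomorphism. -/
def sigmaHomOfOrderIso {B C : Type*} [BooleanAlgebra B] [BooleanAlgebra C] (e : B ≃o C) :
    SigmaHom B C :=
  .ofIsLUB
    { toFun := e
      map_sup' := map_sup e
      map_inf' := map_inf e
      map_top' := map_top e
      map_bot' := map_bot e }
    (fun E a ha => by
      have := e.isLUB_image'.2 ha
      rwa [← Set.range_comp] at this)

/-- A measure-preserving isomorphism of Boolean algebras is an isomorphism of probability
algebras. -/
def ProbAlg.isoOfOrderIso {P Q : ProbAlg.{u}} (e : Q.carrier ≃o P.carrier)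
    (h : ∀ E, P.μ (e E) = Q.μ E) : P ≅ Q where
  hom := AbsProb.Hom.mk (sigmaHomOfOrderIso e) h
  inv := AbsProb.Hom.mk (sigmaHomOfOrderIso e.symm) fun E => by
    rw [← h]
    exact congrArg P.μ (e.apply_symm_apply E)
  hom_inv_id := AbsProb.Hom.ext (SigmaHom.ext fun E => e.apply_symm_apply E)
  inv_hom_id := AbsProb.Hom.ext (SigmaHom.ext fun E => e.symm_apply_apply E)

namespace Linfty

variable {P : ProbAlg.{u}}

theorem indicator_inf (E F : P.carrier) :
    (indicator (E ⊓ F) : Linfty P) = indicator E * indicator F := by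
  obtain ⟨S, rfl⟩ := P.stoneModel.surjective E
  obtain ⟨T, rfl⟩ := P.stoneModel.surjective F
  rw [← map_inf, ← Model.ofBddMeas_indicatorFun, ← Model.ofBddMeas_indicatorFun,
    ← Model.ofBddMeas_indicatorFun, stone_mul]
  congr 1
  refine Subtype.ext (funext fun x => ?_)
  change (S.1 ∩ T.1).indicator (1 : P.stoneModel.space.carrier → ℂ) x =
    S.1.indicator 1 x * T.1.indicator 1 x
  by_cases hS : x ∈ S.1 <;> by_cases hT : x ∈ T.1 <;> simp [hS, hT]

theorem indicator_compl (E : P.carrier) : (indicator Eᶜ : Linfty P) = 1 - indicator E := by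
  obtain ⟨S, rfl⟩ := P.stoneModel.surjective E
  rw [eq_sub_iff_add_eq, ← map_compl', ← Model.ofBddMeas_indicatorFun,
    ← Model.ofBddMeas_indicatorFun, stone_add, stone_one]
  congr 1
  exact Subtype.ext (Set.indicator_compl_add_self S.1 1)

theorem star_indicator (E : P.carrier) : star (indicator E : Linfty P) = indicator E := by
  obtain ⟨S, rfl⟩ := P.stoneModel.surjective E
  rw [← Model.ofBddMeas_indicatorFun, stone_star]
  congr 1
  refine Subtype.ext (funext fun x => ?_)
  change starRingEnd ℂ (S.1.indicator 1 x) = S.1.indicator 1 x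
  by_cases hx : x ∈ S.1 <;> simp [hx]

/-- The indicator functions as projections. -/
def indicatorProj (P : ProbAlg.{u}) : BoundedLatticeHom P.carrier (Proj (Linfty P)) where
  toFun E := ⟨indicator E, by
    refine ⟨?_, star_indicator E⟩
    rw [IsIdempotentElem, ← indicator_inf, inf_idem]⟩
  map_sup' E F := Subtype.ext (by
    change indicator (E ⊔ F) = 1 - (1 - indicator E) * (1 - indicator F)
    rw [← indicator_compl, ← indicator_compl, ← indicator_inf, ← compl_sup,
      ← indicator_compl, compl_compl])
  map_inf' E F := Subtype.ext (indicator_inf E F)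
  map_top' := Subtype.ext indicator_top
  map_bot' := Subtype.ext (by
    change indicator ⊥ = 0
    rw [← compl_top, indicator_compl, indicator_top, sub_self])

/-- The preimage of `{1}` recovers the element. Conversely an idempotent function takes only the
values `0` and `1` almost everywhere, hence is the indicator of the set where it equals `1`. -/
theorem indicatorProj_bijective : Function.Bijective (indicatorProj P) := by
  constructor
  · intro E F h
    have h1 : ∀ G : P.carrier, (indicator G).1 ⟨{1}, measurableSet_singleton 1⟩ = G := fun G => by
      change (if (1 : ℂ) ∈ ({1} : Set ℂ) then G else ⊥) ⊔
        (if (0 : ℂ) ∈ ({1} : Set ℂ) then Gᶜ else ⊥) = G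
      simp
    rw [← h1 E, ← h1 F]
    exact congrArg (fun p : Proj (Linfty P) => p.1.1 _) h
  · rintro ⟨p, hp⟩
    obtain ⟨f, rfl⟩ := exists_rep p
    have h := hp.isIdempotentElem.eq
    rw [stone_mul, Model.ofBddMeas_eq_iff] at h
    refine ⟨P.stoneModel.proj ⟨f.1 ⁻¹' {1}, f.2.1 (measurableSet_singleton 1)⟩, Subtype.ext ?_⟩
    change indicator _ = _
    rw [← Model.ofBddMeas_indicatorFun, Model.ofBddMeas_eq_iff]
    filter_upwards [h] with x hx
    have hx : f.1 x * f.1 x = f.1 x := hx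
    change (f.1 ⁻¹' {1}).indicator 1 x = f.1 x
    by_cases h1 : f.1 x = 1
    · simp [h1]
    · refine (Set.indicator_of_notMem (s := f.1 ⁻¹' {1}) h1 _).trans ?_
      by_contra h0
      exact h1 (mul_left_cancel₀ (Ne.symm h0) (hx.trans (mul_one _).symm))

end Linfty

/-- The projections of `L^∞(P)` are the indicator functions of the elements of `P`. -/
def linftyIdemIso : linftyWellDefined.{u}.functor ⋙ idemWellDefined.{u}.functor ≅ 𝟭 ProbAlg.{u} :=
  NatIso.ofComponents
    (fun P => ProbAlg.isoOfOrderIso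
      (P := (linftyWellDefined.{u}.functor ⋙ idemWellDefined.{u}.functor).obj P) (Q := P)
      (orderIsoOfBijective (Linfty.indicatorProj P) Linfty.indicatorProj_bijective)
      (fun E => congrArg Complex.re (Linfty.trace_indicator E)))
    (fun T => AbsProb.Hom.ext (SigmaHom.ext fun E => Subtype.ext
      (((linftyWellDefined.{u}.koopman_isHom T).choose_spec (Linfty.indicator E)).trans
        (Linfty.koopman_indicator T E))))

end CanonicalModel
end

noncomputable section
namespace CanonicalModel

open WeakDual Filter Topology

/-! ### A tracial von Neumann algebra is the `L^∞` algebra of its spectrum -/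

namespace VonNeumannTau

/-- The spectrum of a tracial von Neumann algebra, with the measure representing the trace. -/
abbrev spec (A : VonNeumannTau.{u}) : CHProb.{u} :=
  rieszWellDefined.functor.obj (.op (forget.obj A))

variable {A : VonNeumannTau.{u}}

/-- The Gelfand transform. -/
def gelfand (a : A.carrier) : C(A.spec.carrier, ℂ) := gelfandStarTransform A.carrier a

theorem exists_gelfand_eq (f : C(A.spec.carrier, ℂ)) : ∃ a : A.carrier, gelfand a = f :=
  exists_gelfandStarTransform_eq f

theorem integral_gelfand (a : A.carrier) : ∫ φ, gelfand a φ ∂A.spec.μ = A.trace a :=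
  rieszWellDefined.integral_eq (.op (forget.obj A)) a

section Order

attribute [local instance] CStarAlgebra.spectralOrder CStarAlgebra.spectralOrderedRing

open scoped ComplexOrder

/-- Faithfulness in the form of full support. The continuous function `d` measures the failure of `0
≤ z`; applied to `b - a` it gives a positive element of trace zero, hence zero, so the inequality
holds at every character. -/
theorem le_of_ae_le {a b : A.carrier} (h : ∀ᵐ φ ∂A.spec.μ, gelfand a φ ≤ gelfand b φ) : a ≤ b := by
  let d : ℂ → ℝ := fun z => max (-z.re) 0 + |z.im|
  have hd : Continuous d := by fun_prop
  have hd0 : ∀ z, 0 ≤ d z := fun z => add_nonneg (le_max_right _ _) (abs_nonneg _)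
  have hd1 : ∀ z, d z = 0 ↔ 0 ≤ z := fun z => by
    rw [add_eq_zero_iff_of_nonneg (le_max_right _ _) (abs_nonneg _), max_eq_right_iff, abs_eq_zero,
      Complex.le_def, neg_nonpos, Complex.zero_re, Complex.zero_im, eq_comm (a := z.im)]
  obtain ⟨w, hw⟩ := exists_gelfand_eq (A := A)
    ⟨fun φ => (d (gelfand (b - a) φ) : ℂ), Complex.continuous_ofReal.comp
      (hd.comp (gelfand (b - a)).continuous)⟩
  have hw1 : ∀ φ : characterSpace ℂ A.carrier, φ w = (d (φ (b - a)) : ℂ) := fun φ =>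
    DFunLike.congr_fun hw φ
  have hw0 : 0 ≤ w := nonneg_iff_characters.2 fun φ => by
    rw [hw1]
    exact Complex.zero_le_real.2 (hd0 _)
  have ht : A.trace w = 0 := by
    rw [← integral_gelfand]
    refine integral_eq_zero_of_ae ?_
    filter_upwards [h] with φ hφ
    have h2 : gelfand (b - a) φ = gelfand b φ - gelfand a φ :=
      DFunLike.congr_fun (map_sub (gelfandStarTransform A.carrier) b a) φ
    rw [hw]
    change ((d (gelfand (b - a) φ) : ℝ) : ℂ) = 0
    rw [h2, (hd1 _).2 (sub_nonneg.2 hφ), Complex.ofReal_zero]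
  have := eq_zero_of_trace_nonpos hw0 (by rw [ht, Complex.zero_re])
  rw [← sub_nonneg, nonneg_iff_characters]
  intro φ
  rw [← hd1]
  have h3 := hw1 φ
  rw [this, map_zero] at h3
  exact_mod_cast h3.symm

theorem eq_of_ae_eq {a b : A.carrier} (h : gelfand a =ᵐ[A.spec.μ] gelfand b) : a = b :=
  le_antisymm (le_of_ae_le (h.mono fun _ hφ => hφ.le))
    (le_of_ae_le (h.mono fun _ hφ => hφ.ge))

/-- A function on the spectrum is represented by an element of the algebra if it agrees with its
Gelfand transform almost everywhere. -/
def IsRepresented (A : VonNeumannTau.{u}) (g : A.spec.carrier → ℂ) : Prop :=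
  ∃ a : A.carrier, gelfand a =ᵐ[A.spec.μ] g

namespace IsRepresented

theorem of_continuous (f : C(A.spec.carrier, ℂ)) : IsRepresented A f := by
  obtain ⟨a, rfl⟩ := exists_gelfand_eq f
  exact ⟨a, .rfl⟩

theorem const (c : ℂ) : IsRepresented A fun _ => c := of_continuous (.const _ c)

theorem add {f g : A.spec.carrier → ℂ} (hf : IsRepresented A f) (hg : IsRepresented A g) :
    IsRepresented A fun φ => f φ + g φ := by
  obtain ⟨a, ha⟩ := hf
  obtain ⟨b, hb⟩ := hg
  refine ⟨a + b, ?_⟩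
  rw [show gelfand (a + b) = gelfand a + gelfand b from map_add (gelfandStarTransform _) _ _]
  exact ha.add hb

theorem mul {f g : A.spec.carrier → ℂ} (hf : IsRepresented A f) (hg : IsRepresented A g) :
    IsRepresented A fun φ => f φ * g φ := by
  obtain ⟨a, ha⟩ := hf
  obtain ⟨b, hb⟩ := hg
  refine ⟨a * b, ?_⟩
  rw [show gelfand (a * b) = gelfand a * gelfand b from map_mul (gelfandStarTransform _) _ _]
  exact ha.mul hb

theorem sub {f g : A.spec.carrier → ℂ} (hf : IsRepresented A f) (hg : IsRepresented A g) :
    IsRepresented A fun φ => f φ - g φ := by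
  have := hf.add ((const (-1)).mul hg)
  simpa only [neg_one_mul, ← sub_eq_add_neg] using this

/-- The limit of a bounded increasing sequence of represented functions is represented. -/
theorem of_monotone {g : ℕ → A.spec.carrier → ℝ} {G : A.spec.carrier → ℝ} {M : ℝ}
    (hg : ∀ n, IsRepresented A fun φ => (g n φ : ℂ)) (hmono : ∀ φ, Monotone fun n => g n φ)
    (hM : ∀ n φ, g n φ ≤ M) (hG : ∀ φ, Tendsto (fun n => g n φ) atTop (𝓝 (G φ))) :
    IsRepresented A fun φ => (G φ : ℂ) := by
  choose a ha using hg
  have hamono : Monotone a := fun m n hmn => le_of_ae_le <| by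
    filter_upwards [ha m, ha n] with φ hm hn
    rw [hm, hn]
    exact Complex.real_le_real.2 (hmono φ hmn)
  obtain ⟨c, hc⟩ := exists_gelfand_eq (A := A) (.const _ (M : ℂ))
  have hac : ∀ n, a n ≤ c := fun n => le_of_ae_le <| by
    filter_upwards [ha n] with φ hn
    rw [hn, hc]
    exact Complex.real_le_real.2 (hM n φ)
  have hdir : DirectedOn (· ≤ ·) (Set.range a) := by
    rintro _ ⟨m, rfl⟩ _ ⟨n, rfl⟩
    exact ⟨_, ⟨max m n, rfl⟩, hamono (le_max_left m n), hamono (le_max_right m n)⟩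
  have _ := TracialVonNeumann.wstar (A := A.carrier)
  -- The transform of this supremum lies above every `g n` almost everywhere, but need not be their
  -- pointwise limit everywhere.
  obtain ⟨b, hb⟩ := exists_isLUB_of_directedOn (Set.range_nonempty a) hdir
    ⟨c, by rintro _ ⟨n, rfl⟩; exact hac n⟩
  refine ⟨b, ?_⟩
  have hint : ∀ n, Integrable (g n) A.spec.μ := fun n => by
    have := ((A.spec.integrable (gelfand (a n))).congr (ha n)).re
    simpa using this
  have hre : ∀ x : A.carrier, ∫ φ, (gelfand x φ).re ∂A.spec.μ = (A.trace x).re := fun x => by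
    rw [← integral_gelfand]
    exact integral_re (A.spec.integrable (gelfand x))
  have htr : Tendsto (fun n => (A.trace (a n)).re) atTop (𝓝 (A.trace b).re) := by
    refine tendsto_atTop_isLUB (fun m n hmn => trace_re_mono (hamono hmn)) ?_
    have := TracialVonNeumann.trace_normal (Set.range_nonempty a) hdir hb
    rwa [← Set.range_comp] at this
  have hle : ∀ n, ∀ᵐ φ ∂A.spec.μ, (g n φ : ℂ) ≤ gelfand b φ := fun n => by
    filter_upwards [ha n] with φ hn
    rw [← hn]
    exact le_iff_characters.1 (hb.1 ⟨n, rfl⟩) φ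
  -- By normality the integrals of `g n` converge to that of the dominating function `Re (gelfand
  -- b)`, which forces convergence almost everywhere.
  have hlim := tendsto_of_integral_tendsto_of_monotone hint
    (F := fun φ => (gelfand b φ).re) (A.spec.integrable (gelfand b)).re
    (by
      rw [hre]
      refine htr.congr fun n => ?_
      rw [← hre]
      refine integral_congr_ae ?_
      filter_upwards [ha n] with φ hn
      rw [hn, Complex.ofReal_re])
    (ae_of_all _ hmono)
    (by
      filter_upwards [ae_all_iff.2 hle] with φ hφ n
      simpa using (Complex.le_def.1 (hφ n)).1)
  filter_upwards [hlim, hle 0] with φ h1 h2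
  refine Complex.ext ?_ ?_
  · rw [Complex.ofReal_re]
    exact tendsto_nhds_unique h1 (hG φ)
  · rw [Complex.ofReal_im, ← (Complex.le_def.1 h2).2, Complex.ofReal_im]

/-- The sets with represented indicator functions. -/
abbrev measurableSpace (A : VonNeumannTau.{u}) : MeasurableSpace A.spec.carrier where
  MeasurableSet' S := IsRepresented A fun φ => ((S.indicator 1 φ : ℝ) : ℂ)
  measurableSet_empty := by simpa using const (A := A) 0
  measurableSet_compl S hS := by
    convert (const 1).sub hS using 2 with φ
    by_cases hφ : φ ∈ S <;> simp [hφ]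
  measurableSet_iUnion S hS := by
    refine of_monotone (M := 1) (g := fun n => (Set.accumulate S n).indicator 1) (fun n => ?_)
      (fun φ m n hmn => Set.indicator_le_indicator_of_subset (Set.monotone_accumulate hmn)
        (fun _ => zero_le_one) φ) (fun n φ => Set.indicator_le_self' (fun _ _ => zero_le_one) φ)
      (fun φ => ?_)
    · induction n with
      | zero => simpa [Set.accumulate_zero_nat] using hS 0
      | succ n ih =>
        -- The indicator of a union of two sets is `1 - (1 - x)(1 - y)` in terms of their
        -- indicators.
        convert (const 1).sub (((const 1).sub ih).mul ((const 1).sub (hS (n + 1)))) using 2 with φ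
        rw [Set.accumulate_succ]
        by_cases h1 : φ ∈ Set.accumulate S n <;> by_cases h2 : φ ∈ S (n + 1) <;> simp [h1, h2]
    · rw [← Set.iUnion_accumulate]
      exact (Set.monotone_accumulate.tendsto_indicator _ 1 φ).mono_right (pure_le_nhds _)

/-- The good sets form a `σ`-algebra, so it suffices to treat the complement of `f ⁻¹' F` with `f`
continuous and `F` closed. Its indicator is the increasing limit of the continuous functions `1 -
thickenedIndicator`. -/
theorem indicator {S : Set A.spec.carrier} (hS : MeasurableSet S) :
    IsRepresented A fun φ => ((S.indicator 1 φ : ℝ) : ℂ) := by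
  have hle : A.spec.meas ≤ measurableSpace A := by
    rw [A.spec.baire.eq_baire]
    refine iSup_le fun f => ?_
    rw [← measurable_iff_comap_le]
    refine @measurable_of_isClosed _ _ _ _ _ (measurableSpace A) _ fun F hF => ?_
    rw [← @MeasurableSet.compl_iff]
    have hδ : Tendsto (fun n : ℕ => 1 / ((n : ℝ) + 1)) atTop (𝓝 0) :=
      tendsto_one_div_add_atTop_nhds_zero_nat
    have hpos : ∀ n : ℕ, 0 < 1 / ((n : ℝ) + 1) := fun n => Nat.one_div_pos_of_nat
    refine of_monotone (M := 1) (A := A)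
      (g := fun n φ => 1 - (thickenedIndicator (hpos n) F (f φ) : ℝ)) (fun n => ?_)
      (fun φ m n hmn => ?_)
      (fun n φ => ?_) (fun φ => ?_)
    · exact of_continuous ⟨fun φ => ((1 - (thickenedIndicator (hpos n) F (f φ) : ℝ) : ℝ) : ℂ), by
        fun_prop⟩
    · refine sub_le_sub_left (NNReal.coe_le_coe.2 ?_) _
      exact thickenedIndicator_mono (hpos n) (hpos m) (Nat.one_div_le_one_div hmn) F _
    · simp
    · have h1 := tendsto_pi_nhds.1 (thickenedIndicator_tendsto_indicator_closure hpos hδ F) (f φ)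
      have h2 := ((NNReal.continuous_coe.tendsto _).comp h1).const_sub 1
      have h3 : 1 - (((closure F).indicator (fun _ => (1 : NNReal)) (f φ) : NNReal) : ℝ) =
          (f ⁻¹' F)ᶜ.indicator 1 φ := by
        rw [hF.closure_eq]
        by_cases hφ : f φ ∈ F <;> simp [hφ]
      exact h3 ▸ h2
  exact hle S hS

/-- The bound `M` is quantified inside the induction: summands and approximants of a function
bounded by `M` are again bounded by `M`, as `of_monotone` requires. -/
theorem of_ennreal {f : A.spec.carrier → ENNReal} (hf : Measurable f) :
    ∀ M : NNReal, (∀ φ, f φ ≤ M) → IsRepresented A fun φ => ((f φ).toReal : ℂ) := by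
  refine Measurable.ennreal_induction (motive := fun f => ∀ M : NNReal, (∀ φ, f φ ≤ M) →
    IsRepresented A fun φ => ((f φ).toReal : ℂ)) (fun c S hS => ?_) (fun f g _ _ _ h1 h2 => ?_)
    (fun f _ hmono h => ?_) hf
  · intro M _
    convert (const (c.toReal : ℂ)).mul (indicator hS) using 2 with φ
    by_cases hφ : φ ∈ S <;> simp [hφ]
  · intro M hM
    convert (h1 M fun φ => le_self_add.trans (hM φ)).add
      (h2 M fun φ => le_add_self.trans (hM φ)) using 2 with φ
    have hfg : f φ + g φ ≠ ⊤ := ((hM φ).trans_lt ENNReal.coe_lt_top).ne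
    rw [Pi.add_apply, ENNReal.toReal_add (ENNReal.add_ne_top.1 hfg).1 (ENNReal.add_ne_top.1 hfg).2,
      Complex.ofReal_add]
  · intro M hM
    have hM' : ∀ n φ, f n φ ≤ M := fun n φ => (le_iSup (fun n => f n φ) n).trans (hM φ)
    have hne : ∀ n φ, f n φ ≠ ⊤ := fun n φ => ((hM' n φ).trans_lt ENNReal.coe_lt_top).ne
    refine of_monotone (M := M) (fun n => h n M (hM' n))
      (fun φ m n hmn => ENNReal.toReal_mono (hne n φ) (hmono hmn φ))
      (fun n φ => ENNReal.toReal_mono ENNReal.coe_ne_top (hM' n φ)) (fun φ => ?_)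
    refine (ENNReal.tendsto_toReal ((hM φ).trans_lt ENNReal.coe_lt_top).ne).comp ?_
    exact tendsto_atTop_iSup fun m n hmn => hmono hmn φ

theorem of_real {f : A.spec.carrier → ℝ} (hf : Measurable f) {M : ℝ} (hM : ∀ φ, |f φ| ≤ M) :
    IsRepresented A fun φ => (f φ : ℂ) := by
  have h1 := of_ennreal hf.ennreal_ofReal M.toNNReal fun φ =>
    ENNReal.ofReal_le_ofReal ((le_abs_self _).trans (hM φ))
  have h2 := of_ennreal hf.neg.ennreal_ofReal M.toNNReal fun φ =>
    ENNReal.ofReal_le_ofReal ((neg_le_abs _).trans (hM φ))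
  convert h1.sub h2 using 2 with φ
  rw [← Complex.ofReal_sub, ENNReal.toReal_ofReal', Pi.neg_apply, ENNReal.toReal_ofReal']
  congr 1
  rcases le_total 0 (f φ) with h | h
  · rw [max_eq_left h, max_eq_right (neg_nonpos.2 h), sub_zero]
  · rw [max_eq_right h, max_eq_left (neg_nonneg.2 h), zero_sub, neg_neg]

theorem of_measurable {f : A.spec.carrier → ℂ} (hf : Measurable f) {M : ℝ} (hM : ∀ φ, ‖f φ‖ ≤ M) :
    IsRepresented A f := by
  have h1 := of_real (A := A) (Complex.measurable_re.comp hf)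
    fun φ => (Complex.abs_re_le_norm _).trans (hM φ)
  have h2 := of_real (A := A) (Complex.measurable_im.comp hf)
    fun φ => (Complex.abs_im_le_norm _).trans (hM φ)
  convert h1.add (h2.mul (const Complex.I)) using 2 with φ
  exact (Complex.re_add_im (f φ)).symm

end IsRepresented

end Order

end VonNeumannTau

/-- Forget the topology of a compact Hausdorff probability space. -/
def CHProb.toConc : CHProb.{u} ⥤ ConcProb.{u} where
  obj X := { carrier := X.carrier, μ := X.μ }
  map T := ConcProb.Hom.mk T.toMap T.measurePreserving

namespace VonNeumannTau

/-- The Gelfand transform as a map to the `L^∞` algebra of the spectrum. -/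
def gelfandConc (A : VonNeumannTau.{u}) :
    A.carrier →⋆ₐ[ℂ] ConcLinfty (CHProb.toConc.obj A.spec) where
  toFun a := ConcLinfty.mk ⟨gelfand a, A.spec.measurable_continuousMap _, ‖gelfand a‖,
    (gelfand a).norm_coe_le_norm⟩
  map_one' := congrArg ConcLinfty.mk (Subtype.ext
    (congrArg DFunLike.coe (map_one (gelfandStarTransform A.carrier))))
  map_mul' a b := congrArg ConcLinfty.mk (Subtype.ext
    (congrArg DFunLike.coe (map_mul (gelfandStarTransform A.carrier) a b)))
  map_zero' := congrArg ConcLinfty.mk (Subtype.ext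
    (congrArg DFunLike.coe (map_zero (gelfandStarTransform A.carrier))))
  map_add' a b := congrArg ConcLinfty.mk (Subtype.ext
    (congrArg DFunLike.coe (map_add (gelfandStarTransform A.carrier) a b)))
  commutes' c := by
    rw [Algebra.algebraMap_eq_smul_one c, Algebra.algebraMap_eq_smul_one c]
    refine congrArg ConcLinfty.mk (Subtype.ext ?_)
    refine (congrArg DFunLike.coe (map_smul (gelfandStarTransform A.carrier) c 1)).trans ?_
    rw [map_one]
    rfl
  map_star' a := congrArg ConcLinfty.mk (Subtype.ext
    (congrArg DFunLike.coe (map_star (gelfandStarTransform A.carrier) a)))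

/-- Injectivity is faithfulness of the trace; surjectivity says that bounded Baire functions are
almost everywhere continuous ones, which rests on its normality and on the predual. -/
theorem gelfandConc_bijective (A : VonNeumannTau.{u}) : Function.Bijective A.gelfandConc := by
  refine ⟨fun a b h => eq_of_ae_eq (ConcLinfty.mk_eq.1 h), fun f => ?_⟩
  obtain ⟨f, rfl⟩ := ConcLinfty.mk_surjective f
  obtain ⟨M, hM⟩ := f.2.2
  obtain ⟨a, ha⟩ := IsRepresented.of_measurable (A := A) f.2.1 hM
  exact ⟨a, ConcLinfty.mk_eq.2 ha⟩

end VonNeumannTau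

/-- A tracial von Neumann algebra is the `L^∞` algebra of its spectrum, naturally. -/
def specConcLinftyIso : VonNeumannTau.forget.{u}.op ⋙ rieszWellDefined.{u}.functor ⋙
    CHProb.toConc.{u} ⋙ concLinftyWellDefined.{u}.functor ≅ 𝟭 VonNeumannTau.{u}ᵒᵖ :=
  NatIso.ofComponents
    (fun A => (VonNeumannTau.isoOfBijective (A := A.unop)
      (B := (concLinftyWellDefined.{u}.functor.obj (CHProb.toConc.obj A.unop.spec)).unop)
      (VonNeumannTau.homOfTrace (A := A.unop)
        (B := (concLinftyWellDefined.{u}.functor.obj (CHProb.toConc.obj A.unop.spec)).unop)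
        A.unop.gelfandConc VonNeumannTau.integral_gelfand)
      A.unop.gelfandConc_bijective).op)
    (fun Φ => Quiver.Hom.unop_inj (VonNeumannTau.hom_ext fun _ =>
      ((concLinftyWellDefined.{u}.koopman_isHom (CHProb.toConc.map
        (rieszWellDefined.{u}.functor.map (VonNeumannTau.forget.op.map Φ)))).choose_spec _).trans
        rfl))

end CanonicalModel
end

noncomputable section
namespace CanonicalModel

/-! ### The duality between probability algebras and tracial von Neumann algebras -/

/-- The probability algebra of the spectrum of a tracial von Neumann algebra. -/
def specAlg : VonNeumannTau.{u}ᵒᵖ ⥤ ProbAlg.{u} :=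
  VonNeumannTau.forget.{u}.op ⋙ rieszWellDefined.{u}.functor ⋙ CHProb.toConc.{u} ⋙
    abstraction.{u} ⋙ mes.{u}

/-- A tracial von Neumann algebra is the `L^∞` algebra of the probability algebra of its
spectrum. -/
def specAlgLinftyIso : specAlg.{u} ⋙ linftyWellDefined.{u}.functor ≅ 𝟭 VonNeumannTau.{u}ᵒᵖ :=
  Functor.isoWhiskerLeft (VonNeumannTau.forget.{u}.op ⋙ rieszWellDefined.{u}.functor ⋙
    CHProb.toConc.{u}) absLinftyIso ≪≫ specConcLinftyIso

/-- The projections of a tracial von Neumann algebra form the probability algebra of its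
spectrum. -/
def idemIsoSpecAlg : idemWellDefined.{u}.functor ≅ specAlg.{u} :=
  (Functor.isoWhiskerRight specAlgLinftyIso.{u} idemWellDefined.{u}.functor).symm ≪≫
    Functor.isoWhiskerLeft specAlg.{u} linftyIdemIso.{u}

/-- A tracial von Neumann algebra is the `L^∞` algebra of its algebra of projections. -/
def idemLinftyIso : idemWellDefined.{u}.functor ⋙ linftyWellDefined.{u}.functor ≅
    𝟭 VonNeumannTau.{u}ᵒᵖ :=
  Functor.isoWhiskerRight idemIsoSpecAlg.{u} linftyWellDefined.{u}.functor ≪≫ specAlgLinftyIso.{u}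

/-- A functor with an inverse up to natural isomorphism is full and faithful. -/
theorem faithful_and_full_of_iso {C D : Type*} [Category* C] [Category* D] {F : C ⥤ D} {G : D ⥤ C}
    (e : F ⋙ G ≅ 𝟭 C) (e' : G ⋙ F ≅ 𝟭 D) : F.Faithful ∧ F.Full :=
  have : F.IsEquivalence := (CategoryTheory.Equivalence.mk F G e.symm e').isEquivalence_functor
  ⟨inferInstance, inferInstance⟩

end CanonicalModel
end

/-! ### Assembly of the diagram. -/

theorem theorem6p2 :
    ∃ (wC : ConcLinftyWellDefined.{u}) (wL : LinftyWellDefined.{u})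
      (wI : IdemWellDefined.{u}) (wR : RieszWellDefined.{u}),
      -- the indicated faithfulness and fullness properties
      (VonNeumannTau.forget.{u}.op.Faithful ∧ VonNeumannTau.forget.{u}.op.Full) ∧
      (wL.functor.Faithful ∧ wL.functor.Full) ∧
      (wI.functor.Faithful ∧ wI.functor.Full) ∧
      (CHProb.cfunc.{u}.Faithful ∧ CHProb.cfunc.{u}.Full) ∧
      (wR.functor.Faithful ∧ wR.functor.Full) ∧
      ((stone wL wR).Faithful ∧ (stone wL wR).Full) ∧
      -- commutativity of the left part of the diagram
      Nonempty (wC.functor ≅ abstraction ⋙ wL.absFunctor) ∧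
      Nonempty (wL.absFunctor ≅ mes ⋙ wL.functor) ∧
      -- the duality between probability algebras and tracial commutative von Neumann algebras
      Nonempty (wL.functor ⋙ wI.functor ≅ 𝟭 ProbAlg.{u}) ∧
      Nonempty (wI.functor ⋙ wL.functor ≅ 𝟭 VonNeumannTau.{u}ᵒᵖ) ∧
      -- the duality between compact Hausdorff probability spaces and tracial `C⋆`-algebras
      Nonempty (CHProb.cfunc.{u} ⋙ wR.functor ≅ 𝟭 CHProb.{u}) ∧
      Nonempty (wR.functor ⋙ CHProb.cfunc.{u} ≅ 𝟭 CStarTau.{u}ᵒᵖ) ∧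
      -- commutativity of the right part of the diagram
      Nonempty (stone wL wR ≅ wL.functor ⋙ VonNeumannTau.forget.op ⋙ wR.functor) ∧
      Nonempty (stone wL wR ⋙ CHProb.cfunc ≅ wL.functor ⋙ VonNeumannTau.forget.op) ∧
      Nonempty (wI.functor ⋙ stone wL wR ≅ VonNeumannTau.forget.op ⋙ wR.functor) ∧
      Nonempty (wI.functor ⋙ stone wL wR ⋙ CHProb.cfunc ≅ VonNeumannTau.forget.op) := by
  have hL := faithful_and_full_of_iso linftyIdemIso.{u} idemLinftyIso.{u}
  have hR := faithful_and_full_of_iso (rieszCfuncIso rieszWellDefined.{u})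
    (cfuncRieszIso rieszWellDefined.{u})
  -- Put in scope as instances, so that the composite `stone` inherits fullness and faithfulness.
  have := hL.1
  have := hL.2
  have := hR.1
  have := hR.2
  -- The Riesz functor at the end of `stone` cancels against continuous functions.
  let stoneCfuncIso : stone linftyWellDefined.{u} rieszWellDefined.{u} ⋙ CHProb.cfunc.{u} ≅
      linftyWellDefined.{u}.functor ⋙ VonNeumannTau.forget.{u}.op :=
    Functor.isoWhiskerLeft (linftyWellDefined.{u}.functor ⋙ VonNeumannTau.forget.{u}.op)
      (rieszCfuncIso rieszWellDefined.{u})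
  refine ⟨concLinftyWellDefined, linftyWellDefined, idemWellDefined, rieszWellDefined,
    ⟨inferInstance, inferInstance⟩, hL, faithful_and_full_of_iso idemLinftyIso linftyIdemIso,
    faithful_and_full_of_iso (cfuncRieszIso rieszWellDefined) (rieszCfuncIso rieszWellDefined),
    hR, ⟨?_, ?_⟩,
    ⟨absLinftyIso.symm⟩, ⟨Iso.refl _⟩, ⟨linftyIdemIso⟩, ⟨idemLinftyIso⟩,
    ⟨cfuncRieszIso rieszWellDefined⟩,
    ⟨rieszCfuncIso rieszWellDefined⟩, ⟨Iso.refl _⟩, ⟨stoneCfuncIso⟩, ⟨?_⟩, ⟨?_⟩⟩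
  · unfold stone
    infer_instance
  · unfold stone
    infer_instance
  · exact Functor.isoWhiskerRight idemLinftyIso
      (VonNeumannTau.forget.op ⋙ rieszWellDefined.functor)
  · exact Functor.isoWhiskerLeft idemWellDefined.functor stoneCfuncIso ≪≫
      Functor.isoWhiskerRight idemLinftyIso VonNeumannTau.forget.op
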